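/- **Setting.** A *fullerene* is a finite connected cubic map on the oriented sphere all of whose faces (rings) are pentagons or hexagons. Its dual is a triangulation of the sphere; making every dual triangle an equilateral triangle of side $1$ turns the sphere into a surface that is flat except at the centres of the pentagons. Put $\omega=e^{2\pi i/6}$ and let $\mathbb Z[\omega]$ be the Eisenstein lattice. The *Coxeter coordinates* of a nonzero lattice vector $z$ are the integers $a>0$, $b\ge 0$ with $z=\omega^j(a+b\omega)$ for some $j$. A *decomposition into lattice triangles* of the surface of a fullerene is a decomposition into finitely many nondegenerate flat triangles (facets), glued edge to edge, each of which unfolds onto the Eisenstein plane (the dual triangulation unfolding to the triangular lattice) with its three corners at lattice points. It is a *master polyhedron* of the fullerene if its vertices are centres of pentagons (they are then the centres of all pentagons); its edges are the *master edges*, and the Coxeter coordinates of a master edge are those of its vector in the unfolding. For integers $k,l\ge 0$, not both $0$, a fullerene $F$ arises from a fullerene $F_0$ by the *Goldberg–Coxeter transformation* $(k,l)$ if each triangle of the dual of $F_0$ is replaced by an equilateral lattice triangle with side vector $k+l\omega$ (up to rotation by multiples of $60^\circ$), that is, if the surface of $F$ has a decomposition into lattice triangles that is combinatorially the dual of $F_0$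 and all of whose facets are such triangles. $F$ is a *G-C fullerene* if it arises in this way from some fullerene (its archetype) with $k^2+kl+l^2>1$. The transformation $(k,0)$ is called *$k$-inflation*. **Theorem 1.** Let $F$ be a fullerene with a master polyhedron $P$, and let $k>1$ be an integer that divides both Coxeter coordinates of every master edge of $P$. Then $F$ is a G-C fullerene. More precisely, there is a fullerene $F_0$ that has a master polyhedron $P_0$ with the same combinatorial structure as $P$, such that the Coxeter coordinates $(a',b')$ of each edge of $P$ and the coordinates $(a,b)$ of the corresponding edge of $P_0$ satisfy $(a',b')=(ka,kb)$, and $F$ arises from $F_0$ by $k$-inflation. -/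

import Mathlib

universe u v

/-! ### The Eisenstein plane -/

/-- The Eisenstein integers `a + b ω`, where `ω ^ 2 = ω - 1`, that is `ω = exp (2 π i / 6)`. -/
abbrev Eisenstein : Type := QuadraticAlgebra ℤ (-1) 1

namespace Eisenstein

/-- The sixth root of unity `ω`, as a unit of the ring of Eisenstein integers (its inverse is
`1 - ω`).  The units of this ring are exactly the six unit vectors `1, ω, …, ω ^ 5`. -/
def omega : Eisensteinˣ where
  val := ⟨0, 1⟩
  inv := ⟨1, -1⟩
  val_inv := by ext <;> simp [QuadraticAlgebra.re_one, QuadraticAlgebra.im_one]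
  inv_val := by ext <;> simp [QuadraticAlgebra.re_one, QuadraticAlgebra.im_one]

/-- The point of the Euclidean plane `ℂ` represented by an Eisenstein integer. -/
noncomputable def toComplex (z : Eisenstein) : ℂ :=
  z.re + z.im * Complex.exp (2 * Real.pi * Complex.I / 6)

/-- The Coxeter coordinates of a nonzero lattice vector `z`: the pair `(a, b)` of natural numbers
with `0 < a` such that `z` is `a + b ω` up to a rotation by a multiple of `60°`.  The six
branches correspond to the six sectors of the plane; by convention the value at `0` is `(0, 0)`. -/
def coxeter (z : Eisenstein) : ℕ × ℕ :=
  if 0 < z.re ∧ 0 ≤ z.im then (z.re.toNat, z.im.toNat)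
  else if z.re ≤ 0 ∧ 0 < z.re + z.im then ((z.re + z.im).toNat, (-z.re).toNat)
  else if 0 < z.im ∧ z.re + z.im ≤ 0 then (z.im.toNat, (-z.re - z.im).toNat)
  else if z.re < 0 ∧ z.im ≤ 0 then ((-z.re).toNat, (-z.im).toNat)
  else if 0 ≤ z.re ∧ z.re + z.im < 0 then ((-z.re - z.im).toNat, z.re.toNat)
  else ((-z.im).toNat, (z.re + z.im).toNat)

theorem coxeter_spec (z : Eisenstein) (hz : z ≠ 0) :
    0 < (coxeter z).1 ∧
      ∃ j : ℕ, z = ((omega ^ j : Eisensteinˣ) : Eisenstein) *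
        ⟨((coxeter z).1 : ℤ), ((coxeter z).2 : ℤ)⟩ := by
  obtain ⟨a, b⟩ := z
  have hab : ¬ (a = 0 ∧ b = 0) := by
    rintro ⟨rfl, rfl⟩
    exact hz rfl
  unfold coxeter
  dsimp only
  split_ifs with h1 h2 h3 h4 h5
  · refine ⟨by lia, 0, ?_⟩
    ext <;> simp [omega] <;> lia
  · refine ⟨by lia, 1, ?_⟩
    ext <;> simp [omega] <;> lia
  · refine ⟨by lia, 2, ?_⟩
    ext <;> simp [omega, pow_succ] <;> lia
  · refine ⟨by lia, 3, ?_⟩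
    ext <;> simp [omega, pow_succ] <;> lia
  · refine ⟨by lia, 4, ?_⟩
    ext <;> simp [omega, pow_succ] <;> lia
  · refine ⟨by lia, 5, ?_⟩
    ext <;> simp [omega, pow_succ] <;> lia

end Eisenstein

/-- The cross product of two vectors of the plane; it is positive when `w` lies to the left
of `z`. -/
noncomputable def cross (z w : ℂ) : ℝ := z.re * w.im - z.im * w.re

/-- The open triangle with corners `A`, `B`, `C` in counterclockwise order. -/
def openTriangle (A B C : ℂ) : Set ℂ :=
  {p | 0 < cross (B - A) (p - A) ∧ 0 < cross (C - B) (p - B) ∧ 0 < cross (A - C) (p - C)}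

/-- The closed triangle with corners `A`, `B`, `C` in counterclockwise order. -/
def closedTriangle (A B C : ℂ) : Set ℂ :=
  {p | 0 ≤ cross (B - A) (p - A) ∧ 0 ≤ cross (C - B) (p - B) ∧ 0 ≤ cross (A - C) (p - C)}

/-! ### Triangulated surfaces -/

/-- A closed oriented surface cut into triangles, given by its darts (directed edges):
`flip` reverses a dart, and `next` leads from a dart to the following one along the boundary of
the triangle on its left.  Triangles are the orbits of `next`. -/
structure TriSurface (M : Type*) where
  flip : Equiv.Perm M
  next : Equiv.Perm M
  flip_flip : ∀ m, flip (flip m) = m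
  flip_ne : ∀ m, flip m ≠ m
  next_next_next : ∀ m, next (next (next m)) = m
  next_ne : ∀ m, next m ≠ m

/-- A directed edge of the triangular lattice of the plane: its starting point, and its direction,
which is one of the six unit vectors. -/
abbrev PlaneDart : Type := Eisenstein × Eisensteinˣ

namespace PlaneDart

/-- The starting point of a lattice dart. -/
def tail (x : PlaneDart) : Eisenstein := x.1

/-- The end point of a lattice dart. -/
def head (x : PlaneDart) : Eisenstein := x.1 + x.2

/-- The reversed lattice dart. -/
def flip (x : PlaneDart) : PlaneDart := (x.1 + x.2, -x.2)

/-- The following dart along the lattice triangle to the left. -/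
def next (x : PlaneDart) : PlaneDart := (x.1 + x.2, Eisenstein.omega ^ 2 * x.2)

/-- The point of the lattice triangle to the left of the dart `x` that corresponds to the point
`p` of the standard triangle `0, 1, ω` under the rigid motion taking the dart `0 → 1` to `x`. -/
noncomputable def place (x : PlaneDart) (p : ℂ) : ℂ :=
  Eisenstein.toComplex x.1 + Eisenstein.toComplex x.2 * p

end PlaneDart

/-- The standard open triangle with corners `0, 1, ω`. -/
noncomputable def stdOpen : Set ℂ :=
  openTriangle 0 1 (Eisenstein.toComplex Eisenstein.omega)

/-- The standard closed triangle with corners `0, 1, ω`. -/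
noncomputable def stdClosed : Set ℂ :=
  closedTriangle 0 1 (Eisenstein.toComplex Eisenstein.omega)

/-- The interior of the lattice triangle to the left of the dart `x` meets the interior of the
triangle with corners `A`, `B`, `C` in counterclockwise order. -/
def Meets (A B C : Eisenstein) (x : PlaneDart) : Prop :=
  (x.place '' stdOpen ∩ openTriangle A.toComplex B.toComplex C.toComplex).Nonempty

/-! ### Fullerenes -/

/-- The number of cycles of a permutation (fixed points included). -/
noncomputable def numCycles {D : Type*} (π : Equiv.Perm D) : ℕ :=
  Nat.card (Quotient (Equiv.Perm.SameCycle.setoid π))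

/-- A fullerene: a finite connected cubic map on the sphere all of whose faces (rings) are
pentagons or hexagons.  The map is given by its darts (directed bonds): `flip` reverses a dart,
`rot` turns a dart counterclockwise around the atom from which it starts, and `rot⁻¹ * flip` leads
to the following dart along the boundary of the ring on the left. -/
structure Fullerene (D : Type*) where
  finite : Finite D
  rot : Equiv.Perm D
  flip : Equiv.Perm D
  flip_flip : ∀ d, flip (flip d) = d
  flip_ne : ∀ d, flip d ≠ d
  /-- every atom has exactly three bonds -/
  rot_rot_rot : ∀ d, rot (rot (rot d)) = d
  rot_ne : ∀ d, rot d ≠ d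
  /-- every ring has five or six sides -/
  ring_size : ∀ d, Function.minimalPeriod (rot⁻¹ * flip) d = 5 ∨
    Function.minimalPeriod (rot⁻¹ * flip) d = 6
  connected : MulAction.IsPretransitive (Subgroup.closure {rot, flip}) D
  /-- Euler's formula: the surface is a sphere -/
  euler : (numCycles rot : ℤ) - numCycles flip + numCycles (rot⁻¹ * flip) = 2

namespace Fullerene

variable {D : Type*}

/-- The permutation of the darts that goes counterclockwise around the rings. -/
def ring (F : Fullerene D) : Equiv.Perm D := F.rot⁻¹ * F.flip

/-- The dart `d` has a pentagon on its left. -/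
def OnPentagon (F : Fullerene D) (d : D) : Prop := Function.minimalPeriod F.ring d = 5

/-- The dual of a fullerene, a triangulation of the sphere.  The dart `d` is now read as the
directed edge that starts at the centre of the ring on the left of the bond `d` and crosses this
bond.  Turning counterclockwise around a vertex of the dual is `ring`; the triangles correspond to
the atoms. -/
def dual (F : Fullerene D) : TriSurface D where
  flip := F.flip
  next := F.ring⁻¹ * F.flip
  flip_flip := F.flip_flip
  flip_ne := F.flip_ne
  next_next_next := by
    have h : F.flip⁻¹ = F.flip := by
      ext d
      rw [Equiv.Perm.inv_eq_iff_eq, F.flip_flip]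
    intro m
    simp [ring, h, F.flip_flip, F.rot_rot_rot]
  next_ne := by
    have h : F.flip⁻¹ = F.flip := by
      ext d
      rw [Equiv.Perm.inv_eq_iff_eq, F.flip_flip]
    intro m hm
    apply F.rot_ne (F.flip m)
    have := congrArg F.flip hm
    simpa [ring, h, F.flip_flip] using this

end Fullerene

/-! ### Cutting a fullerene into flat lattice triangles -/

/-- A decomposition of the surface of the fullerene `F` into flat triangular facets that are glued
edge to edge according to the combinatorial surface `S`.  The surface of `F` is made of
equilateral triangles of side `1`, one for each triangle of the dual of `F`.

Each facet is unfolded onto the Eisenstein plane, with its corners at lattice points.  The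
unfolding is recorded by the map `dev`, which tells for each dart of the lattice triangles that
meet the interior of the unfolded facet which dart of `F` it comes from. -/
structure FacetDecomposition {D M : Type*} (F : Fullerene D) (S : TriSurface M) where
  /-- the starting point of the edge `m` in the unfolding of the facet on the left of `m` -/
  corner : M → Eisenstein
  /-- the unfolding of the facet on the left of `m` -/
  dev : M → PlaneDart → D
  /-- the unfolded facets are nondegenerate and positively oriented -/
  ccw : ∀ m, 0 < cross
    ((corner (S.next m)).toComplex - (corner m).toComplex)
    ((corner (S.next (S.next m))).toComplex - (corner m).toComplex)
  /-- the unfolding depends on the facet only -/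
  dev_next : ∀ m, dev (S.next m) = dev m
  /-- lattice triangles that meet the interior of the facet come from triangles of the dual -/
  dev_plane_next : ∀ m x,
    Meets (corner m) (corner (S.next m)) (corner (S.next (S.next m))) x →
    dev m x.next = F.dual.next (dev m x)
  /-- neighbouring lattice triangles that meet the interior of the facet come from triangles that
  are neighbours in the same way -/
  dev_plane_flip : ∀ m x,
    Meets (corner m) (corner (S.next m)) (corner (S.next (S.next m))) x →
    Meets (corner m) (corner (S.next m)) (corner (S.next (S.next m))) x.flip →
    dev m x.flip = F.dual.flip (dev m x)
  /-- the facets on the two sides of an edge `m` fit together: there is a rotation `u` such that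
  the rigid motion `z ↦ corner (next m) + u (z - corner (flip m))` moves the unfolded facet on the
  other side to the other side of the unfolded edge `m`, and there the two unfoldings continue
  each other across the interior of this edge -/
  glue : ∀ m, ∃ u : Eisensteinˣ,
    u * (corner (S.next (S.flip m)) - corner (S.flip m)) = corner m - corner (S.next m) ∧
    ∀ x y : PlaneDart,
      Meets (corner m) (corner (S.next m)) (corner (S.next (S.next m))) x →
      Meets (corner (S.flip m)) (corner (S.next (S.flip m)))
        (corner (S.next (S.next (S.flip m)))) y →
      (segment ℝ x.tail.toComplex x.head.toComplex ∩
        openSegment ℝ (corner m).toComplex (corner (S.next m)).toComplex).Nonempty →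
      ((corner (S.next m) + u * (y.1 - corner (S.flip m)), u * y.2) = x →
        dev (S.flip m) y = dev m x) ∧
      ((corner (S.next m) + u * (y.1 - corner (S.flip m)), u * y.2) = x.flip →
        dev (S.flip m) y = F.dual.flip (dev m x))
  /-- the closed facets cover the surface -/
  cover : ∀ d : D, ∀ p ∈ stdClosed, ∃ m x, dev m x = d ∧
    Meets (corner m) (corner (S.next m)) (corner (S.next (S.next m))) x ∧
    PlaneDart.place x p ∈ closedTriangle (corner m).toComplex
      (corner (S.next m)).toComplex (corner (S.next (S.next m))).toComplex
  /-- the interiors of the facets are embedded and pairwise disjoint -/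
  disjoint : ∀ m m' x x', dev m x = dev m' x' → ∀ p ∈ stdOpen,
    PlaneDart.place x p ∈ openTriangle (corner m).toComplex
      (corner (S.next m)).toComplex (corner (S.next (S.next m))).toComplex →
    PlaneDart.place x' p ∈ openTriangle (corner m').toComplex
      (corner (S.next m')).toComplex (corner (S.next (S.next m'))).toComplex →
    S.next.SameCycle m m' ∧ x = x'

namespace FacetDecomposition

variable {D M : Type*} {F : Fullerene D} {S : TriSurface M}

/-- The vector of the edge `m` in the unfolding of the facet on its left. -/
def vec (P : FacetDecomposition F S) (m : M) : Eisenstein := P.corner (S.next m) - P.corner m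

/-- The facet decomposition is a master polyhedron of the fullerene: its vertices are centres
of pentagons. (As facets and open edges are flat, every pentagon then is a vertex.) -/
def IsMaster (P : FacetDecomposition F S) : Prop :=
  ∀ m x, Meets (P.corner m) (P.corner (S.next m)) (P.corner (S.next (S.next m))) x →
    x.tail = P.corner m → F.OnPentagon (P.dev m x)

end FacetDecomposition

/-! ### Goldberg-Coxeter transformations -/

/-- The fullerene `F` results from the fullerene `F₀` by the Goldberg-Coxeter transformation
`(k, l)`: each triangle of the dual of `F₀` is replaced by the graphene patch `(k, l)`, the
equilateral triangle in the lattice whose sides are `k + l ω` up to rotations by multiples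
of `60°`. -/
def IsGoldbergCoxeter {D₀ D : Type*} (k l : ℕ) (F₀ : Fullerene D₀) (F : Fullerene D) : Prop :=
  ∃ P : FacetDecomposition F F₀.dual, ∀ d, ∃ u : Eisensteinˣ,
    P.vec d = u * (⟨(k : ℤ), (l : ℤ)⟩ : Eisenstein)

/-- A Goldberg-Coxeter fullerene is one that results from some fullerene by a nontrivial
Goldberg-Coxeter transformation, that is one with area scale factor `k² + k l + l² > 1`. -/
def Fullerene.IsGoldbergCoxeterFullerene {D : Type u} (F : Fullerene D) : Prop :=
  ∃ (k l : ℕ) (D₀ : Type u) (F₀ : Fullerene D₀),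
    1 < k ^ 2 + k * l + l ^ 2 ∧ IsGoldbergCoxeter k l F₀ F

/-! In the unfolding of a facet of `P`, measure the starting point of a dart from a corner of the
facet, modulo `k`, in the frame in which the dart has direction `1`. Since `k` divides all edge
vectors, the residue depends neither on the corner nor on the facet in which the dart is seen, so
every dart of `F` gets a label in `ℤ[ω]/k` (`exists_latticeLabelling`). That the label is well
defined is a matter of connectedness: one lattice triangle may be cut up by several facets, but the
label is locally constant while a point moves through it (`exists_label_locally`,
`label_eq_of_dev_eq`). Reversal acts on labels by `v ↦ -(v + 1)` and rotation about a vertex of the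
dual by `v ↦ ω⁻¹ v`.

At a pentagon five rotations return to the same dart, so `ω⁵ v = v`; as `1 - ω⁵ = ω` is a unit, `v =
0` (`val_eq_zero_of_ring_pow_five`). Thus every vertex of nonzero label is a hexagon. Starting from
a dart of label `0`, the lattice triangle with corners `0, k, k ω` can therefore be wrapped onto the
surface: its lattice points other than the corners have nonzero residues, so nothing obstructs the
unfolding (`transport_flip`).

The darts of label `0` are the darts of the archetype. Its rotation is that of `F`, and its reversal
traverses a straight path of `k` edges. Turning the patch of side `k` by a third of a turn shows
that its sides form triangles (`transport_bigNext`); the patches cover `F` (`exists_inPatch`) and do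
not overlap (`exists_iterate_of_transport_eq`). Connectedness is inherited from `F` by following
patches across their sides. For Euler's formula, each dart contributes `1/3 - 1/2 + 1/5` at a
pentagon and `1/3 - 1/2 + 1/6 = 0` at a hexagon, so the characteristic is a thirtieth of the number
of pentagon darts (`euler_eq`), and both maps have the same pentagon darts. The patches themselves
are the facets of the `k`-inflation (`cutting`).

The polyhedron descends by replacing the corners of each facet by their quotients by `k`; the
remainder is common to the whole facet. A dart of the shrunken facet is a side of a triangle of side
`k` in the original unfolding, and it is sent to the dart of the archetype whose patch unfolds onto
that triangle (`Unfolds`). Agreement at one small triangle is enough, because a patch and a facet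
meet in a convex set (`convex_induction`, `unfolds_of_eq`). Compatibility across edges is the
content of `IsGlue.unfolds_same` and `IsGlue.unfolds_flip`. -/

open Eisenstein Filter Topology

/-! ### Units of the Eisenstein integers and lattice coordinates of the plane -/

namespace Eisenstein

@[simp] theorem re_omega : (omega : Eisenstein).re = 0 := rfl
@[simp] theorem im_omega : (omega : Eisenstein).im = 1 := rfl
@[simp] theorem re_one : (1 : Eisenstein).re = 1 := rfl
@[simp] theorem im_one : (1 : Eisenstein).im = 0 := rfl

theorem omega_sq : (omega : Eisenstein) ^ 2 = omega - 1 := by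
  ext <;> simp [pow_two]

@[simp] theorem re_omega_sq : ((omega : Eisenstein) ^ 2).re = -1 := by simp [pow_two]
@[simp] theorem im_omega_sq : ((omega : Eisenstein) ^ 2).im = 1 := by simp [pow_two]

theorem omega_cube : omega ^ 3 = -1 := by
  ext <;> simp [pow_succ]

/-- The norm `a² + a b + b²` is multiplicative and nonnegative, so it is `1` on units; this confines
both coordinates to `-1, 0, 1`. -/
theorem unit_cases (u : Eisensteinˣ) :
    u = 1 ∨ u = omega ∨ u = omega ^ 2 ∨ u = -1 ∨ u = -omega ∨ u = -omega ^ 2 := by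
  obtain ⟨⟨a, b⟩, ⟨c, d⟩, h, -⟩ := u
  have h1 := congrArg QuadraticAlgebra.re h
  have h2 := congrArg QuadraticAlgebra.im h
  simp at h1 h2
  have hn : (a * a + a * b + b * b) * (c * c + c * d + d * d) = 1 := by
    have e : (a * a + a * b + b * b) * (c * c + c * d + d * d) =
      (a * c - b * d) ^ 2 + (a * c - b * d) * (a * d + b * c + b * d) +
        (a * d + b * c + b * d) ^ 2 := by ring
    have h1' : a * c - b * d = 1 := by linarith
    rw [e, h1', h2]; norm_num
  have hp : a * a + a * b + b * b = 1 := by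
    rcases Int.eq_one_or_neg_one_of_mul_eq_one hn with h | h
    · exact h
    · nlinarith [sq_nonneg (a + b), sq_nonneg a, sq_nonneg b]
  have ha : a ≤ 1 := by nlinarith [sq_nonneg (a + 2 * b)]
  have ha' : -1 ≤ a := by nlinarith [sq_nonneg (a + 2 * b)]
  have hb : b ≤ 1 := by nlinarith [sq_nonneg (b + 2 * a)]
  have hb' : -1 ≤ b := by nlinarith [sq_nonneg (b + 2 * a)]
  simp only [Units.ext_iff, QuadraticAlgebra.ext_iff]
  simp
  have : a = -1 ∨ a = 0 ∨ a = 1 := by lia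
  have : b = -1 ∨ b = 0 ∨ b = 1 := by lia
  rcases ‹a = -1 ∨ _› with rfl | rfl | rfl <;> rcases ‹b = -1 ∨ _› with rfl | rfl | rfl <;>
    simp at hp ⊢

theorem exp_sq : Complex.exp (2 * Real.pi * Complex.I / 6) ^ 2 =
    Complex.exp (2 * Real.pi * Complex.I / 6) - 1 := by
  have h : (2 * Real.pi * Complex.I / 6 : ℂ) = ((Real.pi / 3 : ℝ) : ℂ) * Complex.I := by
    push_cast; ring
  rw [h, Complex.exp_mul_I, ← Complex.ofReal_cos, ← Complex.ofReal_sin, Real.cos_pi_div_three,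
    Real.sin_pi_div_three]
  have h3 : ((√3 : ℝ) : ℂ) ^ 2 = 3 := by
    rw [← Complex.ofReal_pow, Real.sq_sqrt (by norm_num)]; norm_num
  push_cast
  ring_nf
  rw [h3, Complex.I_sq]
  ring

@[simp] theorem toComplex_add (z w : Eisenstein) :
    toComplex (z + w) = toComplex z + toComplex w := by
  simp [toComplex]; ring

@[simp] theorem toComplex_neg (z : Eisenstein) : toComplex (-z) = -toComplex z := by
  simp [toComplex]; ring

@[simp] theorem toComplex_mul (z w : Eisenstein) :
    toComplex (z * w) = toComplex z * toComplex w := by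
  have := exp_sq
  simp only [toComplex, QuadraticAlgebra.re_mul, QuadraticAlgebra.im_mul]
  push_cast
  linear_combination (-(z.im : ℂ) * w.im) * this

@[simp] theorem toComplex_zero : toComplex 0 = 0 := by simp [toComplex]
@[simp] theorem toComplex_one : toComplex 1 = 1 := by simp [toComplex]
@[simp] theorem toComplex_natCast (n : ℕ) : toComplex n = n := by simp [toComplex]

/-- The coordinate `a` of the point `a + b ω` of the plane, for real `a` and `b`. -/
noncomputable def lx (p : ℂ) : ℝ := p.re - p.im / √3

/-- The coordinate `b` of the point `a + b ω` of the plane, for real `a` and `b`. -/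
noncomputable def ly (p : ℂ) : ℝ := 2 * p.im / √3

theorem toComplex_re (z : Eisenstein) : (toComplex z).re = z.re + z.im / 2 := by
  have h : (2 * Real.pi * Complex.I / 6 : ℂ) = ((Real.pi / 3 : ℝ) : ℂ) * Complex.I := by
    push_cast; ring
  rw [toComplex, h, Complex.exp_mul_I, ← Complex.ofReal_cos, ← Complex.ofReal_sin,
    Real.cos_pi_div_three, Real.sin_pi_div_three]
  simp
  ring

theorem toComplex_im (z : Eisenstein) : (toComplex z).im = z.im * √3 / 2 := by
  have h : (2 * Real.pi * Complex.I / 6 : ℂ) = ((Real.pi / 3 : ℝ) : ℂ) * Complex.I := by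
    push_cast; ring
  rw [toComplex, h, Complex.exp_mul_I, ← Complex.ofReal_cos, ← Complex.ofReal_sin,
    Real.cos_pi_div_three, Real.sin_pi_div_three]
  simp
  ring

theorem sqrt_three_ne : √3 ≠ 0 := by positivity

@[simp] theorem lx_toComplex (z : Eisenstein) : lx (toComplex z) = z.re := by
  have := sqrt_three_ne
  rw [lx, toComplex_re, toComplex_im]; field_simp; ring

@[simp] theorem ly_toComplex (z : Eisenstein) : ly (toComplex z) = z.im := by
  have := sqrt_three_ne
  rw [ly, toComplex_im]; field_simp

@[simp] theorem lx_add (p q : ℂ) : lx (p + q) = lx p + lx q := by simp [lx]; ring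
@[simp] theorem ly_add (p q : ℂ) : ly (p + q) = ly p + ly q := by simp [ly]; ring
@[simp] theorem lx_sub (p q : ℂ) : lx (p - q) = lx p - lx q := by simp [lx]; ring
@[simp] theorem ly_sub (p q : ℂ) : ly (p - q) = ly p - ly q := by simp [ly]; ring
@[simp] theorem lx_ofReal_mul (t : ℝ) (p : ℂ) : lx (t * p) = t * lx p := by simp [lx]; ring
@[simp] theorem ly_ofReal_mul (t : ℝ) (p : ℂ) : ly (t * p) = t * ly p := by simp [ly]; ring
@[simp] theorem lx_natCast_mul (t : ℕ) (p : ℂ) : lx (t * p) = t * lx p := by simp [lx]; ring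
@[simp] theorem ly_natCast_mul (t : ℕ) (p : ℂ) : ly (t * p) = t * ly p := by simp [ly]; ring
@[simp] theorem lx_neg (p : ℂ) : lx (-p) = -lx p := by simp [lx]; ring
@[simp] theorem ly_neg (p : ℂ) : ly (-p) = -ly p := by simp [ly]; ring
@[simp] theorem lx_zero : lx 0 = 0 := by simp [lx]
@[simp] theorem ly_zero : ly 0 = 0 := by simp [ly]
@[simp] theorem lx_one : lx 1 = 1 := by simp [lx]
@[simp] theorem ly_one : ly 1 = 0 := by simp [ly]
@[simp] theorem lx_ofReal (t : ℝ) : lx t = t := by simp [lx]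
@[simp] theorem ly_ofReal (t : ℝ) : ly t = 0 := by simp [ly]

@[simp] theorem lx_toComplex_mul (z : Eisenstein) (p : ℂ) :
    lx (toComplex z * p) = z.re * lx p - z.im * ly p := by
  have h := sqrt_three_ne
  have h3 : √3 ^ 2 = 3 := Real.sq_sqrt (by norm_num)
  simp only [lx, ly, Complex.mul_re, Complex.mul_im, toComplex_re, toComplex_im]
  field_simp
  ring_nf
  simp only [h3]
  ring

@[simp] theorem ly_toComplex_mul (z : Eisenstein) (p : ℂ) :
    ly (toComplex z * p) = z.re * ly p + z.im * lx p + z.im * ly p := by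
  have h := sqrt_three_ne
  have h3 : √3 ^ 2 = 3 := Real.sq_sqrt (by norm_num)
  simp only [lx, ly, Complex.mul_im, toComplex_re, toComplex_im]
  field_simp
  ring

theorem ext_coords {p q : ℂ} (hx : lx p = lx q) (hy : ly p = ly q) : p = q := by
  have h := sqrt_three_ne
  have him : p.im = q.im := by
    simp only [ly] at hy
    field_simp at hy
    linarith
  simp only [lx, him] at hx
  exact Complex.ext (by linarith) him

theorem continuous_lx : Continuous lx := by unfold lx; fun_prop
theorem continuous_ly : Continuous ly := by unfold ly; fun_prop

theorem cross_eq (z w : ℂ) : cross z w = √3 / 2 * (lx z * ly w - ly z * lx w) := by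
  have h := sqrt_three_ne
  simp only [cross, lx, ly]
  field_simp
  ring

theorem cross_pos {z w : ℂ} : 0 < cross z w ↔ 0 < lx z * ly w - ly z * lx w := by
  rw [cross_eq]; exact mul_pos_iff_of_pos_left (by positivity)

theorem cross_nonneg {z w : ℂ} : 0 ≤ cross z w ↔ 0 ≤ lx z * ly w - ly z * lx w := by
  rw [cross_eq]; exact mul_nonneg_iff_of_pos_left (by positivity)

theorem cross_unit_mul (u : Eisensteinˣ) (z w : ℂ) :
    cross (toComplex u * z) (toComplex u * w) = cross z w := by
  simp only [cross_eq, lx_toComplex_mul, ly_toComplex_mul]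
  rcases unit_cases u with rfl | rfl | rfl | rfl | rfl | rfl <;> simp <;> ring

end Eisenstein


/-! ### Lattice darts as rigid motions, and the lattice triangles -/

theorem mem_stdOpen {p : ℂ} : p ∈ stdOpen ↔ 0 < lx p ∧ 0 < ly p ∧ lx p + ly p < 1 := by
  simp only [stdOpen, openTriangle, Set.mem_ofPred_eq, cross_pos]
  simp
  constructor <;> rintro ⟨a, b, c⟩ <;> refine ⟨?_, ?_, ?_⟩ <;> linarith

theorem mem_stdClosed {p : ℂ} : p ∈ stdClosed ↔ 0 ≤ lx p ∧ 0 ≤ ly p ∧ lx p + ly p ≤ 1 := by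
  simp only [stdClosed, closedTriangle, Set.mem_ofPred_eq, cross_nonneg]
  simp
  constructor <;> rintro ⟨a, b, c⟩ <;> refine ⟨?_, ?_, ?_⟩ <;> linarith

theorem exists_coords (a b : ℝ) : ∃ p : ℂ, lx p = a ∧ ly p = b := by
  refine ⟨a + toComplex omega * b, ?_, ?_⟩ <;> simp

namespace PlaneDart

@[ext] theorem ext {x y : PlaneDart} (h1 : x.1 = y.1) (h2 : x.2 = y.2) : x = y :=
  Prod.ext h1 h2

/-- The dart `0 → 1`. -/
def base : PlaneDart := (0, 1)

/-- The image of the lattice dart `x` under the rigid motion that takes the dart `0 → 1` to `g`. -/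
def comp (g x : PlaneDart) : PlaneDart := (g.1 + g.2 * x.1, g.2 * x.2)

/-- The dart to which `0 → 1` goes under the rigid motion that takes `g` to `0 → 1`. -/
def inv (g : PlaneDart) : PlaneDart := (-((g.2⁻¹ : Eisensteinˣ) * g.1), g.2⁻¹)

/-- Orientation preserving motions of the lattice act simply transitively on its darts, so a dart
stands for a motion and `comp` is the group law. As `next` and `flip` are right multiplications,
they commute with all motions. -/
theorem comp_assoc (g h x : PlaneDart) : comp (comp g h) x = comp g (comp h x) := by
  ext1
  · simp only [comp, Units.val_mul]; ring
  · simp only [comp, mul_assoc]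

@[simp] theorem comp_base (g : PlaneDart) : comp g base = g := by
  ext1 <;> simp [comp, base]

@[simp] theorem base_comp (g : PlaneDart) : comp base g = g := by
  ext1 <;> simp [comp, base]

@[simp] theorem inv_comp_self (g : PlaneDart) : comp (inv g) g = base := by
  ext1 <;> simp [comp, inv, base]

@[simp] theorem comp_inv_self (g : PlaneDart) : comp g (inv g) = base := by
  ext1 <;> simp [comp, inv, base]

@[simp] theorem inv_comp_comp (g x : PlaneDart) : comp (inv g) (comp g x) = x := by
  rw [← comp_assoc, inv_comp_self, base_comp]

@[simp] theorem comp_inv_comp (g x : PlaneDart) : comp g (comp (inv g) x) = x := by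
  rw [← comp_assoc, comp_inv_self, base_comp]

theorem comp_next (g x : PlaneDart) : comp g x.next = (comp g x).next := by
  ext1
  · simp only [comp, next, Units.val_mul]; ring
  · simp only [comp, next]; rw [mul_left_comm]

theorem comp_flip (g x : PlaneDart) : comp g x.flip = (comp g x).flip := by
  ext1
  · simp only [comp, flip, Units.val_mul]; ring
  · simp only [comp, flip, mul_neg]

@[simp] theorem flip_flip (x : PlaneDart) : x.flip.flip = x := by
  ext1 <;> simp [flip]

theorem next_next_next (x : PlaneDart) : x.next.next.next = x := by
  ext1
  · have h := omega_sq
    simp only [next, Units.val_mul, Units.val_pow_eq_pow_val]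
    linear_combination (x.2 : Eisenstein) * ((omega : Eisenstein) ^ 2 + omega + 1) * h
  · have h := omega_cube
    simp only [next, ← mul_assoc, ← pow_add]
    rw [show 2 + 2 + 2 = 3 * 2 from rfl, pow_mul, h]; simp

theorem iterate_next_comp (g x : PlaneDart) (i : ℕ) :
    next^[i] (comp g x) = comp g (next^[i] x) := by
  induction i with
  | zero => rfl
  | succ i ih => rw [Function.iterate_succ_apply', Function.iterate_succ_apply', ih, comp_next]

theorem iterate_next_three (x : PlaneDart) : next^[3] x = x := next_next_next x

theorem iterate_next_inverse (x : PlaneDart) {i : ℕ} (hi : i < 3) :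
    next^[3 - i] (next^[i] x) = x := by
  rw [← Function.iterate_add_apply, Nat.sub_add_cancel hi.le, iterate_next_three]

theorem place_comp (g x : PlaneDart) (p : ℂ) : (comp g x).place p = g.place (x.place p) := by
  simp [place, comp]; ring

@[simp] theorem place_base (p : ℂ) : base.place p = p := by simp [place, base]

@[simp] theorem place_inv_place (g : PlaneDart) (p : ℂ) : (inv g).place (g.place p) = p := by
  rw [← place_comp, inv_comp_self, place_base]

@[simp] theorem place_place_inv (g : PlaneDart) (p : ℂ) : g.place ((inv g).place p) = p := by
  rw [← place_comp, comp_inv_self, place_base]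

theorem continuous_place (x : PlaneDart) : Continuous x.place := by
  unfold place; fun_prop

theorem place_toComplex (x : PlaneDart) (z : Eisenstein) :
    x.place z.toComplex = (x.1 + x.2 * z).toComplex := by simp [place]

theorem place_zero (x : PlaneDart) : x.place 0 = x.tail.toComplex := by simp [place, tail]
theorem place_one (x : PlaneDart) : x.place 1 = x.head.toComplex := by simp [place, head]

theorem place_lineMap (x : PlaneDart) (p q : ℂ) (t : ℝ) :
    x.place (p + t * (q - p)) = x.place p + t * (x.place q - x.place p) := by
  simp [place]; ring

theorem cross_place (x : PlaneDart) (p q r s : ℂ) :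
    cross (x.place p - x.place q) (x.place r - x.place s) = cross (p - q) (r - s) := by
  rw [← cross_unit_mul x.2 (p - q)]
  simp only [place]; congr 1 <;> ring

theorem place_mem_openTriangle (g : PlaneDart) {A B C p : ℂ} :
    g.place p ∈ openTriangle (g.place A) (g.place B) (g.place C) ↔ p ∈ openTriangle A B C := by
  simp [openTriangle, cross_place]

theorem place_mem_closedTriangle (g : PlaneDart) {A B C p : ℂ} :
    g.place p ∈ closedTriangle (g.place A) (g.place B) (g.place C) ↔ p ∈ closedTriangle A B C := by
  simp [closedTriangle, cross_place]

/-- The open lattice triangle to the left of a dart. -/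
def tri (x : PlaneDart) : Set ℂ := x.place '' stdOpen

/-- The closed lattice triangle to the left of a dart. -/
def ctri (x : PlaneDart) : Set ℂ := x.place '' stdClosed

theorem mem_tri {x : PlaneDart} {p : ℂ} : p ∈ x.tri ↔ (inv x).place p ∈ stdOpen := by
  constructor
  · rintro ⟨q, hq, rfl⟩; simpa
  · intro h; exact ⟨_, h, by simp⟩

theorem mem_ctri {x : PlaneDart} {p : ℂ} : p ∈ x.ctri ↔ (inv x).place p ∈ stdClosed := by
  constructor
  · rintro ⟨q, hq, rfl⟩; simpa
  · intro h; exact ⟨_, h, by simp⟩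

theorem tri_comp (g x : PlaneDart) : (comp g x).tri = g.place '' x.tri := by
  simp only [tri, Set.image_image, place_comp]

theorem ctri_comp (g x : PlaneDart) : (comp g x).ctri = g.place '' x.ctri := by
  simp only [ctri, Set.image_image, place_comp]

theorem place_mem_tri_comp {g x : PlaneDart} {p : ℂ} : g.place p ∈ (comp g x).tri ↔ p ∈ x.tri := by
  rw [tri_comp]
  refine ⟨?_, fun h => ⟨p, h, rfl⟩⟩
  rintro ⟨q, hq, h⟩
  rw [← place_inv_place g p, ← h, place_inv_place]; exact hq

theorem place_mem_ctri_comp {g x : PlaneDart} {p : ℂ} :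
    g.place p ∈ (comp g x).ctri ↔ p ∈ x.ctri := by
  rw [ctri_comp]
  refine ⟨?_, fun h => ⟨p, h, rfl⟩⟩
  rintro ⟨q, hq, h⟩
  rw [← place_inv_place g p, ← h, place_inv_place]; exact hq

theorem next_eq_comp (x : PlaneDart) : x.next = comp x (1, omega ^ 2) := by
  ext1 <;> simp [next, comp, mul_comm]

theorem lx_place (x : PlaneDart) (p : ℂ) :
    lx (x.place p) = x.1.re + (x.2 : Eisenstein).re * lx p - (x.2 : Eisenstein).im * ly p := by
  simp [place]; ring

theorem ly_place (x : PlaneDart) (p : ℂ) :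
    ly (x.place p) = x.1.im + (x.2 : Eisenstein).re * ly p + (x.2 : Eisenstein).im * lx p
      + (x.2 : Eisenstein).im * ly p := by
  simp [place]; ring

theorem tri_next_subset (x : PlaneDart) : x.next.tri ⊆ x.tri := by
  rw [next_eq_comp, tri_comp]
  rintro _ ⟨_, ⟨p, hp, rfl⟩, rfl⟩
  refine ⟨_, ?_, rfl⟩
  rw [mem_stdOpen] at hp ⊢
  simp only [lx_place, ly_place]
  simp
  exact ⟨by linarith, by linarith, by linarith⟩

theorem ctri_next_subset (x : PlaneDart) : x.next.ctri ⊆ x.ctri := by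
  rw [next_eq_comp, ctri_comp]
  rintro _ ⟨_, ⟨p, hp, rfl⟩, rfl⟩
  refine ⟨_, ?_, rfl⟩
  rw [mem_stdClosed] at hp ⊢
  simp only [lx_place, ly_place]
  simp
  exact ⟨by linarith, by linarith, by linarith⟩

@[simp] theorem tri_next (x : PlaneDart) : x.next.tri = x.tri := by
  refine (tri_next_subset x).antisymm ?_
  -- Going twice more around the 3-cycle turns the inclusion into its converse.
  have h := (tri_next_subset x.next.next).trans (tri_next_subset x.next)
  rwa [next_next_next] at h

@[simp] theorem ctri_next (x : PlaneDart) : x.next.ctri = x.ctri := by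
  refine (ctri_next_subset x).antisymm ?_
  have h := (ctri_next_subset x.next.next).trans (ctri_next_subset x.next)
  rwa [next_next_next] at h

@[simp] theorem tri_iterate_next (x : PlaneDart) (i : ℕ) : (next^[i] x).tri = x.tri := by
  induction i with
  | zero => rfl
  | succ i ih => rw [Function.iterate_succ_apply', tri_next, ih]

@[simp] theorem ctri_iterate_next (x : PlaneDart) (i : ℕ) : (next^[i] x).ctri = x.ctri := by
  induction i with
  | zero => rfl
  | succ i ih => rw [Function.iterate_succ_apply', ctri_next, ih]

theorem isOpen_stdOpen : IsOpen stdOpen := by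
  have : stdOpen = {p | 0 < lx p} ∩ ({p | 0 < ly p} ∩ {p | lx p + ly p < 1}) := by
    ext p; exact mem_stdOpen
  rw [this]
  have h1 := continuous_lx
  have h2 := continuous_ly
  exact (isOpen_lt (by fun_prop) (by fun_prop)).inter
    ((isOpen_lt (by fun_prop) (by fun_prop)).inter (isOpen_lt (by fun_prop) (by fun_prop)))

theorem isOpen_tri (x : PlaneDart) : IsOpen x.tri := by
  have : x.tri = (inv x).place ⁻¹' stdOpen := by ext p; exact mem_tri
  rw [this]
  exact isOpen_stdOpen.preimage (continuous_place _)

theorem tri_subset_ctri (x : PlaneDart) : x.tri ⊆ x.ctri := by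
  refine Set.image_mono fun p hp => ?_
  rw [mem_stdOpen] at hp
  rw [mem_stdClosed]
  exact ⟨hp.1.le, hp.2.1.le, hp.2.2.le⟩

theorem tri_nonempty (x : PlaneDart) : x.tri.Nonempty := by
  obtain ⟨p, h1, h2⟩ := exists_coords (1 / 3) (1 / 3)
  exact ⟨_, p, mem_stdOpen.2 (by rw [h1, h2]; norm_num), rfl⟩

theorem mem_tri_up {z : Eisenstein} {q : ℂ} : q ∈ tri (z, 1) ↔
    (z.re : ℝ) < lx q ∧ (z.im : ℝ) < ly q ∧ lx q + ly q < z.re + z.im + 1 := by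
  rw [mem_tri, mem_stdOpen, lx_place, ly_place]
  simp [inv]
  intros
  constructor <;> intros <;> linarith

theorem mem_tri_down {z : Eisenstein} {q : ℂ} : q ∈ tri (z, -1) ↔
    lx q < (z.re : ℝ) ∧ ly q < (z.im : ℝ) ∧ (z.re + z.im - 1 : ℝ) < lx q + ly q := by
  rw [mem_tri, mem_stdOpen, lx_place, ly_place]
  simp [inv]
  intros
  constructor <;> intros <;> linarith

theorem mem_ctri_up {z : Eisenstein} {q : ℂ} : q ∈ ctri (z, 1) ↔
    (z.re : ℝ) ≤ lx q ∧ (z.im : ℝ) ≤ ly q ∧ lx q + ly q ≤ z.re + z.im + 1 := by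
  rw [mem_ctri, mem_stdClosed, lx_place, ly_place]
  simp [inv]
  intros
  constructor <;> intros <;> linarith

theorem mem_ctri_down {z : Eisenstein} {q : ℂ} : q ∈ ctri (z, -1) ↔
    lx q ≤ (z.re : ℝ) ∧ ly q ≤ (z.im : ℝ) ∧ (z.re + z.im - 1 : ℝ) ≤ lx q + ly q := by
  rw [mem_ctri, mem_stdClosed, lx_place, ly_place]
  simp [inv]
  intros
  constructor <;> intros <;> linarith

/-- The directions around a triangle are `u, ω² u, ω⁴ u`, one of which is `±1`. Questions about
lattice triangles thereby reduce to upward and downward triangles, where they are integer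
inequalities. -/
theorem exists_iterate_next_dir (x : PlaneDart) :
    ∃ i < 3, (next^[i] x).2 = 1 ∨ (next^[i] x).2 = -1 := by
  obtain ⟨z, u⟩ := x
  rcases unit_cases u with rfl | rfl | rfl | rfl | rfl | rfl
  · exact ⟨0, by lia, Or.inl rfl⟩
  · refine ⟨1, by lia, Or.inr ?_⟩
    rw [← omega_cube]; rfl
  · refine ⟨2, by lia, Or.inl ?_⟩
    change omega ^ 2 * (omega ^ 2 * omega ^ 2) = 1
    rw [← pow_add, ← pow_add, show 2 + (2 + 2) = 3 * 2 from rfl, pow_mul, omega_cube]; simp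
  · exact ⟨0, by lia, Or.inr rfl⟩
  · refine ⟨1, by lia, Or.inl ?_⟩
    change omega ^ 2 * -omega = 1
    rw [mul_neg, ← pow_succ, omega_cube, neg_neg]
  · refine ⟨2, by lia, Or.inr ?_⟩
    change omega ^ 2 * (omega ^ 2 * -omega ^ 2) = -1
    rw [mul_neg, mul_neg, ← pow_add, ← pow_add, show 2 + (2 + 2) = 3 * 2 from rfl, pow_mul,
      omega_cube]; simp

/-- Two darts have the same lattice triangle on their left. -/
def SameTri (x y : PlaneDart) : Prop := ∃ i < 3, y = next^[i] x

theorem SameTri.refl (x : PlaneDart) : SameTri x x := ⟨0, by lia, rfl⟩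

theorem SameTri.symm {x y : PlaneDart} (h : SameTri x y) : SameTri y x := by
  obtain ⟨i, hi, rfl⟩ := h
  interval_cases i
  · exact ⟨0, by lia, rfl⟩
  · exact ⟨2, by lia, (next_next_next x).symm⟩
  · exact ⟨1, by lia, (next_next_next x).symm⟩

theorem SameTri.next {x y : PlaneDart} (h : SameTri x y) : SameTri x y.next := by
  obtain ⟨i, hi, rfl⟩ := h
  interval_cases i
  · exact ⟨1, by lia, rfl⟩
  · exact ⟨2, by lia, rfl⟩
  · exact ⟨0, by lia, next_next_next x⟩

theorem SameTri.iterate {x y : PlaneDart} (h : SameTri x y) (i : ℕ) : SameTri x (PlaneDart.next^[i] y) := by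
  induction i with
  | zero => exact h
  | succ i ih => rw [Function.iterate_succ_apply']; exact ih.next

theorem SameTri.trans {x y z : PlaneDart} (h : SameTri x y) (h' : SameTri y z) : SameTri x z := by
  obtain ⟨i, -, rfl⟩ := h'
  exact h.iterate i

theorem SameTri.comp {x y : PlaneDart} (g : PlaneDart) (h : SameTri x y) :
    SameTri (comp g x) (comp g y) := by
  obtain ⟨i, hi, rfl⟩ := h
  exact ⟨i, hi, (iterate_next_comp g x i).symm⟩

theorem SameTri.tri_eq {x y : PlaneDart} (h : SameTri x y) : y.tri = x.tri := by
  obtain ⟨i, hi, rfl⟩ := h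
  simp

theorem SameTri.ctri_eq {x y : PlaneDart} (h : SameTri x y) : y.ctri = x.ctri := by
  obtain ⟨i, hi, rfl⟩ := h
  simp

/-- The open rhombus formed by the two lattice triangles at a dart, without the corners. -/
def rhombus (x : PlaneDart) : Set ℂ :=
  x.place '' {p | 0 < lx p ∧ lx p < 1 ∧ 0 < lx p + ly p ∧ lx p + ly p < 1}

theorem mem_rhombus {x : PlaneDart} {p : ℂ} : p ∈ x.rhombus ↔
    0 < lx ((inv x).place p) ∧ lx ((inv x).place p) < 1 ∧
      0 < lx ((inv x).place p) + ly ((inv x).place p) ∧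
      lx ((inv x).place p) + ly ((inv x).place p) < 1 := by
  constructor
  · rintro ⟨q, hq, rfl⟩; simpa using hq
  · intro h; exact ⟨_, h, by simp⟩

theorem isOpen_rhombus (x : PlaneDart) : IsOpen x.rhombus := by
  have : x.rhombus = {p | 0 < lx ((inv x).place p)} ∩ ({p | lx ((inv x).place p) < 1} ∩
      ({p | 0 < lx ((inv x).place p) + ly ((inv x).place p)} ∩
      {p | lx ((inv x).place p) + ly ((inv x).place p) < 1})) := by
    ext p; exact mem_rhombus
  rw [this]
  have h0 := continuous_place (inv x)
  have h1 := continuous_lx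
  have h2 := continuous_ly
  exact (isOpen_lt (by fun_prop) (by fun_prop)).inter
    ((isOpen_lt (by fun_prop) (by fun_prop)).inter
      ((isOpen_lt (by fun_prop) (by fun_prop)).inter (isOpen_lt (by fun_prop) (by fun_prop))))

/-- With `x` moved to the base dart and `y` turned to direction `±1`, a common point bounds the
integer coordinates of `y` so tightly that only the standard triangle remains. -/
theorem sameTri_of_inter_nonempty {x y : PlaneDart} (h : (x.tri ∩ y.tri).Nonempty) :
    SameTri x y := by
  obtain ⟨_, ⟨p, hp, rfl⟩, hy⟩ := h
  set y' := comp (inv x) y with hy'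
  have hyy : y = comp x y' := by simp [hy']
  suffices SameTri base y' by
    have := this.comp x
    rwa [comp_base, ← hyy] at this
  rw [hyy, place_mem_tri_comp] at hy
  obtain ⟨i, hi, h⟩ := exists_iterate_next_dir y'
  refine SameTri.symm (SameTri.trans ⟨i, hi, rfl⟩ (?_ : SameTri (PlaneDart.next^[i] y') base))
  rw [← tri_iterate_next _ i] at hy
  generalize PlaneDart.next^[i] y' = w at hy h ⊢
  obtain ⟨z, u⟩ := w
  dsimp at h
  rw [mem_stdOpen] at hp
  rcases h with rfl | rfl
  · rw [mem_tri_up] at hy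
    have h1 : (z.re : ℝ) < (1 : ℤ) := by push_cast; linarith
    have h2 : ((0 : ℤ) : ℝ) < z.re + z.im + 1 := by push_cast; linarith
    have h3 : (z.im : ℝ) < (1 : ℤ) := by push_cast; linarith
    norm_cast at h1 h2 h3
    by_cases h4 : z = 0
    · subst h4; exact SameTri.refl _
    · exfalso
      apply h4
      have h5 : (-1 : ℝ) < z.re := by linarith
      have h6 : (-1 : ℝ) < z.im := by linarith
      norm_cast at h5 h6
      ext <;> simp <;> lia
  · exfalso
    rw [mem_tri_down] at hy
    have h1 : (0 : ℝ) < z.re := by linarith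
    have h2 : (0 : ℝ) < z.im := by linarith
    have h3 : (z.re + z.im : ℝ) < 2 := by linarith
    norm_cast at h1 h2 h3
    lia

theorem sameTri_of_rhombus {x y : PlaneDart} (h : (y.tri ∩ x.rhombus).Nonempty) :
    SameTri x y ∨ SameTri x.flip y := by
  obtain ⟨_, hy, ⟨p, hp, rfl⟩⟩ := h
  set y' := comp (inv x) y with hy'
  have hyy : y = comp x y' := by simp [hy']
  suffices SameTri base y' ∨ SameTri base.flip y' by
    rcases this with h | h
    · left; simpa [← hyy] using h.comp x
    · right; simpa [← hyy, comp_flip] using h.comp x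
  rw [hyy, place_mem_tri_comp] at hy
  obtain ⟨i, hi, h⟩ := exists_iterate_next_dir y'
  have key : SameTri (PlaneDart.next^[i] y') base ∨ SameTri (PlaneDart.next^[i] y') base.flip := by
    rw [← tri_iterate_next _ i] at hy
    generalize PlaneDart.next^[i] y' = w at hy h ⊢
    obtain ⟨z, u⟩ := w
    dsimp at h
    obtain ⟨p1, p2, p3, p4⟩ := hp
    rcases h with rfl | rfl
    · left
      rw [mem_tri_up] at hy
      have h1 : (z.re : ℝ) < 1 := by linarith
      have h2 : (0 : ℝ) < z.re + 1 := by linarith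
      have h3 : (z.re + z.im : ℝ) < 1 := by linarith
      have h4 : (0 : ℝ) < z.re + z.im + 1 := by linarith
      norm_cast at h1 h2 h3 h4
      have : z = 0 := by ext <;> simp <;> lia
      subst this
      exact SameTri.refl _
    · right
      rw [mem_tri_down] at hy
      have h1 : (z.re : ℝ) < 2 := by linarith
      have h2 : (0 : ℝ) < z.re := by linarith
      have h3 : (z.re + z.im : ℝ) < 2 := by linarith
      have h4 : (0 : ℝ) < z.re + z.im := by linarith
      norm_cast at h1 h2 h3 h4
      have : z = 1 := by ext <;> simp <;> lia
      subst this
      have h5 : base.flip = (1, -1) := by ext1 <;> simp [base, PlaneDart.flip]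
      rw [h5]
      exact SameTri.refl _
  have h0 : SameTri y' (PlaneDart.next^[i] y') := ⟨i, hi, rfl⟩
  exact key.imp (fun h => (h0.trans h).symm) (fun h => (h0.trans h).symm)

theorem exists_mem_ctri (p : ℂ) : ∃ x : PlaneDart, p ∈ x.ctri := by
  have h1 := Int.floor_le (lx p)
  have h2 := Int.lt_floor_add_one (lx p)
  have h3 := Int.floor_le (ly p)
  have h4 := Int.lt_floor_add_one (ly p)
  by_cases h : lx p + ly p ≤ ⌊lx p⌋ + ⌊ly p⌋ + 1
  · exact ⟨(⟨⌊lx p⌋, ⌊ly p⌋⟩, 1), mem_ctri_up.2 ⟨h1, h3, h⟩⟩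
  · refine ⟨(⟨⌊lx p⌋ + 1, ⌊ly p⌋ + 1⟩, -1), mem_ctri_down.2 ⟨?_, ?_, ?_⟩⟩ <;> push_cast <;> linarith

/-- The points in the interior of the unit segment from which a dart arises. -/
def openEdge (x : PlaneDart) : Set ℂ := {p | ∃ t : ℝ, 0 < t ∧ t < 1 ∧ p = x.place t}

theorem openEdge_subset_rhombus (x : PlaneDart) : x.openEdge ⊆ x.rhombus := by
  rintro _ ⟨t, h0, h1, rfl⟩
  exact ⟨_, by simp [*], rfl⟩

theorem openEdge_flip (x : PlaneDart) : x.flip.openEdge = x.openEdge := by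
  have key : ∀ y : PlaneDart, y.openEdge ⊆ y.flip.openEdge := by
    rintro y _ ⟨t, h0, h1, rfl⟩
    refine ⟨1 - t, by linarith, by linarith, ?_⟩
    simp [place, flip]; ring
  refine Set.Subset.antisymm ?_ (key x)
  simpa using key x.flip

theorem openEdge_subset_ctri (x : PlaneDart) : x.openEdge ⊆ x.ctri := by
  rintro _ ⟨t, h0, h1, rfl⟩
  exact ⟨_, mem_stdClosed.2 (by simp; constructor <;> linarith), rfl⟩

theorem openEdge_subset_segment (x : PlaneDart) :
    x.openEdge ⊆ segment ℝ x.tail.toComplex x.head.toComplex := by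
  rintro _ ⟨t, h0, h1, rfl⟩
  refine ⟨1 - t, t, by linarith, by linarith, by ring, ?_⟩
  simp [place, head, tail]; ring

theorem place_mem_boundary {x : PlaneDart} {q : ℂ} (hc : q ∈ stdClosed) (ho : q ∉ stdOpen) :
    ∃ i < 3, ∃ t : ℝ, 0 ≤ t ∧ t ≤ 1 ∧ x.place q = (next^[i] x).place t := by
  rw [mem_stdClosed] at hc
  rw [mem_stdOpen] at ho
  have key : ∀ y : PlaneDart, x = comp x base ∧ ∀ i, next^[i] x = comp x (next^[i] base) := by
    intro _
    exact ⟨(comp_base x).symm, fun i => by rw [← iterate_next_comp, comp_base]⟩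
  by_cases h2 : 0 < ly q
  · by_cases h1 : 0 < lx q
    · have h3 : lx q + ly q = 1 := by
        by_contra h3
        exact ho ⟨h1, h2, lt_of_le_of_ne hc.2.2 h3⟩
      refine ⟨1, by lia, ly q, h2.le, by linarith, ?_⟩
      rw [(key x).2, place_comp]
      congr 1
      apply ext_coords <;> simp only [lx_place, ly_place] <;>
        simp [next, base] <;> linarith
    · have h3 : lx q = 0 := le_antisymm (not_lt.1 h1) hc.1
      refine ⟨2, by lia, 1 - ly q, by linarith, by linarith, ?_⟩
      rw [(key x).2, place_comp]
      congr 1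
      apply ext_coords <;> simp [lx_place, ly_place, next, base, h3]
  · have h3 : ly q = 0 := le_antisymm (not_lt.1 h2) hc.2.1
    refine ⟨0, by lia, lx q, hc.1, by linarith, ?_⟩
    congr 1
    apply ext_coords <;> simp [h3]

theorem mem_openEdge_of_mem_ctri {x : PlaneDart} {p : ℂ} (hc : p ∈ x.ctri) (ho : p ∉ x.tri)
    (hp : p ∉ Set.range toComplex) : ∃ i < 3, p ∈ (next^[i] x).openEdge := by
  obtain ⟨q, hq, rfl⟩ := hc
  obtain ⟨i, hi, t, h0, h1, h⟩ := place_mem_boundary (x := x) hq (fun h => ho ⟨q, h, rfl⟩)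
  refine ⟨i, hi, t, lt_of_le_of_ne h0 ?_, lt_of_le_of_ne h1 ?_, h⟩
  · rintro rfl
    exact hp ⟨_, (h.trans (by simpa using place_zero _)).symm⟩
  · rintro rfl
    exact hp ⟨_, (h.trans (by simpa using place_one _)).symm⟩

end PlaneDart

/-! ### Triangles in the plane -/

section Triangles

variable {A B C p q : ℂ}

theorem cross_lerp (z w w' : ℂ) (t : ℝ) :
    cross z (w + t * (w' - w)) = (1 - t) * cross z w + t * cross z w' := by
  simp [cross]; ring

theorem continuous_cross_sub (z w : ℂ) : Continuous fun p => cross z (p - w) := by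
  unfold cross; fun_prop

theorem isOpen_openTriangle (A B C : ℂ) : IsOpen (openTriangle A B C) :=
  (isOpen_lt continuous_const (continuous_cross_sub _ _)).inter
    ((isOpen_lt continuous_const (continuous_cross_sub _ _)).inter
      (isOpen_lt continuous_const (continuous_cross_sub _ _)))

theorem convex_halfPlane (z w : ℂ) : Convex ℝ {p | 0 < cross z (p - w)} := by
  intro p hp q hq a b ha hb hab
  have e : cross z (a • p + b • q - w) = a * cross z (p - w) + b * cross z (q - w) := by
    have hb' : b = 1 - a := by linarith
    subst hb'
    simp [cross]; ring
  rw [Set.mem_ofPred_eq] at *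
  rw [e]
  rcases ha.eq_or_lt with rfl | ha
  · have : b = 1 := by linarith
    subst this; simpa
  · have := mul_pos ha hp
    have := mul_nonneg hb hq.le
    linarith

theorem convex_openTriangle (A B C : ℂ) : Convex ℝ (openTriangle A B C) :=
  (convex_halfPlane _ _).inter ((convex_halfPlane _ _).inter (convex_halfPlane _ _))

theorem openTriangle_rotate (A B C : ℂ) : openTriangle B C A = openTriangle A B C := by
  ext p; simp [openTriangle]; tauto

theorem closedTriangle_rotate (A B C : ℂ) : closedTriangle B C A = closedTriangle A B C := by
  ext p; simp [closedTriangle]; tauto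

theorem cross_rotate (A B C : ℂ) : cross (C - B) (A - B) = cross (B - A) (C - A) := by
  simp [cross]; ring

/-- A small move towards the centroid `G` makes all three cross products positive. -/
theorem closedTriangle_subset_closure (h : 0 < cross (B - A) (C - A)) :
    closedTriangle A B C ⊆ closure (openTriangle A B C) := by
  rintro q ⟨h1, h2, h3⟩
  set G : ℂ := (A + B + C) / 3 with hG
  have g1 : cross (B - A) (G - A) = cross (B - A) (C - A) / 3 := by
    have : G - A = ((B - A) + (C - A)) / 3 := by rw [hG]; ring
    rw [this]; simp [cross]; ring
  have g2 : cross (C - B) (G - B) = cross (B - A) (C - A) / 3 := by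
    have : G - B = ((C - B) + (A - B)) / 3 := by rw [hG]; ring
    rw [this, ← cross_rotate A B C]; simp [cross]; ring
  have g3 : cross (A - C) (G - C) = cross (B - A) (C - A) / 3 := by
    have : G - C = ((A - C) + (B - C)) / 3 := by rw [hG]; ring
    rw [this, ← cross_rotate A B C, ← cross_rotate B C A]; simp [cross]; ring
  have ht : Tendsto (fun t : ℝ => q + t * (G - q)) (𝓝[>] 0) (𝓝 q) := by
    have : Continuous fun t : ℝ => q + t * (G - q) := by fun_prop
    simpa using (this.tendsto 0).mono_left nhdsWithin_le_nhds
  refine mem_closure_of_tendsto ht ?_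
  filter_upwards [Ioo_mem_nhdsGT (zero_lt_one' ℝ)] with t ht
  have key : ∀ z w : ℂ, 0 ≤ cross z (q - w) → 0 < cross z (G - w) →
      0 < cross z (q + t * (G - q) - w) := by
    intro z w h1 h2
    have : q + t * (G - q) - w = (q - w) + t * ((G - w) - (q - w)) := by ring
    rw [this, cross_lerp]
    have := mul_pos ht.1 h2
    have := mul_nonneg (by linarith [ht.2] : (0 : ℝ) ≤ 1 - t) h1
    linarith
  exact ⟨key _ _ h1 (by rw [g1]; linarith), key _ _ h2 (by rw [g2]; linarith),
    key _ _ h3 (by rw [g3]; linarith)⟩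

theorem inter_openTriangle_nonempty (h : 0 < cross (B - A) (C - A)) (hq : q ∈ closedTriangle A B C)
    {U : Set ℂ} (hU : U ∈ 𝓝 q) : (U ∩ openTriangle A B C).Nonempty :=
  mem_closure_iff_nhds.1 (closedTriangle_subset_closure h hq) U hU

theorem mem_openSegment_iff : q ∈ openSegment ℝ A B ↔ ∃ t : ℝ, 0 < t ∧ t < 1 ∧
    q = A + t * (B - A) := by
  constructor
  · rintro ⟨a, b, ha, hb, hab, rfl⟩
    refine ⟨b, hb, by linarith, ?_⟩
    have : (a : ℂ) = 1 - b := by rw [eq_sub_iff_add_eq]; exact_mod_cast hab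
    simp [this]; ring
  · rintro ⟨t, h0, h1, rfl⟩
    refine ⟨1 - t, t, by linarith, h0, by ring, ?_⟩
    simp; ring

theorem cross_eq_zero_of_mem_openSegment (h : q ∈ openSegment ℝ A B) :
    cross (B - A) (q - A) = 0 := by
  obtain ⟨t, h0, h1, rfl⟩ := mem_openSegment_iff.1 h
  simp [cross]; ring

theorem mem_openSegment_of_cross_eq_zero (h : 0 < cross (B - A) (C - A))
    (hq : q ∈ closedTriangle A B C) (h0 : cross (B - A) (q - A) = 0) (hA : q ≠ A) (hB : q ≠ B) :
    q ∈ openSegment ℝ A B := by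
  obtain ⟨-, h2, h3⟩ := hq
  set Δ := cross (B - A) (C - A) with hΔ
  have hsum : cross (C - B) (q - B) + cross (A - C) (q - C) = Δ := by
    have : Δ = cross (B - A) (q - A) + cross (C - B) (q - B) + cross (A - C) (q - C) := by
      simp [hΔ, cross]; ring
    rw [this, h0]; ring
  -- Barycentric coordinates of `q` multiplied by `Δ`; the coordinate at `C` vanishes.
  have hbary : (Δ : ℂ) * (q - A) = (cross (A - C) (q - C) : ℂ) * (B - A) := by
    have e : (Δ : ℂ) * (q - A) = (cross (A - C) (q - C) : ℂ) * (B - A) +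
        (cross (B - A) (q - A) : ℂ) * (C - A) := by
      apply Complex.ext <;> simp [hΔ, cross] <;> ring
    rw [e, h0]; simp
  have hΔ' : (Δ : ℂ) ≠ 0 := by exact_mod_cast h.ne'
  refine mem_openSegment_iff.2 ⟨cross (A - C) (q - C) / Δ, div_pos (lt_of_le_of_ne h3 ?_) h,
    (div_lt_one h).2 ?_, ?_⟩
  · intro h4
    rw [← h4] at hbary
    simp [hΔ'] at hbary
    exact hA (sub_eq_zero.1 hbary)
  · refine lt_of_le_of_ne (by linarith) ?_
    intro h4
    rw [h4] at hbary
    exact hB (sub_left_inj.1 (mul_left_cancel₀ hΔ' hbary))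
  · push_cast
    field_simp
    linear_combination hbary

/-- A point of a closed triangle that is neither an inner point nor a corner lies on an edge. -/
theorem mem_openSegment_of_boundary (h : 0 < cross (B - A) (C - A))
    (hq : q ∈ closedTriangle A B C) (ho : q ∉ openTriangle A B C) (hA : q ≠ A) (hB : q ≠ B)
    (hC : q ≠ C) :
    q ∈ openSegment ℝ A B ∨ q ∈ openSegment ℝ B C ∨ q ∈ openSegment ℝ C A := by
  by_cases h1 : cross (B - A) (q - A) = 0
  · exact Or.inl (mem_openSegment_of_cross_eq_zero h hq h1 hA hB)
  by_cases h2 : cross (C - B) (q - B) = 0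
  · refine Or.inr (Or.inl (mem_openSegment_of_cross_eq_zero (C := A) ?_ ?_ h2 hB hC))
    · rwa [cross_rotate]
    · rwa [closedTriangle_rotate]
  by_cases h3 : cross (A - C) (q - C) = 0
  · refine Or.inr (Or.inr (mem_openSegment_of_cross_eq_zero (C := B) ?_ ?_ h3 hC hA))
    · rwa [cross_rotate, cross_rotate]
    · rwa [closedTriangle_rotate, closedTriangle_rotate]
  exact absurd ⟨lt_of_le_of_ne hq.1 (Ne.symm h1), lt_of_le_of_ne hq.2.1 (Ne.symm h2),
    lt_of_le_of_ne hq.2.2 (Ne.symm h3)⟩ ho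

/-- Near a point in the interior of an edge, a triangle fills the side of the edge on which it
lies. -/
theorem eventually_mem_openTriangle (h : 0 < cross (B - A) (C - A)) (hq : q ∈ openSegment ℝ A B) :
    ∀ᶠ p in 𝓝 q, 0 < cross (B - A) (p - A) → p ∈ openTriangle A B C := by
  obtain ⟨t, h0, h1, rfl⟩ := mem_openSegment_iff.1 hq
  have e1 : cross (C - B) (A + t * (B - A) - B) = (1 - t) * cross (B - A) (C - A) := by
    simp [cross]; ring
  have e2 : cross (A - C) (A + t * (B - A) - C) = t * cross (B - A) (C - A) := by
    simp [cross]; ring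
  have c1 : ∀ᶠ p in 𝓝 (A + t * (B - A)), 0 < cross (C - B) (p - B) :=
    (continuous_cross_sub _ _).continuousAt.eventually_const_lt
      ((mul_pos (by linarith) h).trans_eq e1.symm)
  have c2 : ∀ᶠ p in 𝓝 (A + t * (B - A)), 0 < cross (A - C) (p - C) :=
    (continuous_cross_sub _ _).continuousAt.eventually_const_lt
      ((mul_pos (by linarith) h).trans_eq e2.symm)
  filter_upwards [c1, c2] with p h1 h2 h3 using ⟨h3, h1, h2⟩

/-- A displacement along `I * (B - A)`, the left normal of the edge, increases the cross product. -/
theorem exists_cross_gt (hAB : A ≠ B) {U : Set ℂ} (hU : U ∈ 𝓝 q) :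
    ∃ p ∈ U, cross (B - A) (q - A) < cross (B - A) (p - A) := by
  have ht : Tendsto (fun t : ℝ => q + t * (Complex.I * (B - A))) (𝓝[>] 0) (𝓝 q) := by
    have : Continuous fun t : ℝ => q + t * (Complex.I * (B - A)) := by fun_prop
    simpa using (this.tendsto 0).mono_left nhdsWithin_le_nhds
  obtain ⟨t, h1, h2⟩ := ((ht.eventually hU).and self_mem_nhdsWithin).exists
  refine ⟨_, h1, ?_⟩
  have e : cross (B - A) (q + t * (Complex.I * (B - A)) - A) =
      cross (B - A) (q - A) + t * Complex.normSq (B - A) := by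
    simp [cross, Complex.normSq_apply]; ring
  rw [e]
  have := mul_pos h2 (Complex.normSq_pos.2 (sub_ne_zero.2 hAB.symm))
  linarith

theorem exists_cross_lt (hAB : A ≠ B) {U : Set ℂ} (hU : U ∈ 𝓝 q) :
    ∃ p ∈ U, cross (B - A) (p - A) < cross (B - A) (q - A) := by
  obtain ⟨p, hp, h⟩ := exists_cross_gt hAB.symm hU
  refine ⟨p, hp, ?_⟩
  have key : ∀ r : ℂ, cross (A - B) (r - B) = - cross (B - A) (r - A) := by
    intro r; simp [cross]; ring
  rw [key, key] at h
  linarith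

theorem exists_cross_ne (hAB : A ≠ B) {U : Set ℂ} (hU : IsOpen U) (hne : U.Nonempty) :
    ∃ p ∈ U, cross (B - A) (p - A) ≠ 0 := by
  obtain ⟨q, hq⟩ := hne
  by_cases h : cross (B - A) (q - A) = 0
  · obtain ⟨p, hp, h'⟩ := exists_cross_gt hAB (hU.mem_nhds hq)
    exact ⟨p, hp, by linarith⟩
  · exact ⟨q, hq, h⟩

theorem ne_of_cross_pos (h : 0 < cross (B - A) (C - A)) : A ≠ B := by
  rintro rfl
  simp [cross] at h

end Triangles

/-! ### Avoiding lattice points -/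

theorem countable_range_toComplex : (Set.range toComplex).Countable := by
  have : Countable Eisenstein := (QuadraticAlgebra.equivProd (-1 : ℤ) 1).injective.countable
  exact Set.countable_range _

theorem exists_notMem_lattice {U : Set ℂ} (hU : IsOpen U) (hne : U.Nonempty) :
    ∃ p ∈ U, p ∉ Set.range toComplex := by
  have := (countable_range_toComplex.dense_compl ℝ).inter_open_nonempty U hU hne
  exact this

theorem exists_mem_openSegment_notMem_lattice {A B p : ℂ} (hAB : A ≠ B)
    (hp : p ∈ openSegment ℝ A B) {U : Set ℂ} (hU : U ∈ 𝓝 p) {L : Set ℂ} (hL : L.Countable) :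
    ∃ q ∈ U, q ∈ openSegment ℝ A B ∧ q ∉ L := by
  obtain ⟨t, h0, h1, rfl⟩ := mem_openSegment_iff.1 hp
  have hcont : Continuous fun t : ℝ => A + t * (B - A) := by fun_prop
  have hinj : Function.Injective fun t : ℝ => A + t * (B - A) := by
    intro s t h
    have h' : ((s : ℂ) - t) * (B - A) = 0 := by
      have := add_left_cancel h
      linear_combination this
    rcases mul_eq_zero.1 h' with h' | h'
    · exact_mod_cast sub_eq_zero.1 h'
    · exact absurd (sub_eq_zero.1 h').symm hAB
  obtain ⟨V, hVU, hVo, hV⟩ := mem_nhds_iff.1 hU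
  obtain ⟨s, ⟨hs, hs'⟩, hsL⟩ := ((hL.preimage hinj).dense_compl ℝ).inter_open_nonempty
    (((fun t : ℝ => A + t * (B - A)) ⁻¹' V) ∩ Set.Ioo 0 1)
    ((hVo.preimage hcont).inter isOpen_Ioo) ⟨t, hV, h0, h1⟩
  exact ⟨_, hVU hs, mem_openSegment_iff.2 ⟨s, hs'.1, hs'.2, rfl⟩, hsL⟩

/-- Fix `p` off the lattice and slide `q` along the normal of `q - p`. Each lattice point blocks at
most one position of `q`, so only countably many positions are bad. -/
theorem exists_segment_avoiding {U V : Set ℂ} (hU : IsOpen U) (hU' : U.Nonempty) (hV : IsOpen V)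
    (hV' : V.Nonempty) :
    ∃ p ∈ U, ∃ q ∈ V, ∀ r ∈ segment ℝ p q, r ∉ Set.range toComplex := by
  obtain ⟨p, hp, hpL⟩ := exists_notMem_lattice hU hU'
  obtain ⟨q, hq, hqp⟩ : ∃ q ∈ V, q ≠ p := by
    obtain ⟨q, hq⟩ := hV'
    have : (V ∩ {p}ᶜ).Nonempty := (dense_compl_singleton p).inter_open_nonempty V hV ⟨q, hq⟩
    exact this
  have hv : q - p ≠ 0 := sub_ne_zero.2 hqp
  set f : ℝ → ℂ := fun t => q + t * (Complex.I * (q - p)) with hf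
  have hcont : Continuous f := by fun_prop
  have hbad : {t | ∃ l ∈ Set.range toComplex, l ∈ segment ℝ p (f t)}.Countable := by
    have : {t | ∃ l ∈ Set.range toComplex, l ∈ segment ℝ p (f t)} =
        ⋃ l ∈ Set.range toComplex, {t | l ∈ segment ℝ p (f t)} := by
      ext t; simp
    rw [this]
    refine countable_range_toComplex.biUnion fun l hl => Set.Subsingleton.countable ?_
    -- A blocking point satisfies `(l - p) / (q - p) = b + b t I` with `b ≠ 0`, which determines
    -- `t`.
    have key : ∀ t, l ∈ segment ℝ p (f t) → ((l - p) / (q - p)).re ≠ 0 ∧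
        t * ((l - p) / (q - p)).re = ((l - p) / (q - p)).im := by
      rintro t ⟨a, b, ha, hb, hab, h⟩
      have h1 : (l - p) / (q - p) = b + (b * t : ℝ) * Complex.I := by
        rw [div_eq_iff hv, ← h]
        have : (a : ℂ) = 1 - b := by rw [eq_sub_iff_add_eq]; exact_mod_cast hab
        simp [this, hf]; ring
      rw [h1]
      have hb0 : b ≠ 0 := by
        rintro rfl
        apply hpL
        have : a = 1 := by linarith
        subst this
        have : l = p := by rw [← h]; simp
        rwa [← this]
      simp [hb0]; ring
    intro s hs t ht
    obtain ⟨h1, h2⟩ := key s hs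
    obtain ⟨-, h3⟩ := key t ht
    exact mul_right_cancel₀ h1 (h2.trans h3.symm)
  obtain ⟨t, ht, ht'⟩ := (hbad.dense_compl ℝ).inter_open_nonempty (f ⁻¹' V) (hV.preimage hcont)
    ⟨0, by simpa [hf] using hq⟩
  exact ⟨p, hp, f t, ht, fun r hr hrL => ht' ⟨r, hrL, hr⟩⟩

/-! ### Connectedness -/

/-- If a property of the members of a family of sets does not change near any point of a
preconnected set in which the family accumulates everywhere, then it holds for all members that
meet this set or for none. -/
theorem IsPreconnected.family_induction {X ι : Type*} [TopologicalSpace X] {S : Set X}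
    (hS : IsPreconnected S) (T : ι → Set X) (R : ι → Prop)
    (hloc : ∀ p ∈ S, ∃ N ∈ 𝓝 p, ∃ Q : Prop, ∀ i, (T i ∩ N).Nonempty → (R i ↔ Q))
    (hacc : ∀ p ∈ S, ∀ N ∈ 𝓝 p, ∃ i, (T i ∩ N).Nonempty) {i j : ι} (hi : (T i ∩ S).Nonempty)
    (hj : (T j ∩ S).Nonempty) (h : R i) : R j := by
  by_contra hRj
  have hopen : ∀ R' : ι → Prop, IsOpen {p | ∃ N ∈ 𝓝 p, ∀ i, (T i ∩ N).Nonempty → R' i} := by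
    intro R'
    rw [isOpen_iff_mem_nhds]
    rintro p ⟨N, hN, h⟩
    obtain ⟨N', hN', ho, hp⟩ := mem_nhds_iff.1 hN
    refine mem_of_superset (ho.mem_nhds hp) fun q hq => ⟨N', ho.mem_nhds hq, fun i hi => h i ?_⟩
    exact hi.mono (Set.inter_subset_inter_right _ hN')
  -- The points near which only members with `R` occur, and those near which only members without
  -- `R` occur, form open sets covering `S`. If both met `S`, they would share a point of `S`, which
  -- accumulation of the family forbids.
  have hU := hopen R
  have hV := hopen fun i => ¬R i
  obtain ⟨p, hp, ⟨N, hN, h1⟩, N', hN', h2⟩ := hS _ _ hU hV (by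
      intro p hp
      obtain ⟨N, hN, Q, hQ⟩ := hloc p hp
      by_cases hq : Q
      · exact Or.inl ⟨N, hN, fun i hi => (hQ i hi).2 hq⟩
      · exact Or.inr ⟨N, hN, fun i hi hr => hq ((hQ i hi).1 hr)⟩) (by
      obtain ⟨p, hpT, hpS⟩ := hi
      refine ⟨p, hpS, ?_⟩
      obtain ⟨N, hN, Q, hQ⟩ := hloc p hpS
      have hq : Q := (hQ i ⟨p, hpT, mem_of_mem_nhds hN⟩).1 h
      exact ⟨N, hN, fun i hi => (hQ i hi).2 hq⟩) (by
      obtain ⟨p, hpT, hpS⟩ := hj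
      refine ⟨p, hpS, ?_⟩
      obtain ⟨N, hN, Q, hQ⟩ := hloc p hpS
      have hq : ¬Q := fun hq => hRj ((hQ j ⟨p, hpT, mem_of_mem_nhds hN⟩).2 hq)
      exact ⟨N, hN, fun i hi hr => hq ((hQ i hi).1 hr)⟩)
  obtain ⟨i, hi⟩ := hacc p hp _ (inter_mem hN hN')
  exact h2 i (hi.mono (by intro x hx; exact ⟨hx.1, hx.2.2⟩))
    (h1 i (hi.mono (by intro x hx; exact ⟨hx.1, hx.2.1⟩)))

namespace PlaneDart

/-- A closed lattice triangle is contained in the closure of its interior. -/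
theorem inter_tri_nonempty {x : PlaneDart} {p : ℂ} (hp : p ∈ x.ctri) {U : Set ℂ} (hU : U ∈ 𝓝 p) :
    (U ∩ x.tri).Nonempty := by
  obtain ⟨q, hq, rfl⟩ := hp
  have h : 0 < cross ((1 : ℂ) - 0) (toComplex omega - 0) := by
    rw [cross_pos]; simp
  obtain ⟨r, hr, hr'⟩ := inter_openTriangle_nonempty h hq
    ((continuous_place x).continuousAt.preimage_mem_nhds hU)
  exact ⟨x.place r, hr, r, hr', rfl⟩

theorem exists_tri_inter_nonempty {U : Set ℂ} (hU : IsOpen U) (hne : U.Nonempty) :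
    ∃ x : PlaneDart, (U ∩ x.tri).Nonempty := by
  obtain ⟨p, hp⟩ := hne
  obtain ⟨x, hx⟩ := exists_mem_ctri p
  exact ⟨x, inter_tri_nonempty hx (hU.mem_nhds hp)⟩

/-- Near a point that is not a lattice point there are at most two lattice triangles. -/
theorem exists_local {p : ℂ} (hp : p ∉ Set.range toComplex) :
    ∃ x : PlaneDart, (p ∈ x.tri ∨ p ∈ x.openEdge) ∧ ∃ N ∈ 𝓝 p, ∀ y : PlaneDart,
      (y.tri ∩ N).Nonempty → SameTri x y ∨ p ∈ x.openEdge ∧ SameTri x.flip y := by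
  obtain ⟨x, hx⟩ := exists_mem_ctri p
  by_cases h : p ∈ x.tri
  · refine ⟨x, Or.inl h, x.tri, (isOpen_tri x).mem_nhds h, fun y hy => Or.inl ?_⟩
    exact sameTri_of_inter_nonempty (by rwa [Set.inter_comm])
  · obtain ⟨i, hi, h⟩ := mem_openEdge_of_mem_ctri hx h hp
    refine ⟨_, Or.inr h, _, (isOpen_rhombus _).mem_nhds (openEdge_subset_rhombus _ h),
      fun y hy => ?_⟩
    exact (sameTri_of_rhombus hy).imp id fun h' => ⟨h, h'⟩

/-- The lattice triangles that meet an open convex set are connected with each other by passing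
from neighbour to neighbour. -/
theorem convex_induction {O : Set ℂ} (hO : IsOpen O) (hc : Convex ℝ O) (R : PlaneDart → Prop)
    (hn : ∀ x : PlaneDart, (x.tri ∩ O).Nonempty → R x → R x.next)
    (hf : ∀ x : PlaneDart, (x.tri ∩ O).Nonempty → (x.flip.tri ∩ O).Nonempty → R x → R x.flip)
    {x y : PlaneDart} (hx : (x.tri ∩ O).Nonempty) (hy : (y.tri ∩ O).Nonempty) (h : R x) : R y := by
  obtain ⟨p, hp, q, hq, hpq⟩ := exists_segment_avoiding ((isOpen_tri x).inter hO) hx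
    ((isOpen_tri y).inter hO) hy
  have hsub : segment ℝ p q ⊆ O := hc.segment_subset hp.2 hq.2
  have hsame : ∀ {x y : PlaneDart}, (x.tri ∩ O).Nonempty → SameTri x y → R x → R y := by
    rintro x y hx ⟨i, -, rfl⟩ h
    induction i with
    | zero => exact h
    | succ i ih =>
      rw [Function.iterate_succ_apply']
      exact hn _ (by simpa) ih
  -- Near each point of a segment free of lattice points there are at most two triangles, and these
  -- share a side, so `R` is locally constant along the segment.
  refine (convex_segment p q).isPreconnected.family_induction (fun x : PlaneDart => x.tri ∩ O) R
    (fun r hr => ?_) (fun r hr N hN => ?_) ⟨p, hp, left_mem_segment _ _ _⟩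
    ⟨q, hq, right_mem_segment _ _ _⟩ h
  · obtain ⟨z, hz, N, hN, hloc⟩ := exists_local (hpq r hr)
    have hr' : r ∈ z.ctri := hz.elim (fun h => tri_subset_ctri _ h)
      (fun h => openEdge_subset_ctri _ h)
    have hzO : (z.tri ∩ O).Nonempty := by
      rw [Set.inter_comm]; exact inter_tri_nonempty hr' (hO.mem_nhds (hsub hr))
    refine ⟨N, hN, R z, fun y hy => ?_⟩
    have hyO : (y.tri ∩ O).Nonempty := hy.mono fun _ h => h.1
    rcases hloc y (hy.mono fun _ h => ⟨h.1.1, h.2⟩) with h | ⟨he, h⟩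
    · exact ⟨hsame hyO h.symm, hsame hzO h⟩
    · have hfO : (z.flip.tri ∩ O).Nonempty := by rwa [← h.tri_eq]
      refine ⟨fun hy => ?_, fun hz => hsame hfO h (hf z hzO hfO hz)⟩
      have := hf z.flip hfO (by simpa) (hsame hyO h.symm hy)
      simpa using this
  · obtain ⟨z, hz⟩ := exists_tri_inter_nonempty (isOpen_interior.inter hO)
      ⟨r, mem_interior_iff_mem_nhds.2 hN, hsub hr⟩
    exact ⟨z, hz.mono fun s hs => ⟨⟨hs.2, hs.1.2⟩, interior_subset hs.1.1⟩⟩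

theorem lattice_notMem_tri (x : PlaneDart) (z : Eisenstein) : z.toComplex ∉ x.tri := by
  rw [mem_tri, place_toComplex, mem_stdOpen]
  simp only [lx_toComplex, ly_toComplex]
  rintro ⟨h1, h2, h3⟩
  norm_cast at h1 h2 h3
  lia

/-- If a segment between lattice points meets the interior of a lattice triangle, then it meets
one of its sides in a point different from the end points of the segment. -/
theorem exists_mem_segment_of_mem_tri {A B : Eisenstein} {q : ℂ} {x : PlaneDart}
    (hq : q ∈ openSegment ℝ A.toComplex B.toComplex) (hx : q ∈ x.tri) :
    ∃ i < 3, (segment ℝ (PlaneDart.next^[i] x).tail.toComplex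
      (PlaneDart.next^[i] x).head.toComplex ∩
        openSegment ℝ A.toComplex B.toComplex).Nonempty := by
  obtain ⟨t, h0, h1, rfl⟩ := mem_openSegment_iff.1 hq
  set P : ℝ → ℂ := fun s => (inv x).place (A.toComplex + s * (B.toComplex - A.toComplex)) with hP
  -- The least barycentric coordinate with respect to the triangle: positive inside, zero on the
  -- boundary, negative outside.
  set h : ℝ → ℝ := fun s => min (min (lx (P s)) (ly (P s))) (1 - lx (P s) - ly (P s)) with hh
  have hPc : Continuous P := (continuous_place _).comp (by fun_prop)
  have hc : Continuous h := by
    have := continuous_lx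
    have := continuous_ly
    fun_prop
  have hpos : ∀ s, 0 < h s ↔ P s ∈ stdOpen := by
    intro s
    rw [mem_stdOpen, hh]
    simp only [lt_min_iff]
    constructor
    · rintro ⟨⟨h1, h2⟩, h3⟩; exact ⟨h1, h2, by linarith⟩
    · rintro ⟨h1, h2, h3⟩; exact ⟨⟨h1, h2⟩, by linarith⟩
  have hnn : ∀ s, 0 ≤ h s ↔ P s ∈ stdClosed := by
    intro s
    rw [mem_stdClosed, hh]
    simp only [le_min_iff]
    constructor
    · rintro ⟨⟨h1, h2⟩, h3⟩; exact ⟨h1, h2, by linarith⟩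
    · rintro ⟨h1, h2, h3⟩; exact ⟨⟨h1, h2⟩, by linarith⟩
  have ht : 0 < h t := (hpos t).2 (mem_tri.1 hx)
  have hfin : ∀ s, 0 < s → s < 1 → h s = 0 → ∃ i < 3,
      (segment ℝ (PlaneDart.next^[i] x).tail.toComplex (PlaneDart.next^[i] x).head.toComplex ∩
        openSegment ℝ A.toComplex B.toComplex).Nonempty := by
    intro s hs0 hs1 hs
    obtain ⟨i, hi, r, hr0, hr1, hr⟩ := place_mem_boundary (x := x) ((hnn s).1 hs.ge)
      (fun h' => by have := (hpos s).2 h'; linarith)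
    refine ⟨i, hi, _, ?_, mem_openSegment_iff.2 ⟨s, hs0, hs1, rfl⟩⟩
    rw [hP] at hr
    simp only [place_place_inv] at hr
    rw [hr]
    refine ⟨1 - r, r, by linarith, by linarith, by ring, ?_⟩
    simp [place, head, tail]; ring
  by_cases hA : h 0 < 0
  · obtain ⟨s, hs, hs'⟩ := intermediate_value_Ioo h0.le hc.continuousOn ⟨hA, ht⟩
    exact hfin s hs.1 (hs.2.trans h1) hs'
  by_cases hB : h 1 < 0
  · obtain ⟨s, hs, hs'⟩ := intermediate_value_Ioo' h1.le hc.continuousOn ⟨hB, ht⟩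
    exact hfin s (h0.trans hs.1) hs.2 hs'
  -- Neither end point is outside the closed triangle, so both are corners of it; the segment then
  -- is a point or a side and misses the interior.
  exfalso
  have hP0 := (hnn 0).1 (not_lt.1 hA)
  have hP1 := (hnn 1).1 (not_lt.1 hB)
  have hPt := (hpos t).1 ht
  have hlerp : P t = P 0 + t * (P 1 - P 0) := by simp only [hP, place]; push_cast; ring
  obtain ⟨a, ha⟩ : ∃ a : Eisenstein, P 0 = a.toComplex :=
    ⟨_, Eq.trans (by simp [hP]) (place_toComplex (inv x) A)⟩
  obtain ⟨b, hb⟩ : ∃ a : Eisenstein, P 1 = a.toComplex :=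
    ⟨_, Eq.trans (by simp [hP]) (place_toComplex (inv x) B)⟩
  rw [hlerp, ha, hb, mem_stdOpen] at hPt
  rw [ha, mem_stdClosed] at hP0
  rw [hb, mem_stdClosed] at hP1
  simp at hPt hP0 hP1
  norm_cast at hP0 hP1
  obtain ⟨a1, a2, a3⟩ := hP0
  obtain ⟨b1, b2, b3⟩ := hP1
  have ca : (a.re = 0 ∧ a.im = 0) ∨ (a.re = 1 ∧ a.im = 0) ∨ (a.re = 0 ∧ a.im = 1) := by lia
  have cb : (b.re = 0 ∧ b.im = 0) ∨ (b.re = 1 ∧ b.im = 0) ∨ (b.re = 0 ∧ b.im = 1) := by lia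
  rcases ca with ⟨e1, e2⟩ | ⟨e1, e2⟩ | ⟨e1, e2⟩ <;> rcases cb with ⟨e3, e4⟩ | ⟨e3, e4⟩ | ⟨e3, e4⟩ <;>
    rw [e1, e2, e3, e4] at hPt <;> norm_num at hPt

end PlaneDart

/-! ### Divisibility of lattice vectors -/

namespace Eisenstein

theorem natCast_dvd_iff {k : ℕ} {z : Eisenstein} :
    (k : Eisenstein) ∣ z ↔ (k : ℤ) ∣ z.re ∧ (k : ℤ) ∣ z.im := by
  constructor
  · rintro ⟨w, rfl⟩
    simp
  · rintro ⟨⟨a, ha⟩, b, hb⟩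
    exact ⟨⟨a, b⟩, by ext <;> simp [ha, hb]⟩

theorem dvd_of_dvd_coxeter {k : ℕ} {z : Eisenstein}
    (h : k ∣ (coxeter z).1 ∧ k ∣ (coxeter z).2) : (k : Eisenstein) ∣ z := by
  by_cases hz : z = 0
  · rw [hz]; exact dvd_zero _
  obtain ⟨-, j, hj⟩ := coxeter_spec z hz
  rw [hj]
  refine Dvd.dvd.mul_left (natCast_dvd_iff.2 ⟨?_, ?_⟩) _
  · exact Int.natCast_dvd_natCast.2 h.1
  · exact Int.natCast_dvd_natCast.2 h.2

/-- The residue ring of the Eisenstein integers modulo `k`. -/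
abbrev Residue (k : ℕ) : Type := Eisenstein ⧸ Ideal.span {(k : Eisenstein)}

/-- The residue class of an Eisenstein integer. -/
abbrev residue (k : ℕ) : Eisenstein →+* Residue k := Ideal.Quotient.mk _

theorem residue_eq_iff {k : ℕ} {z w : Eisenstein} :
    residue k z = residue k w ↔ (k : Eisenstein) ∣ z - w := by
  rw [Ideal.Quotient.eq, Ideal.mem_span_singleton]

theorem residue_eq_zero_iff {k : ℕ} {z : Eisenstein} :
    residue k z = 0 ↔ (k : Eisenstein) ∣ z := by
  rw [Ideal.Quotient.eq_zero_iff_mem, Ideal.mem_span_singleton]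

end Eisenstein

/-- A map from the darts of a fullerene to the residues modulo `k` which describes where a dart
lies in the lattice modulo `k`, in the unfolding in which this dart has direction `1`. -/
structure LatticeLabelling {D : Type*} (F : Fullerene D) (k : ℕ) where
  val : D → Residue k
  val_flip : ∀ d, val (F.flip d) = -(val d + 1)
  val_ring : ∀ d, residue k omega * val (F.ring d) = val d

namespace PlaneDart

/-- The position modulo `k` of a lattice dart relative to the point `c`, in the frame in which the
dart has direction `1`. -/
def label (k : ℕ) (c : Eisenstein) (x : PlaneDart) : Residue k :=
  residue k ((x.2⁻¹ : Eisensteinˣ) * (x.1 - c))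

theorem label_congr {k : ℕ} {c c' : Eisenstein} (h : (k : Eisenstein) ∣ c' - c) (x : PlaneDart) :
    label k c' x = label k c x := by
  rw [label, label, residue_eq_iff, ← mul_sub]
  refine Dvd.dvd.mul_left ?_ _
  rw [dvd_sub_comm]
  simpa using h

/-- In the old frame the head is at `v + 1`; the frame of the reversed dart is turned by half a
turn. -/
theorem label_flip (k : ℕ) (c : Eisenstein) (x : PlaneDart) :
    label k c x.flip = -(label k c x + 1) := by
  have h : ((x.2⁻¹ : Eisensteinˣ) : Eisenstein) * x.2 = 1 := Units.inv_mul _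
  rw [label, label, ← map_one (residue k), ← map_add, ← map_neg]
  congr 1
  simp only [flip, inv_neg, Units.val_neg]
  linear_combination -h

theorem label_next (k : ℕ) (c : Eisenstein) (x : PlaneDart) :
    residue k (omega ^ 2 : Eisenstein) * label k c x.next = label k c x + 1 := by
  have h : ((x.2⁻¹ : Eisensteinˣ) : Eisenstein) * x.2 = 1 := Units.inv_mul _
  have h' : (((omega ^ 2)⁻¹ : Eisensteinˣ) : Eisenstein) * omega ^ 2 = 1 := Units.inv_mul _
  rw [label, label, ← map_one (residue k), ← map_add, ← map_mul]
  congr 1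
  simp only [next, mul_inv, Units.val_mul]
  linear_combination h + ((x.2⁻¹ : Eisensteinˣ) : Eisenstein) * (x.1 + x.2 - c) * h'

theorem label_comp_inv (k : ℕ) (c : Eisenstein) (g x : PlaneDart) :
    label k c (comp (inv g) x) = label k (g.1 + g.2 * c) x := by
  have h : ((g.2⁻¹ : Eisensteinˣ) : Eisenstein) * g.2 = 1 := Units.inv_mul _
  rw [label, label]
  congr 1
  simp only [comp, inv, mul_inv, inv_inv, Units.val_mul]
  linear_combination ((x.2⁻¹ : Eisensteinˣ) : Eisenstein) * (x.1 - g.1) * h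

end PlaneDart

/-! ### Gluing of facets, and the residue label of a dart -/

namespace FacetDecomposition

variable {D : Type u} {M : Type v} {F : Fullerene D} {S : TriSurface M}
  (P : FacetDecomposition F S)

/-- The interior of the unfolded facet on the left of an edge. -/
def facet (m : M) : Set ℂ :=
  openTriangle (P.corner m).toComplex (P.corner (S.next m)).toComplex
    (P.corner (S.next (S.next m))).toComplex

/-- The closed unfolded facet on the left of an edge. -/
def cfacet (m : M) : Set ℂ :=
  closedTriangle (P.corner m).toComplex (P.corner (S.next m)).toComplex
    (P.corner (S.next (S.next m))).toComplex

/-- The interior of an edge in the unfolding of the facet on its left. -/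
def openEdge (m : M) : Set ℂ :=
  openSegment ℝ (P.corner m).toComplex (P.corner (S.next m)).toComplex

/-- Positive on the side of the facet, negative on the other side of the edge. -/
noncomputable def side (m : M) (p : ℂ) : ℝ :=
  cross ((P.corner (S.next m)).toComplex - (P.corner m).toComplex) (p - (P.corner m).toComplex)

/-- The lattice triangle to the left of the dart `x` meets the interior of the facet. -/
def MeetsFacet (m : M) (x : PlaneDart) : Prop := (x.tri ∩ P.facet m).Nonempty

theorem facet_next (m : M) : P.facet (S.next m) = P.facet m := by
  rw [facet, S.next_next_next, openTriangle_rotate, facet]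

theorem isOpen_facet (m : M) : IsOpen (P.facet m) := isOpen_openTriangle _ _ _

theorem convex_facet (m : M) : Convex ℝ (P.facet m) := convex_openTriangle _ _ _

theorem meetsFacet_of_mem_nhds {m : M} {x : PlaneDart} {p : ℂ} (hx : p ∈ x.ctri)
    (h : p ∈ P.facet m) : P.MeetsFacet m x :=
  (PlaneDart.inter_tri_nonempty hx ((P.isOpen_facet m).mem_nhds h)).mono fun _ h => ⟨h.2, h.1⟩

theorem MeetsFacet.sameTri {P : FacetDecomposition F S} {m : M} {x y : PlaneDart}
    (h : P.MeetsFacet m x) (hxy : PlaneDart.SameTri x y) : P.MeetsFacet m y := by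
  rwa [MeetsFacet, hxy.tri_eq]

theorem MeetsFacet.next {P : FacetDecomposition F S} {m : M} {x : PlaneDart}
    (h : P.MeetsFacet m x) : P.MeetsFacet m x.next := by
  rwa [MeetsFacet, PlaneDart.tri_next]

theorem dev_flip {m : M} {x : PlaneDart} (h : P.MeetsFacet m x) (h' : P.MeetsFacet m x.flip) :
    P.dev m x.flip = F.flip (P.dev m x) := P.dev_plane_flip m x h h'

theorem dev_plane_next' {m : M} {x : PlaneDart} (h : P.MeetsFacet m x) :
    P.dev m x.next = F.dual.next (P.dev m x) := P.dev_plane_next m x h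

theorem dev_iterate_next {m : M} {x : PlaneDart} (h : P.MeetsFacet m x) (i : ℕ) :
    P.dev m (PlaneDart.next^[i] x) = F.dual.next^[i] (P.dev m x) := by
  induction i with
  | zero => rfl
  | succ i ih =>
    rw [Function.iterate_succ_apply', Function.iterate_succ_apply', ← ih]
    exact P.dev_plane_next m _ (h.sameTri ((PlaneDart.SameTri.refl x).iterate i))

theorem corner_ne (m : M) : (P.corner m).toComplex ≠ (P.corner (S.next m)).toComplex :=
  ne_of_cross_pos (P.ccw m)

/-- The rigid motion `g` moves the facet on the right of the edge `m` to its place beside the facet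
on the left. -/
structure IsGlue (m : M) (g : PlaneDart) : Prop where
  tail : g.1 + g.2 * P.corner (S.flip m) = P.corner (S.next m)
  head : g.1 + g.2 * P.corner (S.next (S.flip m)) = P.corner m
  same : ∀ {x : PlaneDart} {q : ℂ}, q ∈ P.openEdge m → q ∈ x.tri → P.MeetsFacet m x →
    P.MeetsFacet (S.flip m) (PlaneDart.comp (PlaneDart.inv g) x) →
    P.dev (S.flip m) (PlaneDart.comp (PlaneDart.inv g) x) = P.dev m x
  flip : ∀ {x : PlaneDart} {q : ℂ}, q ∈ P.openEdge m → q ∈ x.openEdge → P.MeetsFacet m x →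
    P.MeetsFacet (S.flip m) (PlaneDart.comp (PlaneDart.inv g) x.flip) →
    P.dev (S.flip m) (PlaneDart.comp (PlaneDart.inv g) x.flip) = F.flip (P.dev m x)

/-- The field `glue` asks for contact between the edge and a side of the lattice triangle. A
triangle that the edge passes through need not provide this at the given dart, but it does at one of
its three darts; `next` transfers the agreement back. -/
theorem exists_isGlue (m : M) : ∃ g, P.IsGlue m g := by
  obtain ⟨u, hu, hglue⟩ := P.glue m
  have key : ∀ y : PlaneDart, PlaneDart.comp
      (P.corner (S.next m) - u * P.corner (S.flip m), u) y =
      (P.corner (S.next m) + u * (y.1 - P.corner (S.flip m)), u * y.2) := by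
    intro y
    ext1
    · simp only [PlaneDart.comp]; ring
    · rfl
  refine ⟨(P.corner (S.next m) - u * P.corner (S.flip m), u), ?_, ?_, ?_, ?_⟩
  · simp
  · dsimp only; linear_combination hu
  · intro x q hq hx hm hf
    obtain ⟨i, hi, hseg⟩ := PlaneDart.exists_mem_segment_of_mem_tri hq hx
    have hm' := hm.sameTri ((PlaneDart.SameTri.refl x).iterate i)
    have hf' := hf.sameTri ((PlaneDart.SameTri.refl _).iterate i)
    have h := (hglue _ _ hm' hf' hseg).1 (by
      rw [← key, ← PlaneDart.iterate_next_comp, PlaneDart.comp_inv_comp])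
    rw [P.dev_iterate_next hm, P.dev_iterate_next hf] at h
    exact F.dual.next.injective.iterate i h
  · intro x q hq hx hm hf
    exact (hglue _ _ hm hf ⟨q, x.openEdge_subset_segment hx, hq⟩).2 (by
      rw [← key, PlaneDart.comp_inv_comp])

variable {P}

theorem side_eq_zero {m : M} {q : ℂ} (hq : q ∈ P.openEdge m) : P.side m q = 0 :=
  cross_eq_zero_of_mem_openSegment hq

theorem continuous_side (m : M) : Continuous (P.side m) := continuous_cross_sub _ _

namespace IsGlue

variable {m : M} {g : PlaneDart}

theorem place_tail (h : P.IsGlue m g) :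
    g.place (P.corner (S.flip m)).toComplex = (P.corner (S.next m)).toComplex := by
  rw [PlaneDart.place_toComplex, h.tail]

theorem place_head (h : P.IsGlue m g) :
    g.place (P.corner (S.next (S.flip m))).toComplex = (P.corner m).toComplex := by
  rw [PlaneDart.place_toComplex, h.head]

theorem side_flip (h : P.IsGlue m g) (p : ℂ) : P.side (S.flip m) p = -P.side m (g.place p) := by
  rw [side, side, ← PlaneDart.cross_place g, h.place_tail, h.place_head]
  simp [cross]; ring

theorem place_mem_openEdge (h : P.IsGlue m g) {q : ℂ} (hq : q ∈ P.openEdge m) :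
    (PlaneDart.inv g).place q ∈ P.openEdge (S.flip m) := by
  rw [openEdge, mem_openSegment_iff] at *
  obtain ⟨t, h0, h1, rfl⟩ := hq
  refine ⟨1 - t, by linarith, by linarith, ?_⟩
  rw [PlaneDart.place_lineMap, ← h.place_head, ← h.place_tail, PlaneDart.place_inv_place,
    PlaneDart.place_inv_place]
  push_cast; ring

/-- Near an interior point of an edge, the two facets at this edge fill everything except the
edge. -/
theorem eventually_mem (h : P.IsGlue m g) {q : ℂ} (hq : q ∈ P.openEdge m) :
    ∀ᶠ p in 𝓝 q, (0 < P.side m p → p ∈ P.facet m) ∧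
      (P.side m p < 0 → (PlaneDart.inv g).place p ∈ P.facet (S.flip m)) := by
  refine (eventually_mem_openTriangle (P.ccw m) hq).and ?_
  have := ((PlaneDart.continuous_place (PlaneDart.inv g)).tendsto q).eventually
    (eventually_mem_openTriangle (P.ccw (S.flip m)) (h.place_mem_openEdge hq))
  filter_upwards [this] with p hp hlt
  apply hp
  have e := h.side_flip ((PlaneDart.inv g).place p)
  rw [PlaneDart.place_place_inv] at e
  change 0 < P.side _ _
  rw [e]; linarith

theorem meets_of_mem (_ : P.IsGlue m g) {x : PlaneDart} {p : ℂ} (hx : p ∈ x.tri)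
    (hp : (PlaneDart.inv g).place p ∈ P.facet (S.flip m)) :
    P.MeetsFacet (S.flip m) (PlaneDart.comp (PlaneDart.inv g) x) :=
  ⟨_, PlaneDart.place_mem_tri_comp.2 hx, hp⟩

theorem exists_side_pos {q : ℂ} {U : Set ℂ} (hU : U ∈ 𝓝 q) (hq : P.side m q = 0) :
    ∃ p ∈ U, 0 < P.side m p := by
  obtain ⟨p, hp, h⟩ := exists_cross_gt (P.corner_ne m) hU
  exact ⟨p, hp, hq.symm.trans_lt h⟩

theorem exists_side_neg {q : ℂ} {U : Set ℂ} (hU : U ∈ 𝓝 q) (hq : P.side m q = 0) :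
    ∃ p ∈ U, P.side m p < 0 := by
  obtain ⟨p, hp, h⟩ := exists_cross_lt (P.corner_ne m) hU
  exact ⟨p, hp, h.trans_eq hq⟩

end IsGlue

/-- A point of a closed facet that is not a lattice point is an inner point of the facet or of one
of its edges. -/
theorem exists_mem_openEdge {m : M} {q : ℂ} (hq : q ∈ P.cfacet m) (ho : q ∉ P.facet m)
    (hL : q ∉ Set.range toComplex) : ∃ i < 3, q ∈ P.openEdge (S.next^[i] m) := by
  rcases mem_openSegment_of_boundary (P.ccw m) hq ho (fun h => hL ⟨_, h.symm⟩)
    (fun h => hL ⟨_, h.symm⟩) (fun h => hL ⟨_, h.symm⟩) with h | h | h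
  · exact ⟨0, by lia, h⟩
  · exact ⟨1, by lia, h⟩
  · refine ⟨2, by lia, ?_⟩
    change q ∈ openSegment ℝ _ (P.corner (S.next (S.next (S.next m)))).toComplex
    rwa [S.next_next_next]

theorem facet_iterate (m : M) (i : ℕ) : P.facet (S.next^[i] m) = P.facet m := by
  induction i with
  | zero => rfl
  | succ i ih => rw [Function.iterate_succ_apply', facet_next, ih]

theorem dev_iterate (m : M) (i : ℕ) : P.dev (S.next^[i] m) = P.dev m := by
  induction i with
  | zero => rfl
  | succ i ih => rw [Function.iterate_succ_apply', P.dev_next, ih]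

theorem meetsFacet_iterate {m : M} {x : PlaneDart} (i : ℕ) :
    P.MeetsFacet (S.next^[i] m) x ↔ P.MeetsFacet m x := by
  rw [MeetsFacet, facet_iterate, MeetsFacet]

section Label

variable {k : ℕ} (hk : ∀ m, (k : Eisenstein) ∣ P.vec m)
include hk

/-- Corners of one facet differ by sums of edge vectors, which are multiples of `k`. -/
theorem label_sameCycle {m m' : M} (h : S.next.SameCycle m m') (x : PlaneDart) :
    x.label k (P.corner m') = x.label k (P.corner m) := by
  obtain ⟨i, rfl⟩ := h
  induction i using Int.induction_on with
  | zero => rfl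
  | succ i ih =>
    rw [add_comm, zpow_add, zpow_one, Equiv.Perm.mul_apply, PlaneDart.label_congr (hk _), ih]
  | pred i ih =>
    rw [← ih, ← PlaneDart.label_congr (hk _)]
    congr 2
    rw [← Equiv.Perm.mul_apply, ← zpow_one_add]
    congr 2; ring

/-- The motion `g` takes the reference corner of the other facet to the far end of the edge `m`, and
the two ends of `m` agree modulo `k`. -/
theorem IsGlue.label_eq {m : M} {g : PlaneDart} (h : P.IsGlue m g) (x : PlaneDart) :
    (PlaneDart.comp (PlaneDart.inv g) x).label k (P.corner (S.flip m)) =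
      x.label k (P.corner m) := by
  rw [PlaneDart.label_comp_inv, h.tail, PlaneDart.label_congr (hk m)]

end Label

end FacetDecomposition

namespace FacetDecomposition

variable {D : Type u} {M : Type v} {F : Fullerene D} {S : TriSurface M}
  {P : FacetDecomposition F S} {k : ℕ}

theorem place_notMem_lattice {x : PlaneDart} {p : ℂ} (hp : p ∈ stdOpen) :
    x.place p ∉ Set.range toComplex := by
  rintro ⟨z, hz⟩
  exact x.lattice_notMem_tri z (hz ▸ ⟨p, hp, rfl⟩)

/-- Two appearances of `d` that both cover a point are the same by `disjoint`, up to the choice of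
corner. So only a point on an edge is critical, and there the two glued facets show `d` with the
same label and cover a neighbourhood apart from the edge. -/
theorem exists_label_locally (hk : ∀ m, (k : Eisenstein) ∣ P.vec m) (d : D) {p : ℂ}
    (hp : p ∈ stdOpen) : ∃ N ∈ 𝓝 p, ∃ v, ∀ m x, P.dev m x = d →
      ({q ∈ stdOpen | x.place q ∈ P.facet m} ∩ N).Nonempty →
        x.label k (P.corner m) = v := by
  have hopen : ∀ m (x : PlaneDart), IsOpen {q ∈ stdOpen | x.place q ∈ P.facet m} := fun m x =>
    PlaneDart.isOpen_stdOpen.inter ((P.isOpen_facet m).preimage x.continuous_place)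
  have hoverlap : ∀ {m m' x x'} {q : ℂ}, P.dev m x = d → P.dev m' x' = d → q ∈ stdOpen →
      x.place q ∈ P.facet m → x'.place q ∈ P.facet m' →
      x'.label k (P.corner m') = x.label k (P.corner m) := by
    intro m m' x x' q h h' hq hx hx'
    obtain ⟨hc, rfl⟩ := P.disjoint m m' x x' (h.trans h'.symm) q hq hx hx'
    exact label_sameCycle hk hc x
  obtain ⟨m, x, hd, hm, hx⟩ := P.cover d p
    (mem_stdClosed.2 ((mem_stdOpen.1 hp).imp le_of_lt (And.imp le_of_lt le_of_lt)))
  change P.MeetsFacet m x at hm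
  by_cases ho : x.place p ∈ P.facet m
  · refine ⟨_, (hopen m x).mem_nhds ⟨hp, ho⟩, x.label k (P.corner m), ?_⟩
    rintro m' x' hd' ⟨q, hq, hq'⟩
    exact hoverlap hd hd' hq.1 hq'.2 hq.2
  obtain ⟨i, -, he⟩ := exists_mem_openEdge hx ho (place_notMem_lattice hp)
  rw [← meetsFacet_iterate i] at hm
  rw [← dev_iterate m i] at hd
  clear hx ho
  generalize S.next^[i] m = m at he hm hd
  obtain ⟨g, hg⟩ := P.exists_isGlue m
  have hev := hg.eventually_mem he
  have hxp : x.place p ∈ x.tri := ⟨p, hp, rfl⟩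
  -- The lattice triangle passes through the edge, so the facet on the other side shows it as well.
  obtain ⟨r, ⟨hr, hrx⟩, hr'⟩ := IsGlue.exists_side_neg
    (inter_mem hev (x.isOpen_tri.mem_nhds hxp)) (side_eq_zero he)
  have hy := hg.meets_of_mem hrx (hr.2 hr')
  have hyd := (hg.same he hxp hm hy).trans hd
  obtain ⟨N, hN, hNo, hpN⟩ := mem_nhds_iff.1 hev
  refine ⟨_, x.continuous_place.continuousAt.preimage_mem_nhds (hNo.mem_nhds hpN),
    x.label k (P.corner m), ?_⟩
  rintro m' x' hd' ⟨q, hq, hq'⟩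
  -- A third facet could be compared only where one of the two is present; an open set has points
  -- off the line of the edge.
  obtain ⟨s, ⟨hs, hsN⟩, hne⟩ := exists_cross_ne (P.corner_ne m)
    (((hopen m' x').preimage (PlaneDart.inv x).continuous_place).inter hNo)
    ⟨x.place q, by simpa using hq, hq'⟩
  have hs2 : (PlaneDart.inv x).place s ∈ stdOpen := hs.1
  rcases hne.lt_or_gt with h | h
  · rw [hoverlap hyd hd' hs2 _ hs.2, hg.label_eq hk]
    rw [PlaneDart.place_comp, PlaneDart.place_place_inv]
    exact (hN hsN).2 h
  · exact hoverlap hd hd' hs2 (by rw [PlaneDart.place_place_inv]; exact (hN hsN).1 h) hs.2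

/-- The place modulo `k` of a dart does not depend on the facet in which one looks for it. -/
theorem label_eq_of_dev_eq (hk : ∀ m, (k : Eisenstein) ∣ P.vec m) {m m' : M} {x x' : PlaneDart}
    (hm : P.MeetsFacet m x) (hm' : P.MeetsFacet m' x') (h : P.dev m x = P.dev m' x') :
    x.label k (P.corner m) = x'.label k (P.corner m') := by
  have hpre : IsPreconnected stdOpen := (convex_openTriangle _ _ _).isPreconnected
  have hT : ∀ {m : M} {x : PlaneDart}, P.MeetsFacet m x →
      ({q ∈ stdOpen | x.place q ∈ P.facet m} ∩ stdOpen).Nonempty := by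
    rintro m x ⟨_, ⟨q, hq, rfl⟩, hf⟩
    exact ⟨q, ⟨hq, hf⟩, hq⟩
  -- The family consists of all appearances of the dart in facets, each seen as the part of the
  -- standard triangle that it covers.
  refine hpre.family_induction
    (fun i : {i : M × PlaneDart // P.dev i.1 i.2 = P.dev m x ∧ P.MeetsFacet i.1 i.2} =>
      {q ∈ stdOpen | i.1.2.place q ∈ P.facet i.1.1})
    (fun i => x.label k (P.corner m) = i.1.2.label k (P.corner i.1.1))
    (fun p hp => ?_) (fun p hp N hN => ?_) (i := ⟨(m, x), rfl, hm⟩) (j := ⟨(m', x'), h.symm, hm'⟩)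
    (hT hm) (hT hm') rfl
  · obtain ⟨N, hN, v, hv⟩ := exists_label_locally hk (P.dev m x) hp
    refine ⟨N, hN, x.label k (P.corner m) = v, fun i hi => ?_⟩
    rw [hv _ _ i.2.1 hi]
  · obtain ⟨n, y, hd, hn, hy⟩ := P.cover (P.dev m x) p
      (mem_stdClosed.2 ((mem_stdOpen.1 hp).imp le_of_lt (And.imp le_of_lt le_of_lt)))
    refine ⟨⟨(n, y), hd, hn⟩, ?_⟩
    obtain ⟨_, ⟨q, ⟨hq, hqN⟩, rfl⟩, hqf⟩ := inter_openTriangle_nonempty (P.ccw n) hy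
      (U := y.place '' (stdOpen ∩ N)) (by
        have h1 : stdOpen ∩ N ∈ 𝓝 p := inter_mem (PlaneDart.isOpen_stdOpen.mem_nhds hp) hN
        have h2 := (PlaneDart.continuous_place (PlaneDart.inv y)).continuousAt (x := y.place p)
          |>.preimage_mem_nhds (t := stdOpen ∩ N) (by simpa using h1)
        refine mem_of_superset h2 fun r hr => ⟨_, hr, by simp⟩)
    exact ⟨q, ⟨hq, hqf⟩, hqN⟩

theorem exists_dev_eq (P : FacetDecomposition F S) (d : D) :
    ∃ m x, P.dev m x = d ∧ P.MeetsFacet m x := by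
  obtain ⟨m, x, h, h', -⟩ := P.cover d 0 (mem_stdClosed.2 (by simp))
  exact ⟨m, x, h, h'⟩

theorem openEdge_notMem_lattice {x : PlaneDart} {p : ℂ} (hp : p ∈ x.openEdge) :
    p ∉ Set.range toComplex := by
  rintro ⟨z, rfl⟩
  obtain ⟨t, h0, h1, h⟩ := hp
  have h2 := PlaneDart.place_toComplex (PlaneDart.inv x) z
  rw [h, PlaneDart.place_inv_place] at h2
  have h3 := congrArg lx h2
  rw [lx_ofReal, lx_toComplex] at h3
  rw [h3] at h0 h1
  norm_cast at h0 h1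
  lia

/-- The midpoint of the dart is not a lattice point, so it lies inside a facet or inside an edge.
Either one facet shows both the dart and its reversal, or the glued facet shows the reversal;
`label_flip` applies in both cases. -/
theorem exists_label_flip (hk : ∀ m, (k : Eisenstein) ∣ P.vec m) (d : D) :
    ∃ m x m' x', P.dev m x = d ∧ P.MeetsFacet m x ∧ P.dev m' x' = F.flip d ∧
      P.MeetsFacet m' x' ∧ x'.label k (P.corner m') = -(x.label k (P.corner m) + 1) := by
  obtain ⟨m, x, hd, hm, hx⟩ := P.cover d ((1 / 2 : ℝ) : ℂ)
    (mem_stdClosed.2 (by rw [lx_ofReal, ly_ofReal]; norm_num))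
  change P.MeetsFacet m x at hm
  have hxe : x.place ((1 / 2 : ℝ) : ℂ) ∈ x.openEdge := ⟨1 / 2, by norm_num, by norm_num, rfl⟩
  have hxf : x.place ((1 / 2 : ℝ) : ℂ) ∈ x.flip.ctri :=
    PlaneDart.openEdge_subset_ctri _ (by rwa [PlaneDart.openEdge_flip])
  generalize x.place ((1 / 2 : ℝ) : ℂ) = p at hx hxe hxf
  have hsimple : ∀ m, P.dev m x = d → P.MeetsFacet m x → P.MeetsFacet m x.flip →
      ∃ m x m' x', P.dev m x = d ∧ P.MeetsFacet m x ∧ P.dev m' x' = F.flip d ∧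
      P.MeetsFacet m' x' ∧ x'.label k (P.corner m') = -(x.label k (P.corner m) + 1) := by
    intro m hd hm hf
    exact ⟨m, x, m, x.flip, hd, hm, by rw [P.dev_flip hm hf, hd], hf, PlaneDart.label_flip k _ x⟩
  by_cases ho : p ∈ P.facet m
  · exact hsimple m hd hm (P.meetsFacet_of_mem_nhds hxf ho)
  obtain ⟨i, -, he⟩ := exists_mem_openEdge hx ho (openEdge_notMem_lattice hxe)
  rw [← meetsFacet_iterate i] at hm
  rw [← dev_iterate m i] at hd
  clear hx ho
  generalize S.next^[i] m = m at he hm hd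
  obtain ⟨g, hg⟩ := P.exists_isGlue m
  obtain ⟨N, hN, hNo, hpN⟩ := mem_nhds_iff.1 (hg.eventually_mem he)
  obtain ⟨s, ⟨hsN, hs⟩, hne⟩ := exists_cross_ne (P.corner_ne m) (hNo.inter x.flip.isOpen_tri)
    (PlaneDart.inter_tri_nonempty hxf (hNo.mem_nhds hpN))
  rcases hne.lt_or_gt with h | h
  · have hy := hg.meets_of_mem hs ((hN hsN).2 h)
    refine ⟨m, x, _, _, hd, hm, (hg.flip he hxe hm hy).trans (by rw [hd]), hy, ?_⟩
    rw [hg.label_eq hk, PlaneDart.label_flip]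
  · exact hsimple m hd hm ⟨s, hs, (hN hsN).1 h⟩

/-- Any appearance of a dart may serve to define its label. The rule for `ring` needs no geometry of
its own, because `ring` is `flip` after the inverse of `next`. -/
theorem exists_latticeLabelling (hk : ∀ m, (k : Eisenstein) ∣ P.vec m) :
    ∃ c : LatticeLabelling F k, ∀ m x, P.MeetsFacet m x →
      c.val (P.dev m x) = x.label k (P.corner m) := by
  choose m x hd hm using P.exists_dev_eq
  have key : ∀ n y, P.MeetsFacet n y →
      (x (P.dev n y)).label k (P.corner (m (P.dev n y))) = y.label k (P.corner n) :=
    fun n y h => label_eq_of_dev_eq hk (hm _) h (hd _)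
  have hflip : ∀ d, (x (F.flip d)).label k (P.corner (m (F.flip d))) =
      -((x d).label k (P.corner (m d)) + 1) := by
    intro d
    obtain ⟨n, y, n', y', h1, h2, h3, h4, h5⟩ := exists_label_flip hk d
    rw [← h3, key _ _ h4, h5, ← key _ _ h2, h1]
  refine ⟨⟨fun d => (x d).label k (P.corner (m d)), hflip, ?_⟩, key⟩
  intro d
  obtain ⟨e, he⟩ : ∃ e, F.dual.next e = d := F.dual.next.surjective d
  have hring : F.ring d = F.flip e := by
    rw [← he]; simp [Fullerene.dual]
  have h2 := key _ _ (hm e).next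
  rw [P.dev_plane_next' (hm e), hd, he] at h2
  have h5 := PlaneDart.label_next k (P.corner (m e)) (x e)
  have h3 : (omega : Eisenstein) * omega ^ 2 = -1 := by
    rw [← pow_succ']; exact congrArg Units.val omega_cube
  have h4 : residue k omega * residue k (omega ^ 2 : Eisenstein) = -1 := by
    rw [← map_mul, h3, map_neg, map_one]
  rw [hring, hflip, h2]
  linear_combination (residue k omega) * h5 - (x e).next.label k (P.corner (m e)) * h4

end FacetDecomposition

/-! ### The triangular patch of side `k` in the lattice -/

namespace Eisenstein

@[simp] theorem re_three : (3 : Eisenstein).re = 3 := rfl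
@[simp] theorem im_three : (3 : Eisenstein).im = 0 := rfl

end Eisenstein

namespace PlaneDart

/-- Three times the centre of the lattice triangle on the left of a dart. -/
def centre (x : PlaneDart) : Eisenstein := 3 * x.1 + x.2 * (1 + omega)

/-- The lattice triangle on the left of a dart lies in the triangle with corners `0, k, k ω`. -/
def InPatch (k : ℕ) (x : PlaneDart) : Prop :=
  0 < x.centre.re ∧ 0 < x.centre.im ∧ x.centre.re + x.centre.im < 3 * k

/-- `centre` is the sum of the three corners. -/
theorem centre_next (x : PlaneDart) : x.next.centre = x.centre := by
  have h := omega_sq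
  simp only [centre, next, Units.val_mul, Units.val_pow_eq_pow_val]
  linear_combination (x.2 : Eisenstein) * (2 + omega) * h

theorem centre_comp (g x : PlaneDart) :
    (comp g x).centre = 3 * g.1 + g.2 * x.centre := by
  simp only [centre, comp, Units.val_mul]; ring

theorem inPatch_next {k : ℕ} {x : PlaneDart} : InPatch k x.next ↔ InPatch k x := by
  simp only [InPatch, centre_next]

theorem inPatch_iterate_next {k : ℕ} {x : PlaneDart} (i : ℕ) :
    InPatch k (next^[i] x) ↔ InPatch k x := by
  induction i with
  | zero => rfl
  | succ i ih => rw [Function.iterate_succ_apply', inPatch_next, ih]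

theorem inPatch_up {k : ℕ} {z : Eisenstein} :
    InPatch k (z, 1) ↔ 0 ≤ z.re ∧ 0 ≤ z.im ∧ z.re + z.im < k := by
  simp [InPatch, centre]
  lia

theorem inPatch_down {k : ℕ} {z : Eisenstein} :
    InPatch k (z, -1) ↔ 1 ≤ z.re ∧ 1 ≤ z.im ∧ z.re + z.im ≤ k := by
  simp [InPatch, centre]
  lia

/-- The rotation of the triangle with corners `0, k, k ω` by a third of a full turn. -/
def turn (k : ℕ) : PlaneDart := ((k : Eisenstein), omega ^ 2)

/-- The rotation by half a turn around the midpoint of the edge from `0` to `k`. -/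
def halfTurn (k : ℕ) : PlaneDart := ((k : Eisenstein), -1)

theorem inPatch_turn {k : ℕ} {x : PlaneDart} : InPatch k (comp (turn k) x) ↔ InPatch k x := by
  simp [InPatch, centre_comp, turn]
  lia

theorem turn_turn_turn (k : ℕ) (x : PlaneDart) :
    comp (turn k) (comp (turn k) (comp (turn k) x)) = x := by
  have h := omega_sq
  have h3 := omega_cube
  ext1
  · simp only [comp, turn, Units.val_pow_eq_pow_val]
    linear_combination ((k : Eisenstein) * (omega ^ 2 + omega + 1) + x.1 *
      (omega ^ 4 + omega ^ 3 - omega - 1)) * h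
  · simp only [comp, turn, ← mul_assoc, ← pow_add]
    rw [show 2 + 2 + 2 = 3 * 2 from rfl, pow_mul, h3]; simp

theorem inPatch_iterate_turn {k : ℕ} {x : PlaneDart} (i : ℕ) :
    InPatch k ((comp (turn k))^[i] x) ↔ InPatch k x := by
  induction i with
  | zero => rfl
  | succ i ih => rw [Function.iterate_succ_apply', inPatch_turn, ih]

theorem base_inPatch {k : ℕ} (hk : 0 < k) : InPatch k base :=
  inPatch_up.2 (by simp; exact hk)

theorem flip_mk (z : Eisenstein) (u : Eisensteinˣ) : flip (z, u) = (z + u, -u) := rfl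

theorem next_mk (z : Eisenstein) (u : Eisensteinˣ) : next (z, u) = (z + u, omega ^ 2 * u) := rfl

theorem omega_sq_mul_neg_omega : omega ^ 2 * -omega = 1 := by
  rw [mul_neg, ← pow_succ, omega_cube, neg_neg]

theorem omega_sq_mul_omega : omega ^ 2 * omega = -1 := by
  rw [← pow_succ, omega_cube]

theorem omega_sq_mul_omega_sq : omega ^ 2 * omega ^ 2 = -omega := by
  rw [← pow_add, show 2 + 2 = 3 + 1 from rfl, pow_add, omega_cube]; simp

/-- Cross the right side of the upward triangle at `z` into a downward triangle, and leave that one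
through either of its other two sides. -/
theorem patch_induction_up {k : ℕ} (R : PlaneDart → Prop)
    (hn : ∀ x, InPatch k x → R x → R x.next)
    (hf : ∀ x, InPatch k x → InPatch k x.flip → R x → R x.flip) {z : Eisenstein}
    (hz : InPatch k (z, 1)) (h : R (z, 1)) (hz' : z.re + z.im + 1 < k) :
    R (z + 1, 1) ∧ R (z + omega, 1) := by
  rw [inPatch_up] at hz
  have hdown : InPatch k (z + 1 + omega, -1) := inPatch_down.2 (by simp; lia)
  have hup : InPatch k (z, 1) := inPatch_up.2 hz
  have hup1 : InPatch k (z + 1, 1) := inPatch_up.2 (by simp; lia)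
  have hup2 : InPatch k (z + omega, 1) := inPatch_up.2 (by simp; lia)
  have e1 : next (z, 1) = (z + 1, omega ^ 2) := by simp [next_mk]
  have e2 : flip (z + 1, omega ^ 2) = (z + omega, -omega ^ 2) := by
    rw [flip_mk, Units.val_pow_eq_pow_val, omega_sq]; congr 1; ring
  have e3 : next (z + 1 + omega, -1) = (z + omega, -omega ^ 2) := by
    rw [next_mk]; congr 1; simp; ring
  have e4 : next (z + omega, -omega ^ 2) = (z + 1, omega) := by
    rw [next_mk, mul_neg, omega_sq_mul_omega_sq, neg_neg, Units.val_neg, Units.val_pow_eq_pow_val,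
      omega_sq]; congr 1; ring
  have e5 : flip (z + 1, omega) = (z + 1 + omega, -omega) := rfl
  have e6 : next (z + 1 + omega, -omega) = (z + 1, 1) := by
    rw [next_mk, omega_sq_mul_neg_omega]; simp
  have e7 : next (z + 1, omega) = (z + 1 + omega, -1) := by
    rw [next_mk, omega_sq_mul_omega]
  have e8 : flip (z + 1 + omega, -1) = (z + omega, 1) := by
    rw [flip_mk]; simp; ring
  have p1 : InPatch k (z + 1, omega ^ 2) := by rwa [← e1, inPatch_next]
  have p2 : InPatch k (z + omega, -omega ^ 2) := by rwa [← e3, inPatch_next]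
  have p3 : InPatch k (z + 1, omega) := by rwa [← e4, inPatch_next]
  have p4 : InPatch k (z + 1 + omega, -omega) := by rwa [← e6, inPatch_next] at hup1
  have r1 : R (z + 1, omega ^ 2) := e1 ▸ hn _ hup h
  have r2 : R (z + omega, -omega ^ 2) := e2 ▸ hf _ p1 (e2 ▸ p2) r1
  have r3 : R (z + 1, omega) := e4 ▸ hn _ p2 r2
  have r4 : R (z + 1 + omega, -omega) := e5 ▸ hf _ p3 (e5 ▸ p4) r3
  have r5 : R (z + 1 + omega, -1) := e7 ▸ hn _ p3 r3
  exact ⟨e6 ▸ hn _ p4 r4, e8 ▸ hf _ hdown (e8 ▸ hup2) r5⟩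

/-- The lattice triangles in the triangle with corners `0, k, k ω` are connected with each other. -/
theorem patch_induction {k : ℕ} (R : PlaneDart → Prop)
    (hn : ∀ x, InPatch k x → R x → R x.next)
    (hf : ∀ x, InPatch k x → InPatch k x.flip → R x → R x.flip) (h0 : R base) {x : PlaneDart}
    (hx : InPatch k x) : R x := by
  have hrow : ∀ b : ℕ, b < k → R (⟨0, b⟩, 1) := by
    intro b hb
    induction b with
    | zero => exact h0
    | succ b ih =>
      have := (patch_induction_up R hn hf (z := ⟨0, b⟩) (inPatch_up.2 (by simp; lia)) (ih (by lia))
        (by simp; lia)).2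
      convert this using 2
      ext <;> simp
  have hup : ∀ a b : ℕ, a + b < k → R (⟨a, b⟩, 1) := by
    intro a b hb
    induction a with
    | zero => exact hrow b (by lia)
    | succ a ih =>
      have := (patch_induction_up R hn hf (z := ⟨a, b⟩) (inPatch_up.2 (by simp; lia)) (ih (by lia))
        (by simp; lia)).1
      convert this using 2
      ext <;> simp
  have hup' : ∀ z : Eisenstein, InPatch k (z, 1) → R (z, 1) := by
    rintro ⟨a, b⟩ h
    rw [inPatch_up] at h
    obtain ⟨h1, h2, h3⟩ := h
    dsimp at h1 h2 h3
    lift a to ℕ using h1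
    lift b to ℕ using h2
    exact hup a b (by lia)
  have hnn : ∀ i x, InPatch k x → R x → R (next^[i] x) := by
    intro i x hx h
    induction i with
    | zero => exact h
    | succ i ih => rw [Function.iterate_succ_apply']; exact hn _ ((inPatch_iterate_next i).2 hx) ih
  obtain ⟨i, hi, h⟩ := exists_iterate_next_dir x
  rw [← iterate_next_inverse x hi]
  have hx' := (inPatch_iterate_next i).2 hx
  generalize next^[i] x = y at h hx'
  apply hnn _ _ hx'
  obtain ⟨z, u⟩ := y
  dsimp at h
  rcases h with rfl | rfl
  · exact hup' z hx'
  · have e : flip (z - 1, 1) = (z, -1) := by rw [flip_mk]; simp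
    have hu : InPatch k (z - 1, 1) := by
      rw [inPatch_down] at hx'
      exact inPatch_up.2 (by simp; lia)
    exact e ▸ hf _ hu (e ▸ hx') (hup' _ hu)

end PlaneDart

/-! ### Walks on a fullerene that imitate walks in the lattice -/

namespace Fullerene

variable {D : Type u} (F : Fullerene D)

theorem dual_next_apply (d : D) : F.dual.next d = F.ring⁻¹ (F.flip d) := rfl

theorem ring_dual_next (d : D) : F.ring (F.dual.next d) = F.flip d := by
  simp [dual_next_apply]

theorem flip_dual_next (d : D) : F.flip (F.dual.next d) = F.ring (F.flip (F.ring d)) := by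
  have h1 : F.dual.next (F.flip (F.ring d)) = d := by
    simp [dual_next_apply, F.flip_flip]
  have h := F.dual.next_next_next (F.flip (F.ring d))
  rw [h1] at h
  rw [← h, ring_dual_next]

/-- One step straight ahead, across a hexagon of the fullerene. -/
def straight : Equiv.Perm D := F.ring ^ 3 * F.flip

/-- The parallel displacement of a dart by one step in the direction `60°` to its left. -/
def shiftLeft : Equiv.Perm D := F.ring⁻¹ * F.straight * F.ring

theorem straight_apply (d : D) : F.straight d = F.ring (F.ring (F.ring (F.flip d))) := rfl

theorem shiftLeft_apply (d : D) : F.shiftLeft d = F.ring (F.ring (F.flip (F.ring d))) := by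
  simp [shiftLeft, straight_apply]

/-- A downward triangle separates `d` from its shift. Only the closing up of triangles enters, so no
ring needs to be a hexagon. -/
theorem next_flip_shiftLeft (d : D) :
    F.dual.next (F.flip (F.shiftLeft d)) = F.flip (F.dual.next d) := by
  rw [dual_next_apply, F.flip_flip, shiftLeft_apply, flip_dual_next]
  simp

theorem next_flip (d : D) : F.dual.next (F.flip d) = F.ring⁻¹ d := by
  rw [dual_next_apply, F.flip_flip]

theorem next_next (d : D) : F.dual.next (F.dual.next d) = F.flip (F.ring d) := by
  have h1 : F.dual.next (F.flip (F.ring d)) = d := by simp [next_flip]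
  have h := F.dual.next_next_next (F.flip (F.ring d))
  rwa [h1] at h

section Hexagon

variable {F} {d : D} (h : (F.ring ^ 6) (F.flip d) = F.flip d)
include h

/-- The two ways around the parallelogram differ by the turning at the head of `d`. At a hexagon
four turns one way equal two turns the other way, and the difference disappears. -/
theorem straight_shiftLeft : F.straight (F.shiftLeft d) = F.shiftLeft (F.straight d) := by
  have h' : F.ring (F.ring (F.ring (F.ring (F.flip d)))) = F.ring⁻¹ (F.ring⁻¹ (F.flip d)) := by
    rw [Equiv.Perm.eq_inv_iff_eq, Equiv.Perm.eq_inv_iff_eq]; exact h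
  have e : ∀ d, F.ring (F.flip (F.ring d)) = F.flip (F.ring⁻¹ (F.flip d)) := fun d =>
    (F.flip_dual_next d).symm
  rw [shiftLeft_apply, straight_apply, straight_apply, shiftLeft_apply, h',
    e (F.ring (F.flip (F.ring d))), e d, F.flip_flip]

theorem next_next_straight :
    F.dual.next (F.dual.next (F.flip (F.shiftLeft d))) =
      F.flip (F.dual.next (F.dual.next (F.straight d))) := by
  have h' : F.ring (F.ring (F.ring (F.ring (F.flip d)))) = F.ring⁻¹ (F.ring⁻¹ (F.flip d)) := by
    rw [Equiv.Perm.eq_inv_iff_eq, Equiv.Perm.eq_inv_iff_eq]; exact h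
  rw [next_flip_shiftLeft, next_next, next_flip, F.flip_flip, straight_apply, h', dual_next_apply]

theorem straight_flip_straight : F.straight (F.flip (F.straight d)) = F.flip d := by
  rw [straight_apply, F.flip_flip, straight_apply]
  exact h

end Hexagon


theorem ring_pow_eq_self (d : D) :
    (F.ring ^ 6) d = d ∨ (F.ring ^ 5) d = d := by
  have h := Function.isPeriodicPt_minimalPeriod F.ring d
  rcases F.ring_size d with h' | h'
  · right
    change Function.minimalPeriod F.ring d = 5 at h'
    rw [h'] at h
    rw [Equiv.Perm.coe_pow]; exact h
  · left
    change Function.minimalPeriod F.ring d = 6 at h'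
    rw [h'] at h
    rw [Equiv.Perm.coe_pow]; exact h

/-- The displacement of a dart by a lattice vector, where the plane is unfolded so that the dart
has direction `1`. -/
def walk (z : Eisenstein) : Equiv.Perm D := F.shiftLeft ^ z.im * F.straight ^ z.re

/-- The dart to which one gets when one moves as one does in the lattice from `0 → 1` to `x`. -/
def transport (x : PlaneDart) : Equiv.Perm D :=
  if x.2 = 1 then F.walk x.1
  else if x.2 = omega ^ 2 then F.dual.next * F.walk (x.1 - 1)
  else if x.2 = -omega then F.dual.next * F.dual.next * F.walk (x.1 - omega)
  else if x.2 = -1 then F.flip * F.walk (x.1 - 1)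
  else if x.2 = -omega ^ 2 then F.dual.next * F.flip * F.walk x.1
  else F.dual.next * F.dual.next * F.flip * F.walk (x.1 + omega - 1)

section Transport

variable (z : Eisenstein) (d : D)

theorem transport_one : F.transport (z, 1) d = F.walk z d := by simp [transport]

theorem transport_omega_sq :
    F.transport (z, omega ^ 2) d = F.dual.next (F.walk (z - 1) d) := by
  simp [transport, Units.ext_iff, QuadraticAlgebra.ext_iff, -Units.val_eq_one,
    -Units.val_eq_neg_one]

theorem transport_neg_omega :
    F.transport (z, -omega) d = F.dual.next (F.dual.next (F.walk (z - omega) d)) := by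
  simp [transport, Units.ext_iff, QuadraticAlgebra.ext_iff, -Units.val_eq_one,
    -Units.val_eq_neg_one]

theorem transport_neg_one : F.transport (z, -1) d = F.flip (F.walk (z - 1) d) := by
  simp [transport, Units.ext_iff, QuadraticAlgebra.ext_iff, -Units.val_eq_one,
    -Units.val_eq_neg_one]

theorem transport_neg_omega_sq :
    F.transport (z, -omega ^ 2) d = F.dual.next (F.flip (F.walk z d)) := by
  simp [transport, Units.ext_iff, QuadraticAlgebra.ext_iff, -Units.val_eq_one,
    -Units.val_eq_neg_one]

theorem transport_omega : F.transport (z, omega) d =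
    F.dual.next (F.dual.next (F.flip (F.walk (z + omega - 1) d))) := by
  simp [transport, Units.ext_iff, QuadraticAlgebra.ext_iff, -Units.val_eq_one,
    -Units.val_eq_neg_one]

end Transport

theorem transport_base (d : D) : F.transport PlaneDart.base d = d := by
  simp [PlaneDart.base, transport_one, walk]

/-- The six cases of `transport` fix one dart of each lattice triangle by a walk and derive the
others by `next`, so this holds in the whole plane. Hexagons are needed only for passing between
triangles. -/
theorem transport_next (x : PlaneDart) (d : D) :
    F.transport x.next d = F.dual.next (F.transport x d) := by
  obtain ⟨z, u⟩ := x
  have h := omega_sq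
  have h3 := F.dual.next_next_next
  rcases unit_cases u with rfl | rfl | rfl | rfl | rfl | rfl
  · rw [PlaneDart.next_mk, mul_one, transport_omega_sq, transport_one]; simp
  · rw [PlaneDart.next_mk, PlaneDart.omega_sq_mul_omega, transport_neg_one, transport_omega, h3]
  · rw [PlaneDart.next_mk, PlaneDart.omega_sq_mul_omega_sq, transport_neg_omega,
      transport_omega_sq, Units.val_pow_eq_pow_val, h]
    congr 4; ring
  · rw [PlaneDart.next_mk, mul_neg, mul_one, transport_neg_one, transport_neg_omega_sq]
    congr 4
  · rw [PlaneDart.next_mk, PlaneDart.omega_sq_mul_neg_omega, transport_one, transport_neg_omega, h3]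
    congr 2
  · rw [PlaneDart.next_mk, mul_neg, PlaneDart.omega_sq_mul_omega_sq, neg_neg,
      transport_neg_omega_sq, transport_omega, Units.val_neg, Units.val_pow_eq_pow_val, h]
    congr 5; ring

theorem walk_add_omega (z : Eisenstein) (d : D) :
    F.walk (z + omega) d = F.shiftLeft (F.walk z d) := by
  simp only [walk, QuadraticAlgebra.im_add, QuadraticAlgebra.re_add, im_omega, re_omega, add_zero]
  rw [add_comm, zpow_one_add]; rfl

end Fullerene

/-! ### Labels along walks, and the wrapping of a patch onto the surface -/

namespace LatticeLabelling

variable {D : Type u} {F : Fullerene D} {k : ℕ} (c : LatticeLabelling F k)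

theorem residue_omega_sq : residue k omega ^ 2 = residue k omega - 1 := by
  rw [← map_pow, omega_sq, map_sub, map_one]

/-- Darts at a pentagon lie at a lattice point that is `0` modulo `k`. -/
theorem val_eq_zero_of_ring_pow_five {d : D} (h : (F.ring ^ 5) d = d) : c.val d = 0 := by
  have h1 := c.val_ring d
  have h2 := c.val_ring (F.ring d)
  have h3 := c.val_ring (F.ring (F.ring d))
  have h4 := c.val_ring (F.ring (F.ring (F.ring d)))
  have h5 := c.val_ring (F.ring (F.ring (F.ring (F.ring d))))
  have h6 : F.ring (F.ring (F.ring (F.ring (F.ring d)))) = d := h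
  rw [h6] at h5
  have hw := residue_omega_sq (k := k)
  set w := residue k omega
  have e : w ^ 5 * c.val d = c.val d := by
    linear_combination h1 + w * h2 + w ^ 2 * h3 + w ^ 3 * h4 + w ^ 4 * h5
  have e5 : w ^ 5 = 1 - w := by linear_combination (w ^ 3 + w ^ 2 - 1) * hw
  rw [e5] at e
  -- `e` says that `w` annihilates the label, and `1 - w` is the inverse of `w`.
  linear_combination -(1 - w) * e + c.val d * hw

theorem ring_pow_six {d : D} (h : c.val d ≠ 0) : (F.ring ^ 6) d = d :=
  (F.ring_pow_eq_self d).resolve_right fun h' => h (c.val_eq_zero_of_ring_pow_five h')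

theorem ring_pow_six_flip {d : D} (h : c.val d + 1 ≠ 0) : (F.ring ^ 6) (F.flip d) = F.flip d :=
  c.ring_pow_six (by rw [c.val_flip]; exact neg_ne_zero.2 h)

theorem val_next (d : D) : residue k omega ^ 2 * c.val (F.dual.next d) = c.val d + 1 := by
  have h := c.val_ring (F.dual.next d)
  rw [F.ring_dual_next, c.val_flip] at h
  have hw := residue_omega_sq (k := k)
  linear_combination -residue k omega ^ 2 * h - (c.val d + 1) * (residue k omega + 1) * hw

theorem val_straight (d : D) : c.val (F.straight d) = c.val d + 1 := by
  have h1 := c.val_ring (F.flip d)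
  have h2 := c.val_ring (F.ring (F.flip d))
  have h3 := c.val_ring (F.ring (F.ring (F.flip d)))
  rw [F.straight_apply]
  rw [c.val_flip] at h1
  have hw := residue_omega_sq (k := k)
  linear_combination -h1 - residue k omega * h2 - residue k omega ^ 2 * h3 +
    (residue k omega + 1) * c.val (F.ring (F.ring (F.ring (F.flip d)))) * hw

theorem val_shiftLeft (d : D) : c.val (F.shiftLeft d) = c.val d + residue k omega := by
  have h : F.ring (F.shiftLeft d) = F.straight (F.ring d) := by simp [Fullerene.shiftLeft]
  have h1 := c.val_ring (F.shiftLeft d)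
  rw [h, c.val_straight] at h1
  have h2 := c.val_ring d
  linear_combination -h1 + h2

theorem val_straight_zpow (n : ℤ) (d : D) : c.val ((F.straight ^ n) d) = c.val d + n := by
  induction n using Int.induction_on generalizing d with
  | zero => simp
  | succ n ih => rw [zpow_add_one, Equiv.Perm.mul_apply, ih, c.val_straight]; push_cast; ring
  | pred n ih =>
    have h := c.val_straight ((F.straight ^ (-(n : ℤ) - 1)) d)
    rw [← Equiv.Perm.mul_apply, ← zpow_one_add, add_sub_cancel, ih] at h
    push_cast at h ⊢
    linear_combination -h

theorem val_shiftLeft_zpow (n : ℤ) (d : D) :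
    c.val ((F.shiftLeft ^ n) d) = c.val d + n * residue k omega := by
  induction n using Int.induction_on generalizing d with
  | zero => simp
  | succ n ih => rw [zpow_add_one, Equiv.Perm.mul_apply, ih, c.val_shiftLeft]; push_cast; ring
  | pred n ih =>
    have h := c.val_shiftLeft ((F.shiftLeft ^ (-(n : ℤ) - 1)) d)
    rw [← Equiv.Perm.mul_apply, ← zpow_one_add, add_sub_cancel, ih] at h
    push_cast at h ⊢
    linear_combination -h

theorem val_walk (z : Eisenstein) (d : D) : c.val (F.walk z d) = c.val d + residue k z := by
  have hz : z = (z.re : Eisenstein) + z.im * omega := by ext <;> simp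
  rw [Fullerene.walk, Equiv.Perm.mul_apply, c.val_shiftLeft_zpow, c.val_straight_zpow]
  conv_rhs => rw [hz]
  simp only [map_add, map_mul, map_intCast]
  ring

/-- In the frame of `d` the transported dart starts at `c.val d + x.1`; multiplication by `x.2`
converts its label from its own frame to that of `d`. -/
theorem val_transport (x : PlaneDart) (d : D) :
    residue k x.2 * c.val (F.transport x d) = c.val d + residue k x.1 := by
  have hup : ∀ z, residue k (1 : Eisensteinˣ) * c.val (F.transport (z, 1) d) =
      c.val d + residue k z := by
    intro z
    rw [F.transport_one, c.val_walk]; simp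
  have hdown : ∀ z, residue k (-1 : Eisensteinˣ) * c.val (F.transport (z, -1) d) =
      c.val d + residue k z := by
    intro z
    rw [F.transport_neg_one, c.val_flip, c.val_walk]; simp; ring
  have hstep : ∀ x : PlaneDart, residue k x.2 * c.val (F.transport x d) = c.val d + residue k x.1 →
      residue k x.next.2 * c.val (F.transport x.next d) = c.val d + residue k x.next.1 := by
    intro x h
    have h1 := c.val_next (F.transport x d)
    rw [F.transport_next]
    simp only [PlaneDart.next, Units.val_mul, Units.val_pow_eq_pow_val, map_mul, map_pow, map_add]
    linear_combination h + residue k x.2 * h1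
  have hsteps : ∀ (i : ℕ) (x : PlaneDart),
      residue k x.2 * c.val (F.transport x d) = c.val d + residue k x.1 →
      residue k (PlaneDart.next^[i] x).2 * c.val (F.transport (PlaneDart.next^[i] x) d) =
        c.val d + residue k (PlaneDart.next^[i] x).1 := by
    intro i x h
    induction i with
    | zero => exact h
    | succ i ih => rw [Function.iterate_succ_apply']; exact hstep _ ih
  obtain ⟨i, hi, h⟩ := x.exists_iterate_next_dir
  rw [← x.iterate_next_inverse hi]
  apply hsteps
  generalize PlaneDart.next^[i] x = y at h ⊢
  obtain ⟨z, u⟩ := y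
  dsimp at h
  rcases h with rfl | rfl
  · exact hup z
  · exact hdown z

end LatticeLabelling

namespace LatticeLabelling

open Fullerene PlaneDart

variable {D : Type u} {F : Fullerene D} {k : ℕ} (c : LatticeLabelling F k)

theorem residue_ne_zero {z : Eisenstein} (h0 : 0 < z.re) (h1 : z.re < k) : residue k z ≠ 0 := by
  rw [Ne, residue_eq_zero_iff, natCast_dvd_iff]
  rintro ⟨h, -⟩
  exact absurd (Int.le_of_dvd h0 h) (by lia)

variable {c}

/-- A walk goes straight first and shifts left afterwards, so an additional straight step has to be
commuted past all shifts. The heads at which this happens have first coordinate `z.re + 1`, strictly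
between `0` and `k`, and are hexagons. -/
theorem walk_add_one {e : D} (he : c.val e = 0) {z : Eisenstein} (h1 : 0 ≤ z.re) (h2 : 0 ≤ z.im)
    (h3 : z.re + 1 < k) : F.walk (z + 1) e = F.straight (F.walk z e) := by
  obtain ⟨a, b⟩ := z
  dsimp at h1 h2 h3
  lift b to ℕ using h2
  induction b with
  | zero =>
    simp only [walk, QuadraticAlgebra.im_add, QuadraticAlgebra.re_add, im_one, re_one, add_zero,
      Nat.cast_zero, zpow_zero, one_mul]
    rw [add_comm, zpow_one_add]; rfl
  | succ b ih =>
    have e1 : (⟨a, ((b + 1 : ℕ) : ℤ)⟩ : Eisenstein) = ⟨a, b⟩ + omega := by ext <;> simp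
    rw [e1, add_right_comm, F.walk_add_omega, F.walk_add_omega, ih, straight_shiftLeft]
    apply c.ring_pow_six_flip
    rw [c.val_walk, he, zero_add, ← map_one (residue k), ← map_add]
    exact residue_ne_zero (by simp; lia) (by simp; lia)

/-- Sides parallel to `ω` are the ones not built into `transport`: they separate two columns of
walks. With `z = y + 1 + omega`, the crossing is possible because of the hexagon at `y + 1`. -/
theorem transport_flip_neg_omega {e : D} (he : c.val e = 0) {z : Eisenstein}
    (h : InPatch k (z, -omega)) (h' : InPatch k (flip (z, -omega))) :
    F.transport (flip (z, -omega)) e = F.flip (F.transport (z, -omega) e) := by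
  rw [flip_mk, neg_neg] at *
  rw [transport_omega, transport_neg_omega]
  simp [InPatch, centre] at h h'
  obtain ⟨y, rfl⟩ : ∃ y, z = y + 1 + omega := ⟨z - 1 - omega, by ring⟩
  simp at h h'
  have e1 : y + 1 + (omega : Eisenstein) + ((-omega : Eisensteinˣ) : Eisenstein) + omega - 1 =
      y + omega := by simp; ring
  rw [e1, add_sub_cancel_right, walk_add_one he (by lia) (by lia) (by lia), F.walk_add_omega,
    next_next_straight]
  apply c.ring_pow_six_flip
  rw [c.val_walk, he, zero_add, ← map_one (residue k), ← map_add]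
  exact residue_ne_zero (by simp; lia) (by simp; lia)

/-- Inside the triangle with corners `0, k, k ω` the unfolding respects the reversal of darts. -/
theorem transport_flip {e : D} (he : c.val e = 0) {x : PlaneDart}
    (h : InPatch k x) (h' : InPatch k x.flip) :
    F.transport x.flip e = F.flip (F.transport x e) := by
  have hsq : ∀ z, F.transport (flip (z, omega ^ 2)) e = F.flip (F.transport (z, omega ^ 2) e) := by
    intro z
    rw [flip_mk, transport_neg_omega_sq, transport_omega_sq, ← next_flip_shiftLeft,
      ← F.walk_add_omega, Units.val_pow_eq_pow_val, omega_sq]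
    congr 4; ring
  have hone : ∀ z, F.transport (flip (z, 1)) e = F.flip (F.transport (z, 1) e) := by
    intro z
    rw [flip_mk, transport_neg_one, transport_one]
    simp
  have hsymm : ∀ x : PlaneDart,
      F.transport x.flip.flip e = F.flip (F.transport x.flip e) →
        F.transport x.flip e = F.flip (F.transport x e) := by
    intro x h
    rw [PlaneDart.flip_flip] at h
    rw [h, F.flip_flip]
  obtain ⟨z, u⟩ := x
  rcases unit_cases u with rfl | rfl | rfl | rfl | rfl | rfl
  · exact hone z
  · apply hsymm
    apply transport_flip_neg_omega he h'
    rwa [← flip_mk, PlaneDart.flip_flip]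
  · exact hsq z
  · apply hsymm
    rw [flip_mk z, neg_neg]
    exact hone _
  · exact transport_flip_neg_omega he h h'
  · apply hsymm
    rw [flip_mk z, neg_neg]
    exact hsq _

/-- At a hexagon, going straight after a reversal retraces the last step; the hypothesis provides
hexagons at the heads of the first `j` edges. -/
theorem straight_pow_flip_straight_pow (j : ℕ) {d : D}
    (hd : ∀ i < j, c.val d + (i : Residue k) + 1 ≠ 0) :
    (F.straight ^ j) (F.flip ((F.straight ^ j) d)) = F.flip d := by
  induction j with
  | zero => simp
  | succ j ih =>
    rw [pow_succ, Equiv.Perm.mul_apply, ← pow_succ, pow_succ' _ j, Equiv.Perm.mul_apply,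
      straight_flip_straight, ih fun i hi => hd i (by lia)]
    apply c.ring_pow_six_flip
    have := c.val_straight_zpow j d
    rw [zpow_natCast, Int.cast_natCast] at this
    rw [this]
    exact hd j (by lia)

theorem natCast_residue_ne_zero {i : ℕ} (h0 : 0 < i) (h1 : i < k) : (i : Residue k) ≠ 0 := by
  have := residue_ne_zero (k := k) (z := (i : Eisenstein)) (by simpa) (by simpa)
  simpa using this

theorem natCast_residue_self : ((k : ℕ) : Residue k) = 0 := by
  have := (residue_eq_zero_iff (k := k) (z := (k : Eisenstein))).2 dvd_rfl
  simpa using this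

/-- The last step of the straight path of length `k`, in the opposite direction. -/
theorem straight_pow_flip {e : D} (he : c.val e = 0) {j : ℕ} (hj : j < k) :
    (F.straight ^ (k - 1 - j)) (F.flip ((F.straight ^ (k - 1)) e)) =
      F.flip ((F.straight ^ j) e) := by
  have h := straight_pow_flip_straight_pow (c := c) (k - 1 - j) (d := (F.straight ^ j) e) (by
    intro i hi
    have := c.val_straight_zpow j e
    rw [zpow_natCast, Int.cast_natCast] at this
    rw [this, he, zero_add, ← Nat.cast_add, ← Nat.cast_succ]
    exact natCast_residue_ne_zero (by lia) (by lia))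
  rw [← Equiv.Perm.mul_apply (F.straight ^ (k - 1 - j)) (F.straight ^ j), ← pow_add,
    show k - 1 - j + j = k - 1 by lia] at h
  exact h

variable (c)

/-- The darts that start at a point of the sublattice. -/
abbrev Dart : Type u := {d : D // c.val d = 0}

variable (hk : 0 < k)

/-- After `k - 1` straight steps the dart is the `k`-th edge of the path; its reversal starts at
distance `k` and has label `-k = 0`. -/
theorem val_far {e : D} (he : c.val e = 0) (hk : 0 < k) :
    c.val (F.flip ((F.straight ^ (k - 1)) e)) = 0 := by
  have := c.val_straight_zpow (k - 1 : ℕ) e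
  rw [zpow_natCast, Int.cast_natCast] at this
  rw [c.val_flip, this, he, zero_add, ← Nat.cast_succ, Nat.succ_eq_add_one, Nat.sub_add_cancel hk,
    natCast_residue_self, neg_zero]

/-- The reversal of the edges of length `k`. -/
def bigFlip : Equiv.Perm c.Dart :=
  Function.Involutive.toPerm
    (fun e => ⟨F.flip ((F.straight ^ (k - 1)) e.1), c.val_far e.2 hk⟩) (by
      intro e
      ext1
      have := straight_pow_flip e.2 hk
      rw [Nat.sub_zero, pow_zero] at this
      change F.flip ((F.straight ^ (k - 1)) (F.flip ((F.straight ^ (k - 1)) e.1))) = _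
      rw [this]
      exact F.flip_flip _)

theorem bigFlip_val (e : c.Dart) :
    (c.bigFlip hk e).1 = F.flip ((F.straight ^ (k - 1)) e.1) := rfl

theorem val_ring_eq_zero_iff (d : D) : c.val (F.ring d) = 0 ↔ c.val d = 0 := by
  rw [← c.val_ring d]
  constructor
  · intro h; rw [h, mul_zero]
  · intro h
    have hw := residue_omega_sq (k := k)
    linear_combination (1 - residue k omega) * h + c.val (F.ring d) * hw

/-- The rotation around the points of the sublattice. -/
def bigRing : Equiv.Perm c.Dart := F.ring.subtypePerm fun d => c.val_ring_eq_zero_iff d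

theorem bigRing_val (e : c.Dart) : (c.bigRing e).1 = F.ring e.1 := rfl

theorem bigRing_inv_val (e : c.Dart) : (c.bigRing⁻¹ e).1 = F.ring⁻¹ e.1 := by
  rw [Equiv.Perm.eq_inv_iff_eq, ← c.bigRing_val]; simp

/-- The following edge of a triangle of side `k`. -/
def bigNext : Equiv.Perm c.Dart := c.bigRing⁻¹ * c.bigFlip hk

theorem bigNext_val (e : c.Dart) :
    (c.bigNext hk e).1 = F.dual.next ((F.straight ^ (k - 1)) e.1) := by
  rw [bigNext, Equiv.Perm.mul_apply, bigRing_inv_val, bigFlip_val, F.dual_next_apply]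

/-- The patch of the next side is the same patch, turned by a third. Both unfoldings respect `next`
and `flip` inside the patch, so agreement at the base dart spreads by `patch_induction`. -/
theorem transport_bigNext (e : c.Dart) {x : PlaneDart} (hx : InPatch k x) :
    F.transport x (c.bigNext hk e).1 = F.transport (comp (turn k) x) e.1 := by
  refine patch_induction (k := k) (fun x => F.transport x (c.bigNext hk e).1 =
    F.transport (comp (turn k) x) e.1) ?_ ?_ ?_ hx
  · intro x hx h
    rw [transport_next, comp_next, transport_next, h]
  · intro x hx hf h
    rw [transport_flip (c.bigNext hk e).2 hx hf, h, comp_flip,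
      transport_flip e.2 (inPatch_turn.2 hx)]
    rw [← comp_flip]; exact inPatch_turn.2 hf
  · rw [transport_base, comp_base, turn, transport_omega_sq, bigNext_val, walk]
    congr 2
    simp [show ((k : ℤ) - 1) = ((k - 1 : ℕ) : ℤ) by lia]

theorem transport_bigNext_iterate (e : c.Dart) {x : PlaneDart} (hx : InPatch k x) (i : ℕ) :
    F.transport x ((c.bigNext hk)^[i] e).1 = F.transport ((comp (turn k))^[i] x) e.1 := by
  induction i generalizing x with
  | zero => rfl
  | succ i ih =>
    rw [Function.iterate_succ_apply', transport_bigNext _ _ _ hx, ih (inPatch_turn.2 hx),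
      Function.iterate_succ_apply]

/-- Three turns of the patch are the identity. -/
theorem bigNext_iterate_three (e : c.Dart) :
    c.bigNext hk (c.bigNext hk (c.bigNext hk e)) = e := by
  have h := c.transport_bigNext_iterate hk e (base_inPatch hk) 3
  rw [transport_base] at h
  ext1
  change ((c.bigNext hk)^[3] e).1 = _
  rw [h]
  change F.transport (comp (turn k) (comp (turn k) (comp (turn k) base))) _ = _
  rw [turn_turn_turn, transport_base]

/-- Across the side from `0` to `k` of the triangle with corners `0, k, k ω` the unfolding is
continued by that of the neighbouring triangle. -/
theorem transport_bigFlip (e : c.Dart) {x x' : PlaneDart} (hx : InPatch k x) (hx' : InPatch k x')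
    (h : x.flip = comp (halfTurn k) x') :
    F.transport x' (c.bigFlip hk e).1 = F.flip (F.transport x e.1) := by
  obtain ⟨z, v⟩ := x'
  obtain ⟨y, u⟩ := x
  have h1 : y + u = k - z := (congrArg Prod.fst h).trans (by simp [comp, halfTurn]; ring)
  have h2 : u = v := by
    have := congrArg Prod.snd h
    simpa [comp, halfTurn, flip_mk] using this
  subst h2
  obtain ⟨a, b⟩ := y
  obtain ⟨a', b'⟩ := z
  have h3 := congrArg QuadraticAlgebra.re h1
  have h4 := congrArg QuadraticAlgebra.im h1
  simp at h3 h4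
  rcases unit_cases u with rfl | rfl | rfl | rfl | rfl | rfl <;>
    simp [InPatch, centre] at hx hx' h3 h4
  · obtain rfl : b = 0 := by lia
    obtain rfl : b' = 0 := by lia
    rw [transport_one, transport_one, bigFlip_val]
    simp only [walk, zpow_zero, one_mul]
    have ha : 0 ≤ a := by lia
    lift a to ℕ using ha
    have := straight_pow_flip e.2 (show a < k by lia)
    rw [zpow_natCast, ← this, show a' = ((k - 1 - a : ℕ) : ℤ) by lia, zpow_natCast]
  -- Only a dart of direction `1` on the side itself has its own triangle above the line through `0`
  -- and `k` and that of its reversal below.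
  all_goals exfalso; lia

/-- `transport x` is a permutation, so a preimage exists in any case; the congruence says exactly
that its label is `0`. -/
theorem exists_transport_eq (x : PlaneDart) (d : D)
    (h : residue k x.2 * c.val d = residue k x.1) :
    ∃ e : c.Dart, F.transport x e.1 = d := by
  obtain ⟨e, rfl⟩ := (F.transport x).surjective d
  refine ⟨⟨e, ?_⟩, rfl⟩
  rw [c.val_transport] at h
  simpa using h

theorem exists_inPatch (hk : 0 < k) (d : D) :
    ∃ x, InPatch k x ∧ ∃ e : c.Dart, F.transport x e.1 = d := by
  obtain ⟨z, hz⟩ := Ideal.Quotient.mk_surjective (c.val d)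
  have hk' : (0 : ℤ) < k := by exact_mod_cast hk
  set a := z.re % k
  set b := z.im % k
  have ha := Int.emod_nonneg z.re hk'.ne'
  have hb := Int.emod_nonneg z.im hk'.ne'
  have ha' := Int.emod_lt_of_pos z.re hk'
  have hb' := Int.emod_lt_of_pos z.im hk'
  have hab : residue k ⟨a, b⟩ = c.val d := by
    rw [← hz]
    refine residue_eq_iff.2 (natCast_dvd_iff.2 ⟨?_, ?_⟩)
    · exact ⟨-(z.re / k), by have := Int.emod_add_mul_ediv z.re k; simp; lia⟩
    · exact ⟨-(z.im / k), by have := Int.emod_add_mul_ediv z.im k; simp; lia⟩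
  -- The fundamental parallelogram consists of the patch and its image under a half turn; in the
  -- second half the position is read off with direction `-1`.
  by_cases h : a + b < k
  · refine ⟨(⟨a, b⟩, 1), inPatch_up.2 ⟨ha, hb, h⟩, c.exists_transport_eq _ _ ?_⟩
    simp [hab]
  · refine ⟨(⟨k - a, k - b⟩, -1), inPatch_down.2 ⟨?_, ?_, ?_⟩, c.exists_transport_eq _ _ ?_⟩
    · change 1 ≤ (k : ℤ) - a; lia
    · change 1 ≤ (k : ℤ) - b; lia
    · change (k : ℤ) - a + (k - b) ≤ k; lia
    · rw [← hab, ← map_mul, residue_eq_iff, natCast_dvd_iff]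
      exact ⟨⟨-1, by simp; ring⟩, ⟨-1, by simp; ring⟩⟩

end LatticeLabelling

/-! ### Counting cycles -/

section Cycles

variable {D : Type*} [Finite D] (π : Equiv.Perm D)

theorem card_sameCycle (d : D) : Nat.card {x // π.SameCycle d x} = Function.minimalPeriod π d := by
  classical
  have := Fintype.ofFinite D
  have h := MulAction.minimalPeriod_eq_card (a := π) (b := d)
  rw [← Nat.card_eq_fintype_card] at h
  refine Eq.trans ?_ h.symm
  refine Nat.card_congr (Equiv.subtypeEquivRight fun x => ?_)
  constructor
  · rintro ⟨i, rfl⟩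
    exact ⟨⟨π ^ i, i, rfl⟩, rfl⟩
  · rintro ⟨⟨_, i, rfl⟩, rfl⟩
    exact ⟨i, rfl⟩

/-- A cycle of length `n` consists of `n` elements, each contributing `1 / n`. -/
theorem numCycles_eq_sum [Fintype D] :
    (numCycles π : ℚ) = ∑ d, (1 : ℚ) / Function.minimalPeriod π d := by
  classical
  have : Fintype (Quotient (Equiv.Perm.SameCycle.setoid π)) := Fintype.ofFinite _
  rw [numCycles, Nat.card_eq_fintype_card, ← Finset.card_univ, Finset.card_eq_sum_ones,
    Nat.cast_sum, ← Finset.sum_fiberwise (s := Finset.univ)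
      (g := fun d => Quotient.mk (Equiv.Perm.SameCycle.setoid π) d)]
  refine Finset.sum_congr rfl fun q _ => ?_
  obtain ⟨b, rfl⟩ := Quotient.exists_rep q
  have hcard : ∀ d, π.SameCycle b d → Function.minimalPeriod π d = Function.minimalPeriod π b := by
    intro d hd
    rw [← card_sameCycle, ← card_sameCycle]
    exact Nat.card_congr (Equiv.subtypeEquivRight fun x => ⟨hd.trans, hd.symm.trans⟩)
  have hmem : ∀ d, (Quotient.mk (Equiv.Perm.SameCycle.setoid π) d =
      Quotient.mk (Equiv.Perm.SameCycle.setoid π) b) ↔ π.SameCycle b d := by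
    intro d
    rw [Quotient.eq]
    exact ⟨Equiv.Perm.SameCycle.symm, Equiv.Perm.SameCycle.symm⟩
  have hpos : 0 < Function.minimalPeriod π b := by
    rw [← card_sameCycle]
    have : Nonempty {x // π.SameCycle b x} := ⟨⟨b, Equiv.Perm.SameCycle.refl _ _⟩⟩
    exact Nat.card_pos
  rw [Finset.sum_congr rfl (g := fun _ => (1 : ℚ) / Function.minimalPeriod π b)
    (fun d hd => by rw [hcard d ((hmem d).1 (Finset.mem_filter.1 hd).2)])]
  rw [Finset.sum_const, nsmul_eq_mul]
  have : (Finset.univ.filter fun d => Quotient.mk (Equiv.Perm.SameCycle.setoid π) d =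
      Quotient.mk (Equiv.Perm.SameCycle.setoid π) b).card = Function.minimalPeriod π b := by
    rw [← card_sameCycle, Nat.card_eq_fintype_card, Fintype.card_subtype]
    simp only [hmem]
  rw [this]
  have : (Function.minimalPeriod π b : ℚ) ≠ 0 := by exact_mod_cast hpos.ne'
  field_simp
  simp

/-- The Euler characteristic of a cubic map whose faces are pentagons and hexagons. -/
theorem euler_eq {rot flip : Equiv.Perm D} (hrot : ∀ d, rot (rot (rot d)) = d)
    (hrot' : ∀ d, rot d ≠ d) (hflip : ∀ d, flip (flip d) = d) (hflip' : ∀ d, flip d ≠ d)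
    (hring : ∀ d, Function.minimalPeriod (rot⁻¹ * flip) d = 5 ∨
      Function.minimalPeriod (rot⁻¹ * flip) d = 6) :
    ((numCycles rot : ℚ) - numCycles flip + numCycles (rot⁻¹ * flip)) =
      Nat.card {d // Function.minimalPeriod (rot⁻¹ * flip) d = 5} / 30 := by
  classical
  have := Fintype.ofFinite D
  rw [numCycles_eq_sum, numCycles_eq_sum, numCycles_eq_sum, ← Finset.sum_sub_distrib,
    ← Finset.sum_add_distrib, Nat.card_eq_fintype_card, Fintype.card_subtype,
    Finset.card_filter, Nat.cast_sum, Finset.sum_div]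
  refine Finset.sum_congr rfl fun d _ => ?_
  have : Fact (Nat.Prime 3) := ⟨Nat.prime_three⟩
  have h3 : Function.minimalPeriod rot d = 3 :=
    Function.minimalPeriod_eq_prime_iff.2 ⟨hrot d, hrot' d⟩
  have h2 : Function.minimalPeriod flip d = 2 :=
    Function.minimalPeriod_eq_prime_iff.2 ⟨hflip d, hflip' d⟩
  rw [h3, h2]
  -- `1/3 - 1/2 + 1/5 = 1/30` at a pentagon, `1/3 - 1/2 + 1/6 = 0` at a hexagon.
  rcases hring d with h | h <;> rw [h] <;> norm_num

end Cycles

theorem Fullerene.ring_pow_ne {D : Type*} (F : Fullerene D) {i : ℕ} (h0 : 0 < i) (h4 : i < 5)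
    (d : D) : (F.ring ^ i) d ≠ d := by
  intro h
  have h' : Function.IsPeriodicPt F.ring i d := by
    rw [Equiv.Perm.coe_pow] at h; exact h
  have := Nat.le_of_dvd h0 h'.minimalPeriod_dvd
  have h5 := F.ring_size d
  change Function.minimalPeriod F.ring d = 5 ∨ Function.minimalPeriod F.ring d = 6 at h5
  lia

/-! ### The archetype as a cubic map on the sphere -/

namespace PlaneDart

theorem iterate_turn_snd (k : ℕ) (x : PlaneDart) (i : ℕ) :
    ((comp (turn k))^[i] x).2 = (next^[i] x).2 := by
  induction i with
  | zero => rfl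
  | succ i ih =>
    rw [Function.iterate_succ_apply', Function.iterate_succ_apply']
    change omega ^ 2 * _ = omega ^ 2 * _
    rw [ih]

theorem iterate_turn_inverse (k : ℕ) (x : PlaneDart) {i : ℕ} (hi : i < 3) :
    (comp (turn k))^[3 - i] ((comp (turn k))^[i] x) = x := by
  rw [← Function.iterate_add_apply, Nat.sub_add_cancel hi.le]
  exact turn_turn_turn k x

theorem iterate_turn_mod (k : ℕ) (x : PlaneDart) (i : ℕ) :
    (comp (turn k))^[i % 3] x = (comp (turn k))^[i] x := by
  have h3 : (comp (turn k))^[3] = id := funext fun x => turn_turn_turn k x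
  conv_rhs => rw [← Nat.mod_add_div i 3, Function.iterate_add_apply, Function.iterate_mul, h3,
    Function.iterate_id]
  rfl

theorem iterate_turn_flip (k : ℕ) (x : PlaneDart) (i : ℕ) :
    ((comp (turn k))^[i] x).flip = (comp (turn k))^[i] x.flip := by
  induction i with
  | zero => rfl
  | succ i ih => rw [Function.iterate_succ_apply', Function.iterate_succ_apply', ← ih, comp_flip]

/-- The reversal of a dart leads out of the triangle with corners `0, k, k ω` only across one of
its sides. -/
theorem exists_halfTurn {k : ℕ} {x : PlaneDart} (hx : InPatch k x) (hf : ¬InPatch k x.flip) :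
    ∃ i < 3, ∃ x', InPatch k x' ∧ ((comp (turn k))^[i] x).flip = comp (halfTurn k) x' := by
  obtain ⟨i, hi, h⟩ := exists_iterate_next_dir x
  rw [← iterate_turn_snd k] at h
  refine ⟨i, hi, ?_⟩
  rw [← inPatch_iterate_turn i] at hx
  rw [← inPatch_iterate_turn i, ← iterate_turn_flip] at hf
  generalize (comp (turn k))^[i] x = y at h hx hf
  obtain ⟨z, u⟩ := y
  dsimp at h
  rcases h with rfl | rfl
  · rw [inPatch_up] at hx
    have hf' : ¬InPatch k (z + 1, -1) := hf
    rw [inPatch_down] at hf'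
    simp at hf'
    refine ⟨(k - 1 - z, 1), inPatch_up.2 ?_, ?_⟩
    · simp; lia
    · simp only [flip_mk, comp, halfTurn]; simp; ring
  · exfalso
    rw [inPatch_down] at hx
    apply hf
    have : flip (z, -1) = (z - 1, 1) := by rw [flip_mk]; simp; ring
    rw [this]
    exact inPatch_up.2 (by simp; lia)

end PlaneDart

namespace LatticeLabelling

open Fullerene PlaneDart

variable {D : Type u} {F : Fullerene D} {k : ℕ} (c : LatticeLabelling F k) (hk : 0 < k)

theorem iterate_bigNext_mod (e : c.Dart) (i : ℕ) :
    (c.bigNext hk)^[i % 3] e = (c.bigNext hk)^[i] e := by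
  have h3 : (c.bigNext hk)^[3] = id := funext fun x => c.bigNext_iterate_three hk x
  conv_rhs => rw [← Nat.mod_add_div i 3, Function.iterate_add_apply, Function.iterate_mul, h3,
    Function.iterate_id]
  rfl

theorem eq_of_dvd_sub {k a b : ℤ} (h : k ∣ a - b) (h1 : a - b < k) (h2 : b - a < k) : a = b :=
  sub_eq_zero.1 (Int.eq_zero_of_abs_lt_dvd h (abs_lt.2 ⟨by lia, h1⟩))

/-- The label of the common image fixes the positions modulo `k`. For a given direction `±1` the
patch has at most one position in each residue class, and opposite directions would require `z + z'
≡ 0`, which the patch excludes. -/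
theorem eq_of_transport_eq {e e' : c.Dart} {x x' : PlaneDart} (hx : InPatch k x)
    (hx' : InPatch k x') (hd : x.2 = 1 ∨ x.2 = -1) (hd' : x'.2 = 1 ∨ x'.2 = -1)
    (h : F.transport x e.1 = F.transport x' e'.1) : x = x' := by
  have h1 := c.val_transport x e
  have h2 := c.val_transport x' e'
  rw [← h, e'.2, zero_add] at h2
  rw [e.2, zero_add] at h1
  obtain ⟨z, u⟩ := x
  obtain ⟨z', u'⟩ := x'
  dsimp at hd hd' h1 h2
  rcases hd with rfl | rfl <;> rcases hd' with rfl | rfl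
  · rw [h1] at h2
    obtain ⟨h3, h4⟩ := natCast_dvd_iff.1 (residue_eq_iff.1 h2)
    rw [inPatch_up] at hx hx'
    congr 1
    exact QuadraticAlgebra.ext (eq_of_dvd_sub h3 (by lia) (by lia))
      (eq_of_dvd_sub h4 (by lia) (by lia))
  · exfalso
    have h5 : residue k (z + z') = residue k k := by
      rw [map_add, ← h1, ← h2, residue_eq_zero_iff.2 dvd_rfl]; simp
    obtain ⟨h3, h4⟩ := natCast_dvd_iff.1 (residue_eq_iff.1 h5)
    rw [inPatch_up] at hx
    rw [inPatch_down] at hx'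
    have h6 : z.re + z'.re = (k : ℤ) :=
      eq_of_dvd_sub (k := (k : ℤ)) (by simp at h3 ⊢; exact h3) (by lia) (by lia)
    have h7 : z.im + z'.im = 0 :=
      eq_of_dvd_sub (k := (k : ℤ)) (by simp at h4 ⊢; exact h4) (by lia) (by lia)
    lia
  · exfalso
    have h5 : residue k (z + z') = residue k k := by
      rw [map_add, ← h1, ← h2, residue_eq_zero_iff.2 dvd_rfl]; simp
    obtain ⟨h3, h4⟩ := natCast_dvd_iff.1 (residue_eq_iff.1 h5)
    rw [inPatch_down] at hx
    rw [inPatch_up] at hx'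
    have h6 : z.re + z'.re = (k : ℤ) :=
      eq_of_dvd_sub (k := (k : ℤ)) (by simp at h3 ⊢; exact h3) (by lia) (by lia)
    have h7 : z.im + z'.im = 0 :=
      eq_of_dvd_sub (k := (k : ℤ)) (by simp at h4 ⊢; exact h4) (by lia) (by lia)
    lia
  · rw [h1] at h2
    obtain ⟨h3, h4⟩ := natCast_dvd_iff.1 (residue_eq_iff.1 h2)
    rw [inPatch_down] at hx hx'
    congr 1
    exact QuadraticAlgebra.ext (eq_of_dvd_sub h3 (by lia) (by lia))
      (eq_of_dvd_sub h4 (by lia) (by lia))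

/-- The triangles of side `k` at the points of the sublattice do not overlap. -/
theorem exists_iterate_of_transport_eq {e e' : c.Dart} {x x' : PlaneDart} (hx : InPatch k x)
    (hx' : InPatch k x') (h : F.transport x e.1 = F.transport x' e'.1) :
    ∃ i < 3, e' = (c.bigNext hk)^[i] e ∧ x = (comp (turn k))^[i] x' := by
  -- Turning the patches brings both darts to direction `±1`, where the label determines the
  -- position.
  obtain ⟨j, hj, hd⟩ := exists_iterate_next_dir x
  obtain ⟨j', hj', hd'⟩ := exists_iterate_next_dir x'
  rw [← iterate_turn_snd k] at hd hd'
  have hy := (inPatch_iterate_turn j).2 hx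
  have hy' := (inPatch_iterate_turn j').2 hx'
  have h1 := c.transport_bigNext_iterate hk e hy (3 - j)
  have h2 := c.transport_bigNext_iterate hk e' hy' (3 - j')
  rw [iterate_turn_inverse k x hj] at h1
  rw [iterate_turn_inverse k x' hj', ← h, ← h1] at h2
  have h3 := c.eq_of_transport_eq hy' hy hd' hd h2
  rw [h3] at h2
  have h4 : (c.bigNext hk)^[3 - j'] e' = (c.bigNext hk)^[3 - j] e :=
    Subtype.ext ((F.transport _).injective h2)
  refine ⟨(j' + (3 - j)) % 3, Nat.mod_lt _ (by lia), ?_, ?_⟩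
  · rw [iterate_bigNext_mod, Function.iterate_add_apply, ← h4, ← Function.iterate_add_apply,
      Nat.add_sub_cancel' hj'.le]
    exact (c.bigNext_iterate_three hk e').symm
  · rw [iterate_turn_mod, add_comm, Function.iterate_add_apply, h3, iterate_turn_inverse k x hj]

theorem bigFlip_bigFlip (e : c.Dart) : c.bigFlip hk (c.bigFlip hk e) = e :=
  Function.Involutive.toPerm_involutive _ e

/-- A straight path that equals its own reversal is symmetric about its middle. For odd `k` the
middle edge would be fixed by `flip`; for even `k` three turns about the middle vertex would fix a
dart, whereas its ring has at least five sides. -/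
theorem bigFlip_ne (e : c.Dart) : c.bigFlip hk e ≠ e := by
  intro h
  have h0 : F.flip ((F.straight ^ (k - 1)) e.1) = e.1 := congrArg Subtype.val h
  obtain ⟨j, hj | hj⟩ := Nat.even_or_odd' k
  · have h1 := straight_pow_flip e.2 (show j - 1 < k by lia)
    rw [h0, show k - 1 - (j - 1) = (j - 1) + 1 by lia, pow_succ', Equiv.Perm.mul_apply,
      straight_apply] at h1
    exact F.ring_pow_ne (i := 3) (by lia) (by lia) _ h1
  · have h1 := straight_pow_flip e.2 (show j < k by lia)
    rw [h0, show k - 1 - j = j by lia] at h1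
    exact F.flip_ne _ h1.symm

/-- Otherwise turning the patch by a third would not change its image, and something happens at the
centre of the patch. If `3 ∣ k`, this is a lattice point, about which two turns would fix a dart;
otherwise it is the centre of a small triangle, whose dart would be fixed by `next`. -/
theorem bigNext_ne (e : c.Dart) : c.bigNext hk e ≠ e := by
  intro h
  have h0 : ∀ x, InPatch k x → F.transport x e.1 = F.transport (comp (turn k) x) e.1 := by
    intro x hx
    rw [← c.transport_bigNext hk e hx, h]
  have hnext : ∀ x, InPatch k x → comp (turn k) x ≠ x.next := by
    intro x hx h1
    have h2 := h0 x hx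
    rw [h1, transport_next] at h2
    exact F.dual.next_ne _ h2.symm
  obtain ⟨j, hj⟩ : ∃ j, k = 3 * j + k % 3 := ⟨k / 3, by lia⟩
  have hlt := Nat.mod_lt k (show 0 < 3 by lia)
  generalize k % 3 = i at hj hlt
  interval_cases i
  · set z : Eisenstein := ⟨j, j⟩ with hz
    have hx : InPatch k (z, 1) := inPatch_up.2 (by simp [hz]; lia)
    have e0 : comp (turn k) (z, 1) = (z, omega ^ 2) := by
      ext1
      · ext <;> simp [comp, turn, hz] <;> lia
      · simp [comp, turn]
    have e1 : (z, omega) = PlaneDart.flip (PlaneDart.next (PlaneDart.next (z, 1))) := by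
      ext1
      · ext <;> simp [PlaneDart.flip, PlaneDart.next, hz]
      · simp only [PlaneDart.next, PlaneDart.flip, mul_one, omega_sq_mul_omega_sq, neg_neg]
    have e2 : (z, omega ^ 2) = PlaneDart.flip (PlaneDart.next (PlaneDart.next (z, omega))) := by
      ext1
      · ext <;> simp [PlaneDart.flip, PlaneDart.next, hz]
      · simp only [PlaneDart.next, PlaneDart.flip, omega_sq_mul_omega, mul_neg, mul_one, neg_neg]
    have hx1 : InPatch k (z, omega) := by simp [InPatch, centre, hz]; lia
    have hx2 : InPatch k (z, omega ^ 2) := by simp [InPatch, centre, hz]; lia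
    have h2 := h0 _ hx
    rw [e0, e2, transport_flip e.2 (by rwa [inPatch_next, inPatch_next]) (by rwa [← e2]),
      transport_next, transport_next, next_next, F.flip_flip, e1,
      transport_flip e.2 (by rwa [inPatch_next, inPatch_next]) (by rwa [← e1]),
      transport_next, transport_next, next_next, F.flip_flip] at h2
    exact F.ring_pow_ne (i := 2) (by lia) (by lia) _ h2.symm
  · refine hnext (⟨j, j⟩, 1) (inPatch_up.2 (by simp; lia)) ?_
    ext1
    · ext <;> simp [comp, turn, next] <;> lia
    · simp [comp, turn, next]
  · refine hnext (⟨j + 1, j + 1⟩, -1) (inPatch_down.2 (by simp; lia)) ?_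
    ext1
    · ext <;> simp [comp, turn, next] <;> lia
    · simp [comp, turn, next]

theorem minimalPeriod_bigRing (e : c.Dart) :
    Function.minimalPeriod c.bigRing e = Function.minimalPeriod F.ring e.1 := by
  refine Function.minimalPeriod_eq_minimalPeriod_iff.2 fun n => ?_
  have h : ∀ n, (c.bigRing^[n] e).1 = F.ring^[n] e.1 := by
    intro n
    induction n with
    | zero => rfl
    | succ n ih =>
      rw [Function.iterate_succ_apply', Function.iterate_succ_apply', bigRing_val, ih]
  rw [Function.IsPeriodicPt, Function.IsPeriodicPt, Function.IsFixedPt, Function.IsFixedPt, ← h,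
    Subtype.ext_iff]

theorem val_eq_zero_of_onPentagon {d : D} (h : F.OnPentagon d) : c.val d = 0 := by
  apply c.val_eq_zero_of_ring_pow_five
  have h' := Function.isPeriodicPt_minimalPeriod F.ring d
  rw [Fullerene.OnPentagon] at h
  rw [h] at h'
  rw [Equiv.Perm.coe_pow]; exact h'

theorem bigRing_eq : (c.bigFlip hk * c.bigRing⁻¹)⁻¹ * c.bigFlip hk = c.bigRing := by
  group

/-- All darts at pentagons have label `0`, so none is lost. -/
theorem card_bigRing_pentagon :
    Nat.card {e // Function.minimalPeriod c.bigRing e = 5} =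
      Nat.card {d // Function.minimalPeriod F.ring d = 5} := by
  refine Nat.card_congr ⟨fun e => ⟨e.1.1, ?_⟩, fun d => ⟨⟨d.1, ?_⟩, ?_⟩, fun e => rfl, fun d => rfl⟩
  · rw [← c.minimalPeriod_bigRing]; exact e.2
  · exact c.val_eq_zero_of_onPentagon d.2
  · rw [c.minimalPeriod_bigRing]; exact d.2

theorem bigRot_bigRot_bigRot (e : c.Dart) :
    (c.bigFlip hk * c.bigRing⁻¹) ((c.bigFlip hk * c.bigRing⁻¹)
      ((c.bigFlip hk * c.bigRing⁻¹) e)) = e := by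
  have h := congrArg (c.bigFlip hk) (c.bigNext_iterate_three hk (c.bigFlip hk e))
  simp only [bigNext, Equiv.Perm.mul_apply, bigFlip_bigFlip] at h
  exact h

theorem bigRot_ne (e : c.Dart) : (c.bigFlip hk * c.bigRing⁻¹) e ≠ e := by
  intro h
  apply c.bigNext_ne hk (c.bigFlip hk e)
  have h1 := congrArg (c.bigFlip hk) h
  simp only [Equiv.Perm.mul_apply, bigFlip_bigFlip] at h1
  simp only [bigNext, Equiv.Perm.mul_apply, bigFlip_bigFlip]
  exact h1

theorem bigRing_size (e : c.Dart) :
    Function.minimalPeriod ((c.bigFlip hk * c.bigRing⁻¹)⁻¹ * c.bigFlip hk) e = 5 ∨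
      Function.minimalPeriod ((c.bigFlip hk * c.bigRing⁻¹)⁻¹ * c.bigFlip hk) e = 6 := by
  rw [bigRing_eq, minimalPeriod_bigRing]
  exact F.ring_size e.1

theorem big_connected : MulAction.IsPretransitive
    (Subgroup.closure {c.bigFlip hk * c.bigRing⁻¹, c.bigFlip hk}) c.Dart := by
  set H := Subgroup.closure {c.bigFlip hk * c.bigRing⁻¹, c.bigFlip hk}
  have hflip : c.bigFlip hk ∈ H := Subgroup.subset_closure (by simp)
  have hrot : c.bigFlip hk * c.bigRing⁻¹ ∈ H := Subgroup.subset_closure (by simp)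
  have hnext : c.bigNext hk ∈ H := by
    have : c.bigNext hk = (c.bigFlip hk)⁻¹ * (c.bigFlip hk * c.bigRing⁻¹) * c.bigFlip hk := by
      rw [bigNext]; group
    rw [this]
    exact H.mul_mem (H.mul_mem (H.inv_mem hflip) hrot) hflip
  refine ⟨fun e e' => ?_⟩
  -- The darts of `F` covered by patches in the orbit of `e`. This set is closed under the
  -- generators of the transitive group of `F`, so it is everything; the non-overlap of patches then
  -- brings `e'` into the orbit.
  let A : Set D := {d | ∃ h ∈ H, ∃ x, InPatch k x ∧ F.transport x (h e).1 = d}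
  have hiter : ∀ h ∈ H, ∀ i, ∃ h' ∈ H, h' e = (c.bigNext hk)^[i] (h e) := by
    intro h hh i
    refine ⟨c.bigNext hk ^ i * h, H.mul_mem (H.pow_mem hnext i) hh, ?_⟩
    rw [Equiv.Perm.mul_apply, Equiv.Perm.coe_pow]
  have hAn : ∀ d ∈ A, F.dual.next d ∈ A := by
    rintro _ ⟨h, hh, x, hx, rfl⟩
    exact ⟨h, hh, x.next, inPatch_next.2 hx, F.transport_next x _⟩
  have hAf : ∀ d ∈ A, F.flip d ∈ A := by
    rintro _ ⟨h, hh, x, hx, rfl⟩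
    by_cases hf : InPatch k x.flip
    · exact ⟨h, hh, x.flip, hf, transport_flip (h e).2 hx hf⟩
    -- The reversal leaves the patch. After turning the patch, it does so across the side from `0`
    -- to `k`, behind which lies the patch of `bigFlip`.
    · obtain ⟨i, hi, x', hx', he⟩ := exists_halfTurn hx hf
      obtain ⟨h', hh', h'e⟩ := hiter h hh (3 - i)
      refine ⟨c.bigFlip hk * h', H.mul_mem hflip hh', x', hx', ?_⟩
      rw [Equiv.Perm.mul_apply, c.transport_bigFlip hk _ ((inPatch_iterate_turn i).2 hx) hx' he,
        h'e, c.transport_bigNext_iterate hk _ ((inPatch_iterate_turn i).2 hx),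
        iterate_turn_inverse k x hi]
  have hAr : ∀ d ∈ A, F.rot d ∈ A := by
    intro d hd
    have : F.rot d = F.flip (F.dual.next (F.flip d)) := by
      have h : F.ring⁻¹ d = F.flip (F.rot d) := by
        rw [Equiv.Perm.inv_eq_iff_eq]
        simp [Fullerene.ring, F.flip_flip]
      rw [next_flip, h, F.flip_flip]
    rw [this]
    exact hAf _ (hAn _ (hAf _ hd))
  have hgrp : ∀ g ∈ Subgroup.closure {F.rot, F.flip}, ∀ d, g d ∈ A ↔ d ∈ A := by
    intro g hg
    induction hg using Subgroup.closure_induction with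
    | mem g hg =>
      rcases hg with rfl | rfl
      · exact fun d => ⟨fun h => F.rot_rot_rot d ▸ hAr _ (hAr _ h), hAr d⟩
      · exact fun d => ⟨fun h => F.flip_flip d ▸ hAf _ h, hAf d⟩
    | one => exact fun d => Iff.rfl
    | mul a b _ _ ha hb => exact fun d => (ha _).trans (hb _)
    | inv a _ ha =>
      intro d
      rw [← ha]; simp
  have hbase : InPatch k base := base_inPatch hk
  have he : e.1 ∈ A := ⟨1, H.one_mem, base, hbase, transport_base F _⟩
  obtain ⟨⟨g, hg⟩, hge⟩ := F.connected.exists_smul_eq e.1 e'.1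
  have hge : g e.1 = e'.1 := hge
  have he' := (hgrp g hg e.1).2 he
  rw [hge] at he'
  obtain ⟨h, hh, x, hx, hx'⟩ := he'
  rw [← F.transport_base e'.1] at hx'
  obtain ⟨i, -, h1, -⟩ := c.exists_iterate_of_transport_eq hk hx hbase hx'
  obtain ⟨h', hh', h2⟩ := hiter h hh i
  exact ⟨⟨h', hh'⟩, h2.trans h1.symm⟩

end LatticeLabelling

namespace LatticeLabelling

open PlaneDart

variable {D : Type u} {F : Fullerene D} {k : ℕ} (c : LatticeLabelling F k) (hk : 0 < k)

/-- The fullerene from which `F` arises by `k`-inflation. -/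
def archetype : Fullerene c.Dart where
  finite := by
    have := F.finite
    infer_instance
  rot := c.bigFlip hk * c.bigRing⁻¹
  flip := c.bigFlip hk
  flip_flip := c.bigFlip_bigFlip hk
  flip_ne := c.bigFlip_ne hk
  rot_rot_rot := c.bigRot_bigRot_bigRot hk
  rot_ne := c.bigRot_ne hk
  ring_size := c.bigRing_size hk
  connected := c.big_connected hk
  euler := by
    have := F.finite
    have h := euler_eq F.rot_rot_rot F.rot_ne F.flip_flip F.flip_ne F.ring_size
    have h' := euler_eq (c.bigRot_bigRot_bigRot hk) (c.bigRot_ne hk) (c.bigFlip_bigFlip hk)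
      (c.bigFlip_ne hk) (c.bigRing_size hk)
    rw [bigRing_eq, card_bigRing_pentagon] at h'
    rw [bigRing_eq]
    have h2 : ((numCycles F.rot : ℚ) - numCycles F.flip + numCycles (F.rot⁻¹ * F.flip)) = 2 := by
      exact_mod_cast F.euler
    have h3 := h'.trans (h.symm.trans h2)
    exact_mod_cast h3

theorem archetype_ring : (c.archetype hk).ring = c.bigRing := c.bigRing_eq hk

theorem archetype_dual_flip : (c.archetype hk).dual.flip = c.bigFlip hk := rfl

theorem archetype_dual_next : (c.archetype hk).dual.next = c.bigNext hk := by
  change (c.archetype hk).ring⁻¹ * _ = _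
  rw [archetype_ring]; rfl

theorem archetype_onPentagon {e : c.Dart} :
    (c.archetype hk).OnPentagon e ↔ F.OnPentagon e.1 := by
  rw [Fullerene.OnPentagon, Fullerene.OnPentagon, archetype_ring, minimalPeriod_bigRing]

end LatticeLabelling

/-! ### Cutting the fullerene into patches of side `k` -/

namespace PlaneDart

/-- The open triangle with corners `0, k, k ω`. -/
def patch (k : ℕ) : Set ℂ := {p | 0 < lx p ∧ 0 < ly p ∧ lx p + ly p < k}

/-- The closed triangle with corners `0, k, k ω`. -/
def cpatch (k : ℕ) : Set ℂ := {p | 0 ≤ lx p ∧ 0 ≤ ly p ∧ lx p + ly p ≤ k}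

variable {k : ℕ}

theorem InPatch.ctri_subset {x : PlaneDart} (h : InPatch k x) : x.ctri ⊆ cpatch k := by
  obtain ⟨i, hi, hd⟩ := exists_iterate_next_dir x
  have hs : SameTri x (next^[i] x) := (SameTri.refl x).iterate i
  rw [← hs.ctri_eq]
  rw [← inPatch_iterate_next i] at h
  generalize next^[i] x = y at h hd
  obtain ⟨z, u⟩ := y
  dsimp at hd
  intro p hp
  rcases hd with rfl | rfl
  · rw [inPatch_up] at h
    rw [mem_ctri_up] at hp
    have h1 : (0 : ℝ) ≤ z.re := by exact_mod_cast h.1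
    have h2 : (0 : ℝ) ≤ z.im := by exact_mod_cast h.2.1
    have h3 : (z.re + z.im + 1 : ℝ) ≤ k := by exact_mod_cast h.2.2
    exact ⟨by linarith, by linarith, by linarith⟩
  · rw [inPatch_down] at h
    rw [mem_ctri_down] at hp
    have h1 : (1 : ℝ) ≤ z.re := by exact_mod_cast h.1
    have h2 : (1 : ℝ) ≤ z.im := by exact_mod_cast h.2.1
    have h3 : (z.re + z.im : ℝ) ≤ k := by exact_mod_cast h.2.2
    exact ⟨by linarith, by linarith, by linarith⟩

theorem InPatch.tri_subset {x : PlaneDart} (h : InPatch k x) : x.tri ⊆ patch k := by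
  obtain ⟨i, hi, hd⟩ := exists_iterate_next_dir x
  have hs : SameTri x (next^[i] x) := (SameTri.refl x).iterate i
  rw [← hs.tri_eq]
  rw [← inPatch_iterate_next i] at h
  generalize next^[i] x = y at h hd
  obtain ⟨z, u⟩ := y
  dsimp at hd
  intro p hp
  rcases hd with rfl | rfl
  · rw [inPatch_up] at h
    rw [mem_tri_up] at hp
    have h1 : (0 : ℝ) ≤ z.re := by exact_mod_cast h.1
    have h2 : (0 : ℝ) ≤ z.im := by exact_mod_cast h.2.1
    have h3 : (z.re + z.im + 1 : ℝ) ≤ k := by exact_mod_cast h.2.2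
    exact ⟨by linarith, by linarith, by linarith⟩
  · rw [inPatch_down] at h
    rw [mem_tri_down] at hp
    have h1 : (1 : ℝ) ≤ z.re := by exact_mod_cast h.1
    have h2 : (1 : ℝ) ≤ z.im := by exact_mod_cast h.2.1
    have h3 : (z.re + z.im : ℝ) ≤ k := by exact_mod_cast h.2.2
    exact ⟨by linarith, by linarith, by linarith⟩

theorem inPatch_of_mem {x : PlaneDart} {p : ℂ} (hp : p ∈ x.tri) (hk : p ∈ patch k) :
    InPatch k x := by
  obtain ⟨i, hi, hd⟩ := exists_iterate_next_dir x
  have hs : SameTri x (next^[i] x) := (SameTri.refl x).iterate i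
  rw [← hs.tri_eq] at hp
  rw [← inPatch_iterate_next i]
  generalize next^[i] x = y at hp hd
  obtain ⟨z, u⟩ := y
  dsimp at hd
  obtain ⟨h1, h2, h3⟩ := hk
  rcases hd with rfl | rfl
  · rw [inPatch_up]
    rw [mem_tri_up] at hp
    have h4 : (0 : ℝ) < z.re + 1 := by linarith
    have h5 : (0 : ℝ) < z.im + 1 := by linarith
    have h6 : (z.re + z.im : ℝ) < k := by linarith
    norm_cast at h4 h5 h6
    exact ⟨by lia, by lia, h6⟩
  · rw [inPatch_down]
    rw [mem_tri_down] at hp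
    have h4 : (0 : ℝ) < z.re := by linarith
    have h5 : (0 : ℝ) < z.im := by linarith
    have h6 : (z.re + z.im : ℝ) < k + 1 := by linarith
    norm_cast at h4 h5 h6
    exact ⟨by lia, by lia, by lia⟩

theorem openTriangle_eq_patch (hk : 0 < k) :
    openTriangle (toComplex 0) (toComplex k) (toComplex (k * omega)) = patch k := by
  have hk' : (0 : ℝ) < k := by exact_mod_cast hk
  ext p
  simp only [openTriangle, Set.mem_ofPred_eq, cross_pos, patch]
  simp [-toComplex_natCast]
  constructor
  · rintro ⟨a, b, c⟩
    refine ⟨?_, ?_, ?_⟩ <;> nlinarith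
  · rintro ⟨a, b, c⟩
    refine ⟨?_, ?_, ?_⟩ <;> nlinarith

theorem closedTriangle_eq_cpatch (hk : 0 < k) :
    closedTriangle (toComplex 0) (toComplex k) (toComplex (k * omega)) = cpatch k := by
  have hk' : (0 : ℝ) < k := by exact_mod_cast hk
  ext p
  simp only [closedTriangle, Set.mem_ofPred_eq, cross_nonneg, cpatch]
  simp [-toComplex_natCast]
  constructor
  · rintro ⟨a, b, c⟩
    refine ⟨?_, ?_, ?_⟩ <;> nlinarith
  · rintro ⟨a, b, c⟩
    refine ⟨?_, ?_, ?_⟩ <;> nlinarith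

theorem iterate_turn_eq_comp (x : PlaneDart) (i : ℕ) :
    (comp (turn k))^[i] x = comp ((comp (turn k))^[i] base) x := by
  induction i with
  | zero => exact (base_comp x).symm
  | succ i ih => rw [Function.iterate_succ_apply', Function.iterate_succ_apply', ih, comp_assoc]

end PlaneDart

namespace LatticeLabelling

open PlaneDart

variable {D : Type u} {F : Fullerene D} {k : ℕ} (c : LatticeLabelling F k) (hk : 0 < k)

include hk in
-- Two positions with the same image differ by a turn of the patch that fixes `e`; as `bigNext` has
-- no fixed points, the turn is trivial.
theorem eq_of_transport_eq_same {e : c.Dart} {x x' : PlaneDart} (hx : InPatch k x)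
    (hx' : InPatch k x') (h : F.transport x e.1 = F.transport x' e.1) : x = x' := by
  obtain ⟨i, hi, h1, rfl⟩ := c.exists_iterate_of_transport_eq hk hx hx' h
  interval_cases i
  · rfl
  · exact absurd h1.symm (c.bigNext_ne hk e)
  · have h2 := c.bigNext_iterate_three hk e
    change e = c.bigNext hk (c.bigNext hk e) at h1
    rw [← h1] at h2
    exact absurd h2 (c.bigNext_ne hk e)

/-- A representative of the triangle of side `k` on the left of `e`. -/
noncomputable def rep (e : c.Dart) : c.Dart :=
  Quotient.out (Quotient.mk (Equiv.Perm.SameCycle.setoid (c.bigNext hk)) e)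

theorem rep_sameCycle (e : c.Dart) : (c.bigNext hk).SameCycle (c.rep hk e) e :=
  Quotient.exact (Quotient.out_eq (Quotient.mk (Equiv.Perm.SameCycle.setoid (c.bigNext hk)) e))

theorem rep_eq {e e' : c.Dart} (h : (c.bigNext hk).SameCycle e e') : c.rep hk e = c.rep hk e' :=
  congrArg Quotient.out (Quotient.sound (s := Equiv.Perm.SameCycle.setoid (c.bigNext hk)) h)

theorem exists_iterate_rep (e : c.Dart) : ∃ i < 3, e = (c.bigNext hk)^[i] (c.rep hk e) := by
  obtain ⟨n, hn⟩ := c.rep_sameCycle hk e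
  have h3 : (c.bigNext hk) ^ (3 : ℤ) = 1 := by
    ext1 e
    exact c.bigNext_iterate_three hk e
  have hlt := Int.emod_lt_of_pos n (show (0 : ℤ) < 3 by norm_num)
  have hnn := Int.emod_nonneg n (show (3 : ℤ) ≠ 0 by norm_num)
  obtain ⟨i, hi⟩ : ∃ i : ℕ, n % 3 = i := ⟨(n % 3).toNat, by lia⟩
  refine ⟨i, by lia, ?_⟩
  conv_lhs => rw [← hn, ← Int.emod_add_mul_ediv n 3, zpow_add, zpow_mul, h3, one_zpow, mul_one, hi,
    zpow_natCast, Equiv.Perm.coe_pow]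

/-- The position of `e` in the unfolding of the triangle on its left. -/
noncomputable def frame (e : c.Dart) : PlaneDart :=
  (comp (turn k))^[(c.exists_iterate_rep hk e).choose] base

theorem exists_frame (e : c.Dart) : ∃ i < 3, e = (c.bigNext hk)^[i] (c.rep hk e) ∧
    c.frame hk e = (comp (turn k))^[i] base :=
  ⟨_, (c.exists_iterate_rep hk e).choose_spec.1, (c.exists_iterate_rep hk e).choose_spec.2, rfl⟩

theorem inPatch_frame_comp (e : c.Dart) {x : PlaneDart} :
    InPatch k (comp (c.frame hk e) x) ↔ InPatch k x := by
  obtain ⟨i, -, -, h⟩ := c.exists_frame hk e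
  rw [h, ← iterate_turn_eq_comp, inPatch_iterate_turn]

theorem transport_frame_comp (e : c.Dart) {x : PlaneDart} (hx : InPatch k x) :
    F.transport (comp (c.frame hk e) x) (c.rep hk e).1 = F.transport x e.1 := by
  obtain ⟨i, -, he, h⟩ := c.exists_frame hk e
  rw [h, ← iterate_turn_eq_comp, ← c.transport_bigNext_iterate hk _ hx, ← he]

theorem rep_bigNext (e : c.Dart) : c.rep hk (c.bigNext hk e) = c.rep hk e :=
  c.rep_eq hk ⟨-1, by simp⟩

/-- Both sides are positions of the same dart in the patch of the representative, and such a
position is unique. -/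
theorem frame_bigNext (e : c.Dart) :
    c.frame hk (c.bigNext hk e) = comp (c.frame hk e) (turn k) := by
  have hb := base_inPatch hk
  have h := c.transport_frame_comp hk (c.bigNext hk e) hb
  rw [c.transport_bigNext hk e hb, comp_base, comp_base, rep_bigNext,
    ← c.transport_frame_comp hk e (by simpa using inPatch_turn.2 hb)] at h
  apply c.eq_of_transport_eq_same hk _ _ h
  · simpa using (c.inPatch_frame_comp hk (c.bigNext hk e)).2 hb
  · simpa using (c.inPatch_frame_comp hk e).2 (inPatch_turn.2 hb)

/-- The frames of a dart and its successors run through the corners `0, k, k ω` from one of three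
starting points. -/
theorem frame_corners (e : c.Dart) {p : Eisenstein → Eisenstein → Eisenstein → Prop}
    (h0 : p 0 k (k * omega)) (h1 : p k (k * omega) 0) (h2 : p (k * omega) 0 k) :
    p (c.frame hk e).1 (c.frame hk (c.bigNext hk e)).1
      (c.frame hk (c.bigNext hk (c.bigNext hk e))).1 := by
  obtain ⟨i, hi, -, h⟩ := c.exists_frame hk e
  simp only [frame_bigNext, h]
  have e0 : (base : PlaneDart).1 = 0 := rfl
  have e1 : (comp (turn k) base).1 = k := by simp [turn]
  have e2 : (comp (turn k) (comp (turn k) base)).1 = k * omega := by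
    ext <;> simp [comp, turn, base]
  have e3 := turn_turn_turn k base
  interval_cases i
  · simp only [Function.iterate_zero, id, base_comp]
    rw [comp_base] at e1 e2
    rwa [e0, e1, e2]
  · simp only [Function.iterate_one]
    rw [comp_base] at *
    rwa [e2, e1, comp_assoc, e3]
  · simp only [Function.iterate_succ, Function.iterate_zero, Function.comp, id]
    rw [comp_base, comp_assoc] at *
    rwa [e2, e3, e0, base_comp, e1]

theorem facet_frame (e : c.Dart) :
    openTriangle (toComplex (c.frame hk e).1) (toComplex (c.frame hk (c.bigNext hk e)).1)
      (toComplex (c.frame hk (c.bigNext hk (c.bigNext hk e))).1) = patch k := by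
  have h := openTriangle_eq_patch hk
  refine c.frame_corners hk e
    (p := fun A B C => openTriangle (toComplex A) (toComplex B) (toComplex C) = patch k) h ?_ ?_
  · rwa [openTriangle_rotate]
  · rwa [← openTriangle_rotate]

theorem cfacet_frame (e : c.Dart) :
    closedTriangle (toComplex (c.frame hk e).1) (toComplex (c.frame hk (c.bigNext hk e)).1)
      (toComplex (c.frame hk (c.bigNext hk (c.bigNext hk e))).1) = cpatch k := by
  have h := closedTriangle_eq_cpatch hk
  refine c.frame_corners hk e
    (p := fun A B C => closedTriangle (toComplex A) (toComplex B) (toComplex C) = cpatch k) h ?_ ?_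
  · rwa [closedTriangle_rotate]
  · rwa [← closedTriangle_rotate]

theorem meets_frame_iff (e : c.Dart) {x : PlaneDart} :
    Meets (c.frame hk e).1 (c.frame hk (c.bigNext hk e)).1
      (c.frame hk (c.bigNext hk (c.bigNext hk e))).1 x ↔ InPatch k x := by
  rw [Meets, facet_frame]
  constructor
  · rintro ⟨p, hp, hp'⟩
    exact inPatch_of_mem hp hp'
  · intro h
    obtain ⟨p, hp⟩ := tri_nonempty x
    exact ⟨p, hp, h.tri_subset hp⟩

theorem frame_ccw (e : c.Dart) : 0 < cross
    ((c.frame hk (c.bigNext hk e)).1.toComplex - (c.frame hk e).1.toComplex)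
    ((c.frame hk (c.bigNext hk (c.bigNext hk e))).1.toComplex - (c.frame hk e).1.toComplex) := by
  have hk' : (0 : ℝ) < k := by exact_mod_cast hk
  refine c.frame_corners hk e (p := fun A B C => 0 < cross (B.toComplex - A.toComplex)
    (C.toComplex - A.toComplex)) ?_ ?_ ?_ <;> rw [cross_pos] <;> simp [-toComplex_natCast] <;>
    nlinarith

/-- Cutting `F` into the triangles of side `k` at the points of the sublattice. -/
noncomputable def cutting : FacetDecomposition F (c.archetype hk).dual where
  corner e := (c.frame hk e).1
  dev e x := F.transport x (c.rep hk e).1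
  ccw e := by
    rw [archetype_dual_next]; exact c.frame_ccw hk e
  dev_next e := by
    rw [archetype_dual_next, rep_bigNext]
  dev_plane_next e x _ := F.transport_next x _
  dev_plane_flip e x hx hf := by
    rw [archetype_dual_next, meets_frame_iff] at hx hf
    exact transport_flip (c.rep hk e).2 hx hf
  glue e := by
    rw [archetype_dual_next, archetype_dual_flip]
    set e' := c.bigFlip hk e
    set f := c.frame hk e with hf
    set f' := c.frame hk e' with hf'
    -- Bring `e'` to the base position, turn it across the side from `0` to `k`, and bring the base
    -- position to `e`.
    set g := comp f (comp (halfTurn k) (inv f')) with hg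
    have hcomp : ∀ y, comp g (comp f' y) = comp f (comp (halfTurn k) y) := by
      intro y
      rw [hg, comp_assoc, comp_assoc, inv_comp_comp]
    have htail : g.1 + g.2 * f'.1 = (c.frame hk (c.bigNext hk e)).1 := by
      have := congrArg Prod.fst (hcomp base)
      rw [comp_base, comp_base] at this
      rw [frame_bigNext]
      exact this
    have hhead : g.1 + g.2 * (c.frame hk (c.bigNext hk e')).1 = f.1 := by
      have := congrArg Prod.fst (hcomp (turn k))
      rw [← frame_bigNext] at this
      refine this.trans ?_
      simp [comp, halfTurn, turn]
    have hglue : ∀ y : PlaneDart,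
        ((c.frame hk (c.bigNext hk e)).1 + g.2 * (y.1 - f'.1), g.2 * y.2) = comp g y := by
      intro y
      rw [← htail, comp]; ext1 <;> simp; ring
    refine ⟨g.2, by rw [← htail, ← hhead]; ring, fun x y hx hy _ => ?_⟩
    rw [meets_frame_iff] at hx hy
    rw [hglue]
    obtain ⟨x, rfl⟩ : ∃ x', x = comp f x' := ⟨_, (comp_inv_comp f x).symm⟩
    obtain ⟨y, rfl⟩ : ∃ y', y = comp f' y' := ⟨_, (comp_inv_comp f' y).symm⟩
    rw [inPatch_frame_comp] at hx hy
    rw [hcomp, ← comp_flip]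
    have hinj : Function.Injective (comp f) := Function.LeftInverse.injective (inv_comp_comp f)
    rw [hinj.eq_iff, hinj.eq_iff, c.transport_frame_comp hk e hx, c.transport_frame_comp hk e' hy]
    refine ⟨fun h => ?_, fun h => c.transport_bigFlip hk e hx hy h.symm⟩
    -- No small triangle straddles a side of a patch: the half turn moves the neighbouring patch
    -- below the line through `0` and `k`.
    exfalso
    have h1 := hx.2.1
    have h2 := hy.2.1
    rw [← h, centre_comp] at h1
    simp [halfTurn] at h1
    lia
  cover d p hp := by
    obtain ⟨x, hx, e, rfl⟩ := c.exists_inPatch hk d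
    rw [archetype_dual_next]
    refine ⟨e, comp (c.frame hk e) x, c.transport_frame_comp hk e hx, ?_, ?_⟩
    · rw [meets_frame_iff, inPatch_frame_comp]; exact hx
    · rw [cfacet_frame]
      exact ((c.inPatch_frame_comp hk e).2 hx).ctri_subset ⟨p, hp, rfl⟩
  disjoint e e' x x' h p hp hx hx' := by
    rw [archetype_dual_next] at *
    rw [facet_frame] at hx hx'
    have hx := inPatch_of_mem ⟨p, hp, rfl⟩ hx
    have hx' := inPatch_of_mem ⟨p, hp, rfl⟩ hx'
    obtain ⟨i, -, h1, -⟩ := c.exists_iterate_of_transport_eq hk hx hx' h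
    have h2 : (c.bigNext hk).SameCycle e e' :=
      (c.rep_sameCycle hk e).symm.trans (Equiv.Perm.SameCycle.trans
        ⟨i, by rw [zpow_natCast, Equiv.Perm.coe_pow, h1]⟩ (c.rep_sameCycle hk e'))
    rw [← c.rep_eq hk h2] at h
    exact ⟨h2, c.eq_of_transport_eq_same hk hx hx' h⟩

theorem cutting_vec (e : c.Dart) : (c.cutting hk).vec e = (c.frame hk e).2 * k := by
  rw [FacetDecomposition.vec, archetype_dual_next]
  change (c.frame hk (c.bigNext hk e)).1 - (c.frame hk e).1 = _
  rw [frame_bigNext]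
  simp [comp, turn]

theorem isGoldbergCoxeter_archetype : IsGoldbergCoxeter k 0 (c.archetype hk) F := by
  refine ⟨c.cutting hk, fun e => ⟨(c.frame hk e).2, ?_⟩⟩
  rw [cutting_vec]
  congr 1

end LatticeLabelling

/-! ### Continuation of the unfolding across an edge -/

theorem PlaneDart.ctri_subset_closure (x : PlaneDart) : x.ctri ⊆ closure x.tri := fun _ hp =>
  mem_closure_iff_nhds.2 fun _ hU => PlaneDart.inter_tri_nonempty hp hU

theorem PlaneDart.convex_tri (x : PlaneDart) : Convex ℝ x.tri := by
  have h : x.tri = openTriangle (x.place 0) (x.place 1) (x.place (toComplex omega)) := by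
    ext p
    rw [PlaneDart.mem_tri, ← x.place_place_inv p, PlaneDart.place_mem_openTriangle,
      PlaneDart.place_inv_place]
    rfl
  rw [h]; exact convex_openTriangle _ _ _

namespace FacetDecomposition

variable {D : Type u} {M : Type v} {F : Fullerene D} {S : TriSurface M}
  {P : FacetDecomposition F S} {m : M} {g : PlaneDart}

theorem side_pos {p : ℂ} (hp : p ∈ P.facet m) : 0 < P.side m p := hp.1

theorem IsGlue.side_neg (h : P.IsGlue m g) {p : ℂ}
    (hp : (PlaneDart.inv g).place p ∈ P.facet (S.flip m)) : P.side m p < 0 := by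
  have := side_pos hp
  rw [h.side_flip, PlaneDart.place_place_inv] at this
  linarith

theorem side_lerp (p q : ℂ) (t : ℝ) :
    P.side m (p + t * (q - p)) = (1 - t) * P.side m p + t * P.side m q := by
  rw [side, side, side, ← cross_lerp]
  congr 1; ring

theorem eventually_mem_openEdge {q : ℂ} (hq : q ∈ P.openEdge m) :
    ∀ᶠ p in 𝓝 q, P.side m p = 0 → p ∈ P.openEdge m := by
  set A := (P.corner m).toComplex with hA
  set B := (P.corner (S.next m)).toComplex with hB
  have hne : B - A ≠ 0 := sub_ne_zero.2 (P.corner_ne m).symm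
  obtain ⟨t, h0, h1, rfl⟩ := mem_openSegment_iff.1 hq
  have hφ : Continuous fun p : ℂ => ((p - A) / (B - A)).re := by fun_prop
  have ht : ((A + t * (B - A) - A) / (B - A)).re = t := by
    rw [add_sub_cancel_left, mul_div_cancel_right₀ _ hne, Complex.ofReal_re]
  have hev := (hφ.tendsto (A + t * (B - A))).eventually
    (Ioo_mem_nhds (a := 0) (b := 1) (by rw [ht]; exact h0) (by rw [ht]; exact h1))
  filter_upwards [hev] with p hp hs
  refine mem_openSegment_iff.2 ⟨_, hp.1, hp.2, ?_⟩
  have him : ((p - A) / (B - A)).im = 0 := by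
    have hs : cross (B - A) (p - A) = 0 := hs
    rw [cross] at hs
    rw [Complex.div_im, ← sub_div, div_eq_zero_iff]
    left; linarith
  have : (((p - A) / (B - A)).re : ℂ) = (p - A) / (B - A) := Complex.ext (by simp) (by simp [him])
  rw [this, div_mul_cancel₀ _ hne]; ring

/-- If an open convex set has points on both sides of an edge and touches the edge, then it
meets the edge. -/
theorem exists_mem_openEdge_of_sides {B : Set ℂ} (hc : Convex ℝ B) (ho : IsOpen B) {t p p' : ℂ}
    (ht : t ∈ closure B) (hte : t ∈ P.openEdge m) (hp : p ∈ B) (hps : 0 < P.side m p)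
    (hp' : p' ∈ B) (hps' : P.side m p' < 0) : ∃ q ∈ B, q ∈ P.openEdge m := by
  -- By convexity `B` contains a point `r` of the line of the edge. Points just beside `t` on the
  -- segment from `t` to `r` are in `B` and still in the open edge.
  obtain ⟨r, hr, hrs⟩ : ∃ r ∈ B, P.side m r = 0 := by
    have hpos : 0 < P.side m p - P.side m p' := by linarith
    refine ⟨p + (P.side m p / (P.side m p - P.side m p') : ℝ) * (p' - p), ?_, ?_⟩
    · rw [← Complex.real_smul]
      refine hc.add_smul_sub_mem hp hp' ⟨by positivity, ?_⟩
      rw [div_le_one hpos]; linarith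
    · rw [side_lerp]; field_simp; ring
  have hlim : Tendsto (fun s : ℝ => t + s * (r - t)) (𝓝[>] 0) (𝓝 t) := by
    have : Continuous fun s : ℝ => t + s * (r - t) := by fun_prop
    have h := this.tendsto 0
    rw [Complex.ofReal_zero, zero_mul, add_zero] at h
    exact h.mono_left nhdsWithin_le_nhds
  obtain ⟨s, hs, hs'⟩ := ((hlim.eventually (eventually_mem_openEdge hte)).and
    (Ioc_mem_nhdsGT (zero_lt_one' ℝ))).exists
  refine ⟨_, ?_, hs (by rw [side_lerp, hrs, side_eq_zero hte]; simp)⟩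
  rw [← ho.interior_eq, ← Complex.real_smul]
  exact hc.add_smul_sub_mem_interior' ht (by rwa [ho.interior_eq]) hs'

/-- A lattice triangle shown by both facets has points on both sides of the edge; if it touches the
edge, its interior meets it, and `IsGlue.same` applies. -/
theorem IsGlue.same_of_mem_ctri (h : P.IsGlue m g) {x : PlaneDart} {q : ℂ} (hq : q ∈ P.openEdge m)
    (hx : q ∈ x.ctri) (hm : P.MeetsFacet m x)
    (hf : P.MeetsFacet (S.flip m) (PlaneDart.comp (PlaneDart.inv g) x)) :
    P.dev (S.flip m) (PlaneDart.comp (PlaneDart.inv g) x) = P.dev m x := by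
  obtain ⟨p, hp, hpm⟩ := hm
  obtain ⟨p', hp', hpf⟩ := hf
  rw [PlaneDart.tri_comp] at hp'
  obtain ⟨p', hp', rfl⟩ := hp'
  obtain ⟨t, htx, hte⟩ := exists_mem_openEdge_of_sides x.convex_tri x.isOpen_tri
    (x.ctri_subset_closure hx) hq hp (side_pos hpm) hp' (h.side_neg hpf)
  exact h.same hte htx ⟨p, hp, hpm⟩ (h.meets_of_mem hp' hpf)

/-- At a generic point of an edge, the unfoldings of the two facets beside the edge continue each
other. -/
theorem IsGlue.exists_local (h : P.IsGlue m g) {q : ℂ} (hq : q ∈ P.openEdge m)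
    (hL : q ∉ Set.range toComplex) :
    ∃ x : PlaneDart, q ∈ x.ctri ∧ P.MeetsFacet m x ∧
      (P.MeetsFacet (S.flip m) (PlaneDart.comp (PlaneDart.inv g) x) ∧
        P.dev (S.flip m) (PlaneDart.comp (PlaneDart.inv g) x) = P.dev m x ∨
      q ∈ x.openEdge ∧ P.MeetsFacet (S.flip m) (PlaneDart.comp (PlaneDart.inv g) x.flip) ∧
        P.dev (S.flip m) (PlaneDart.comp (PlaneDart.inv g) x.flip) = F.flip (P.dev m x)) := by
  obtain ⟨x, hx, N, hN, hloc⟩ := PlaneDart.exists_local hL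
  have key : ∀ (O : Set ℂ), IsOpen O → q ∈ closure O →
      (x.tri ∩ O).Nonempty ∨ q ∈ x.openEdge ∧ (x.flip.tri ∩ O).Nonempty := by
    intro O hO hqO
    obtain ⟨N', hN', hNo, hqN⟩ := mem_nhds_iff.1 hN
    obtain ⟨y, r, ⟨hrN, hrO⟩, hry⟩ := PlaneDart.exists_tri_inter_nonempty (hNo.inter hO)
      (mem_closure_iff.1 hqO N' hNo hqN)
    rcases hloc y ⟨r, hry, hN' hrN⟩ with hs | ⟨he, hs⟩
    · left
      exact ⟨r, hs.tri_eq ▸ hry, hrO⟩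
    · right
      exact ⟨he, r, hs.tri_eq ▸ hry, hrO⟩
  have hev := h.eventually_mem hq
  have h1 := key (P.facet m) (P.isOpen_facet m) (mem_closure_iff_nhds.2 fun U hU => by
    obtain ⟨p, ⟨hpU, hp⟩, hs⟩ := IsGlue.exists_side_pos (inter_mem hU hev) (side_eq_zero hq)
    exact ⟨p, hpU, hp.1 hs⟩)
  have h2 := key ((PlaneDart.inv g).place ⁻¹' P.facet (S.flip m))
    ((P.isOpen_facet _).preimage (PlaneDart.continuous_place _)) (mem_closure_iff_nhds.2
      fun U hU => by
    obtain ⟨p, ⟨hpU, hp⟩, hs⟩ := IsGlue.exists_side_neg (inter_mem hU hev) (side_eq_zero hq)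
    exact ⟨p, hpU, hp.2 hs⟩)
  have hmeet : ∀ y : PlaneDart, (y.tri ∩ (PlaneDart.inv g).place ⁻¹' P.facet (S.flip m)).Nonempty →
      P.MeetsFacet (S.flip m) (PlaneDart.comp (PlaneDart.inv g) y) := by
    rintro y ⟨r, hr, hr'⟩
    exact h.meets_of_mem hr hr'
  have hqx : q ∈ x.ctri := hx.elim (fun h => x.tri_subset_ctri h) fun h => x.openEdge_subset_ctri h
  -- The cases record which of the lattice triangles at `q` meets the facet on each side of the
  -- edge.
  rcases h1 with h1 | ⟨he, h1⟩ <;> rcases h2 with h2 | ⟨he', h2⟩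
  · exact ⟨x, hqx, h1, Or.inl ⟨hmeet x h2, h.same_of_mem_ctri hq hqx h1 (hmeet x h2)⟩⟩
  · exact ⟨x, hqx, h1, Or.inr ⟨he', hmeet _ h2, h.flip hq he' h1 (hmeet _ h2)⟩⟩
  · have he' : q ∈ x.flip.openEdge := by rwa [PlaneDart.openEdge_flip]
    rw [← x.flip_flip] at h2
    exact ⟨x.flip, PlaneDart.openEdge_subset_ctri _ he', h1,
      Or.inr ⟨he', hmeet _ h2, h.flip hq he' h1 (hmeet _ h2)⟩⟩
  · have he' : q ∈ x.flip.openEdge := by rwa [PlaneDart.openEdge_flip]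
    have hqx := PlaneDart.openEdge_subset_ctri _ he'
    exact ⟨x.flip, hqx, h1, Or.inl ⟨hmeet _ h2, h.same_of_mem_ctri hq hqx h1 (hmeet _ h2)⟩⟩

end FacetDecomposition

/-! ### Scaling by `k`: patches in the plane and quotients of the corners -/

section Scale

variable {k : ℕ} (hk : 0 < k)
include hk

theorem Eisenstein.natCast_mul_cancel {z w : Eisenstein} (h : (k : Eisenstein) * z = k * w) :
    z = w := by
  have hk' : (k : ℤ) ≠ 0 := by exact_mod_cast hk.ne'
  have h1 := congrArg QuadraticAlgebra.re h
  have h2 := congrArg QuadraticAlgebra.im h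
  simp at h1 h2
  exact QuadraticAlgebra.ext (by lia) (by lia)

omit hk in
theorem cross_natCast_mul (z w : ℂ) : cross (k * z) (k * w) = k ^ 2 * cross z w := by
  simp only [cross, Complex.mul_re, Complex.mul_im, Complex.natCast_re, Complex.natCast_im]; ring

theorem scale_mem_openTriangle {A B C p : ℂ} (r : ℂ) :
    k * p + r ∈ openTriangle (k * A + r) (k * B + r) (k * C + r) ↔ p ∈ openTriangle A B C := by
  have hk' : (0 : ℝ) < k ^ 2 := by positivity
  simp only [openTriangle, Set.mem_ofPred_eq, add_sub_add_right_eq_sub, ← mul_sub,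
    cross_natCast_mul, mul_pos_iff_of_pos_left hk']

theorem scale_mem_closedTriangle {A B C p : ℂ} (r : ℂ) :
    k * p + r ∈ closedTriangle (k * A + r) (k * B + r) (k * C + r) ↔
      p ∈ closedTriangle A B C := by
  have hk' : (0 : ℝ) < k ^ 2 := by positivity
  simp only [closedTriangle, Set.mem_ofPred_eq, add_sub_add_right_eq_sub, ← mul_sub,
    cross_natCast_mul, mul_nonneg_iff_of_pos_left hk']

end Scale

namespace PlaneDart

variable {k : ℕ}

theorem natCast_mul_mem_patch (hk : 0 < k) {p : ℂ} : k * p ∈ patch k ↔ p ∈ stdOpen := by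
  have hk' : (0 : ℝ) < k := by exact_mod_cast hk
  rw [mem_stdOpen]
  simp only [patch, Set.mem_ofPred_eq, lx_natCast_mul, ly_natCast_mul]
  rw [← mul_add, mul_pos_iff_of_pos_left hk', mul_pos_iff_of_pos_left hk',
    mul_lt_iff_lt_one_right hk']

theorem natCast_mul_mem_cpatch (hk : 0 < k) {p : ℂ} : k * p ∈ cpatch k ↔ p ∈ stdClosed := by
  have hk' : (0 : ℝ) < k := by exact_mod_cast hk
  rw [mem_stdClosed]
  simp only [cpatch, Set.mem_ofPred_eq, lx_natCast_mul, ly_natCast_mul]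
  rw [← mul_add, mul_nonneg_iff_of_pos_left hk', mul_nonneg_iff_of_pos_left hk',
    mul_le_iff_le_one_right hk']

theorem exists_inPatch_mem_ctri {p : ℂ} (hk : 0 < k) (hp : p ∈ cpatch k) :
    ∃ x, InPatch k x ∧ p ∈ x.ctri := by
  obtain ⟨h1, h2, h3⟩ := hp
  have ha := Int.floor_le (lx p)
  have hb := Int.floor_le (ly p)
  have ha' := Int.lt_floor_add_one (lx p)
  have hb' := Int.lt_floor_add_one (ly p)
  have ha0 := Int.floor_nonneg.2 h1
  have hb0 := Int.floor_nonneg.2 h2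
  generalize ⌊lx p⌋ = a at *
  generalize ⌊ly p⌋ = b at *
  by_cases hs : lx p + ly p ≤ a + b + 1
  · by_cases hab : a + b < k
    · exact ⟨(⟨a, b⟩, 1), inPatch_up.2 ⟨ha0, hb0, hab⟩, mem_ctri_up.2 ⟨ha, hb, hs⟩⟩
    -- Here `p` is a lattice point on the side opposite `0`; an upward triangle having it as a
    -- corner is chosen inside the patch.
    · have hab' : (k : ℝ) ≤ a + b := by exact_mod_cast not_lt.1 hab
      have habk : a + b = k := by
        have : (a + b : ℝ) ≤ k := by linarith
        norm_cast at this
        lia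
      by_cases ha1 : 0 < a
      · refine ⟨(⟨a - 1, b⟩, 1), inPatch_up.2 ⟨?_, hb0, ?_⟩, mem_ctri_up.2 ⟨?_, hb, ?_⟩⟩
        · dsimp; lia
        · dsimp; lia
        · push_cast; linarith
        · push_cast; linarith
      · refine ⟨(⟨a, b - 1⟩, 1), inPatch_up.2 ⟨ha0, ?_, ?_⟩, mem_ctri_up.2 ⟨ha, ?_, ?_⟩⟩
        · dsimp; lia
        · dsimp; lia
        · push_cast; linarith
        · push_cast; linarith
  · rw [not_le] at hs
    have hab : a + b + 1 < k := by
      have : (a + b + 1 : ℝ) < k := by linarith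
      exact_mod_cast this
    refine ⟨(⟨a + 1, b + 1⟩, -1), inPatch_down.2 ⟨?_, ?_, ?_⟩, mem_ctri_down.2 ⟨?_, ?_, ?_⟩⟩
    · dsimp; lia
    · dsimp; lia
    · dsimp; lia
    · push_cast; linarith
    · push_cast; linarith
    · push_cast; linarith

/-- The triangle of side `k` on the left of the dart `W`. -/
def region (k : ℕ) (W : PlaneDart) : Set ℂ := (inv W).place ⁻¹' patch k

theorem mem_region {W : PlaneDart} {p : ℂ} : p ∈ region k W ↔ (inv W).place p ∈ patch k := Iff.rfl

theorem place_mem_region {W : PlaneDart} {p : ℂ} : W.place p ∈ region k W ↔ p ∈ patch k := by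
  rw [mem_region, place_inv_place]

theorem region_eq (hk : 0 < k) (W : PlaneDart) : region k W =
    openTriangle (W.place (toComplex 0)) (W.place (toComplex k)) (W.place (toComplex (k * omega))) := by
  ext p
  rw [mem_region, ← openTriangle_eq_patch hk, ← W.place_mem_openTriangle, place_place_inv]

theorem isOpen_region (hk : 0 < k) (W : PlaneDart) : IsOpen (region k W) := by
  rw [region_eq hk]; exact isOpen_openTriangle _ _ _

theorem convex_region (hk : 0 < k) (W : PlaneDart) : Convex ℝ (region k W) := by
  rw [region_eq hk]; exact convex_openTriangle _ _ _

theorem place_mem_closure_region (hk : 0 < k) {W : PlaneDart} {p : ℂ} (hp : p ∈ cpatch k) :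
    W.place p ∈ closure (region k W) := by
  rw [region_eq hk]
  refine closedTriangle_subset_closure ?_ ?_
  · rw [cross_place, cross_pos]
    have hk' : (0 : ℝ) < k := by exact_mod_cast hk
    simp [-toComplex_natCast]
    positivity
  · rwa [place_mem_closedTriangle, closedTriangle_eq_cpatch hk]

theorem InPatch.comp_tri_subset {x : PlaneDart} (h : InPatch k x) (W : PlaneDart) :
    (comp W x).tri ⊆ region k W := by
  rw [tri_comp]
  rintro _ ⟨p, hp, rfl⟩
  exact place_mem_region.2 (h.tri_subset hp)

theorem inPatch_of_mem_region {W y : PlaneDart} {p : ℂ} (hy : p ∈ y.tri) (hp : p ∈ region k W) :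
    InPatch k (comp (inv W) y) :=
  inPatch_of_mem (place_mem_tri_comp.2 hy) hp

theorem inPatch_of_mem_ctri (hk : 0 < k) {W y : PlaneDart} {p : ℂ} (hy : p ∈ y.ctri)
    (hp : p ∈ region k W) : InPatch k (comp (inv W) y) := by
  obtain ⟨q, hq, hqy⟩ := inter_tri_nonempty hy ((isOpen_region hk W).mem_nhds hp)
  exact inPatch_of_mem_region hqy hq

theorem exists_inPatch_inter_nonempty (hk : 0 < k) {W : PlaneDart} {O : Set ℂ} (hO : IsOpen O)
    (h : (region k W ∩ O).Nonempty) : ∃ x, InPatch k x ∧ ((comp W x).tri ∩ O).Nonempty := by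
  obtain ⟨y, p, ⟨hpW, hpO⟩, hpy⟩ := exists_tri_inter_nonempty ((isOpen_region hk W).inter hO) h
  refine ⟨comp (inv W) y, inPatch_of_mem_region hpy hpW, p, ?_, hpO⟩
  rwa [comp_inv_comp]

/-- At a generic point of the side from `0` to `k` of the triangle with corners `0, k, k ω`. -/
theorem exists_halfTurn_of_mem_side {p : ℂ} (h0 : 0 < lx p) (h1 : lx p < k) (hy : ly p = 0)
    (hL : p ∉ Set.range toComplex) : ∃ x x', InPatch k x ∧ InPatch k x' ∧ p ∈ x.openEdge ∧
      x.flip = comp (halfTurn k) x' := by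
  have ha := Int.floor_le (lx p)
  have ha' := Int.lt_floor_add_one (lx p)
  have ha0 := Int.floor_nonneg.2 h0.le
  have hak : ⌊lx p⌋ < k := by
    have : (⌊lx p⌋ : ℝ) < k := by linarith
    exact_mod_cast this
  generalize ⌊lx p⌋ = a at *
  have hne : (a : ℝ) ≠ lx p := by
    intro h
    exact hL ⟨⟨a, 0⟩, ext_coords (by simpa using h) (by simp [hy])⟩
  refine ⟨(⟨a, 0⟩, 1), (⟨k - 1 - a, 0⟩, 1), inPatch_up.2 ⟨ha0, le_rfl, by simpa⟩,
    inPatch_up.2 ⟨by dsimp; lia, le_rfl, by dsimp; lia⟩, ⟨lx p - a, ?_, by linarith, ?_⟩, ?_⟩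
  · linarith [lt_of_le_of_ne ha hne]
  · apply ext_coords
    · rw [lx_place, lx_ofReal, ly_ofReal]; simp
    · rw [ly_place, lx_ofReal, ly_ofReal]; simp [hy]
  · ext1
    · ext <;> simp [flip_mk, comp, halfTurn]
      ring
    · simp [flip_mk, comp, halfTurn]

/-- Scaling a lattice dart by `k` and translating it by `r`, as the side of a triangle
of side `k`. -/
def blow (k : ℕ) (r : Eisenstein) (X : PlaneDart) : PlaneDart := (k * X.1 + r, X.2)

theorem blow_next (r : Eisenstein) (X : PlaneDart) :
    blow k r X.next = comp (blow k r X) (turn k) := by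
  ext1
  · simp only [blow, next, comp, turn]; ring
  · simp only [blow, next, comp, turn, mul_comm]

theorem blow_flip (r : Eisenstein) (X : PlaneDart) :
    blow k r X.flip = comp (blow k r X) (halfTurn k) := by
  ext1
  · simp only [blow, flip, comp, halfTurn]; ring
  · simp [blow, flip, comp, halfTurn]

theorem blow_place (r : Eisenstein) (X : PlaneDart) (p : ℂ) :
    (blow k r X).place (k * p) = k * X.place p + r.toComplex := by
  simp [blow, place]; ring

theorem blow_injective (hk : 0 < k) (r : Eisenstein) : Function.Injective (blow k r) := by
  intro X Y h
  exact Prod.ext (natCast_mul_cancel hk (add_right_cancel (congrArg Prod.fst h)))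
    (show (blow k r X).2 = (blow k r Y).2 by rw [h])

/-- The map `q ↦ k q + r` takes the unit triangle of `X` to the triangle of side `k` on `blow k r
X`. -/
theorem scale_mem_region (hk : 0 < k) (r : Eisenstein) {X : PlaneDart} {q : ℂ} :
    k * q + r.toComplex ∈ region k (blow k r X) ↔ q ∈ X.tri := by
  have : k * q + r.toComplex = (blow k r X).place (k * (inv X).place q) := by
    rw [blow_place, place_place_inv]
  rw [this, place_mem_region, natCast_mul_mem_patch hk, mem_tri]

end PlaneDart

namespace FacetDecomposition

open PlaneDart

variable {D : Type u} {M : Type v} {F : Fullerene D} {S : TriSurface M}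
  (P : FacetDecomposition F S) (k : ℕ)

/-- The remainder of the corners of a facet modulo `k`. -/
def remainder (m : M) : Eisenstein := ⟨(P.corner m).re % k, (P.corner m).im % k⟩

/-- The quotient of a corner of a facet by `k`. -/
def quotient (m : M) : Eisenstein := ⟨(P.corner m).re / k, (P.corner m).im / k⟩

theorem corner_eq (m : M) : P.corner m = k * P.quotient k m + P.remainder k m := by
  ext <;> simp [quotient, remainder, Int.mul_ediv_add_emod]

/-- The side of a triangle of side `k` in the unfolding of a facet. -/
def bigDart (m : M) (X : PlaneDart) : PlaneDart := blow k (P.remainder k m) X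

variable {P k}
variable (hdvd : ∀ m, (k : Eisenstein) ∣ P.vec m)

include hdvd in
theorem remainder_next (m : M) : P.remainder k (S.next m) = P.remainder k m := by
  obtain ⟨h1, h2⟩ := natCast_dvd_iff.1 (hdvd m)
  exact QuadraticAlgebra.ext (Int.modEq_iff_dvd.2 h1).symm (Int.modEq_iff_dvd.2 h2).symm

include hdvd in
theorem remainder_sameCycle {m m' : M} (h : S.next.SameCycle m m') :
    P.remainder k m' = P.remainder k m := by
  have hperm : ∀ n : ℤ, ∀ m, P.remainder k ((S.next ^ n) m) = P.remainder k m := by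
    intro n
    induction n using Int.induction_on with
    | zero => intro m; rfl
    | succ n ih =>
      intro m
      rw [zpow_add_one, Equiv.Perm.mul_apply, ih, remainder_next hdvd]
    | pred n ih =>
      intro m
      rw [zpow_sub_one, Equiv.Perm.mul_apply, ih, ← remainder_next hdvd]
      simp
  obtain ⟨n, rfl⟩ := h
  exact hperm n m

include hdvd in
theorem corner_next_eq (m : M) :
    P.corner (S.next m) = k * P.quotient k (S.next m) + P.remainder k m := by
  rw [← remainder_next hdvd, ← corner_eq]

variable (hk : 0 < k)

include hdvd hk

theorem scale_mem_facet {m : M} {q : ℂ} :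
    k * q + (P.remainder k m).toComplex ∈ P.facet m ↔
      q ∈ openTriangle (P.quotient k m).toComplex (P.quotient k (S.next m)).toComplex
        (P.quotient k (S.next (S.next m))).toComplex := by
  rw [facet, corner_next_eq hdvd m, corner_next_eq hdvd (S.next m), remainder_next hdvd,
    corner_eq P k m, toComplex_add, toComplex_add, toComplex_add, toComplex_mul, toComplex_mul,
    toComplex_mul, toComplex_natCast, scale_mem_openTriangle hk]

theorem scale_mem_cfacet {m : M} {q : ℂ} :
    k * q + (P.remainder k m).toComplex ∈ P.cfacet m ↔
      q ∈ closedTriangle (P.quotient k m).toComplex (P.quotient k (S.next m)).toComplex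
        (P.quotient k (S.next (S.next m))).toComplex := by
  rw [cfacet, corner_next_eq hdvd m, corner_next_eq hdvd (S.next m), remainder_next hdvd,
    corner_eq P k m, toComplex_add, toComplex_add, toComplex_add, toComplex_mul, toComplex_mul,
    toComplex_mul, toComplex_natCast, scale_mem_closedTriangle hk]

theorem scale_mem_openEdge {m : M} {q : ℂ} :
    k * q + (P.remainder k m).toComplex ∈ P.openEdge m ↔
      q ∈ openSegment ℝ (P.quotient k m).toComplex (P.quotient k (S.next m)).toComplex := by
  have hk' : (k : ℂ) ≠ 0 := by exact_mod_cast hk.ne'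
  rw [openEdge, corner_next_eq hdvd m, corner_eq P k m, mem_openSegment_iff, mem_openSegment_iff]
  simp only [toComplex_add, toComplex_mul, toComplex_natCast]
  refine exists_congr fun t => and_congr_right fun _ => and_congr_right fun _ => ?_
  constructor
  · intro h
    apply mul_left_cancel₀ hk'
    linear_combination h
  · rintro rfl
    ring

/-- A triangle of side `k` meets the interior of a facet. -/
theorem small_meets_iff {m : M} {X : PlaneDart} :
    Meets (P.quotient k m) (P.quotient k (S.next m)) (P.quotient k (S.next (S.next m))) X ↔
      (region k (P.bigDart k m X) ∩ P.facet m).Nonempty := by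
  have hk' : (k : ℂ) ≠ 0 := by exact_mod_cast hk.ne'
  constructor
  · rintro ⟨q, hq, hq'⟩
    exact ⟨_, (scale_mem_region hk _).2 hq, (scale_mem_facet hdvd hk).2 hq'⟩
  · rintro ⟨p, hp, hp'⟩
    obtain ⟨q, rfl⟩ : ∃ q, p = k * q + (P.remainder k m).toComplex :=
      ⟨(p - (P.remainder k m).toComplex) / k, by field_simp; ring⟩
    exact ⟨q, (scale_mem_region hk _).1 hp, (scale_mem_facet hdvd hk).1 hp'⟩

omit hdvd in
theorem region_meets_iff {m : M} {W : PlaneDart} :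
    (region k W ∩ P.facet m).Nonempty ↔ ∃ x, InPatch k x ∧ P.MeetsFacet m (comp W x) := by
  constructor
  · exact exists_inPatch_inter_nonempty hk (P.isOpen_facet m)
  · rintro ⟨x, hx, p, hp, hpf⟩
    exact ⟨p, hx.comp_tri_subset W hp, hpf⟩

end FacetDecomposition

/-! ### Triangles of side `k` in the unfolded facets -/

namespace FacetDecomposition

open PlaneDart LatticeLabelling

variable {D : Type u} {M : Type v} {F : Fullerene D} {S : TriSurface M}
  {P : FacetDecomposition F S} {k : ℕ} {c : LatticeLabelling F k}

variable (P c) in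
/-- The unfolding of the facet on the left of `m` takes the triangle of side `k` on the left of
`e` to the one on the left of `W`. -/
def Unfolds (m : M) (W : PlaneDart) (e : c.Dart) : Prop :=
  ∀ x, InPatch k x → P.MeetsFacet m (comp W x) → F.transport x e.1 = P.dev m (comp W x)

theorem Unfolds.eq {m : M} {W : PlaneDart} {e e' : c.Dart} (h : Unfolds P c m W e) {x : PlaneDart}
    (hx : InPatch k x) (hm : P.MeetsFacet m (comp W x))
    (h' : F.transport x e'.1 = P.dev m (comp W x)) : e' = e :=
  Subtype.ext ((F.transport x).injective (h'.trans (h x hx hm).symm))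

/-- The patch and the facet meet in an open convex set, and both unfoldings respect `next` and
`flip` there; agreement at one small triangle spreads by `convex_induction`. -/
theorem unfolds_of_eq (hk : 0 < k) {m : M} {W : PlaneDart} {e : c.Dart} {x : PlaneDart}
    (hx : InPatch k x) (hm : P.MeetsFacet m (comp W x))
    (h : F.transport x e.1 = P.dev m (comp W x)) : Unfolds P c m W e := by
  intro y hy hmy
  have hO : IsOpen (region k W ∩ P.facet m) := (isOpen_region hk W).inter (P.isOpen_facet m)
  have hconv : Convex ℝ (region k W ∩ P.facet m) := (convex_region hk W).inter (P.convex_facet m)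
  have hin : ∀ y, InPatch k y → P.MeetsFacet m (comp W y) →
      ((comp W y).tri ∩ (region k W ∩ P.facet m)).Nonempty := by
    rintro y hy ⟨p, hp, hpm⟩
    exact ⟨p, hp, hy.comp_tri_subset W hp, hpm⟩
  have hout : ∀ y, (y.tri ∩ (region k W ∩ P.facet m)).Nonempty →
      InPatch k (comp (inv W) y) ∧ P.MeetsFacet m y := by
    rintro y ⟨p, hp, hpW, hpm⟩
    exact ⟨inPatch_of_mem_region hp hpW, p, hp, hpm⟩
  have := convex_induction hO hconv
    (fun y => F.transport (comp (inv W) y) e.1 = P.dev m y) ?_ ?_ (hin x hx hm) (hin y hy hmy) ?_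
  · rwa [inv_comp_comp] at this
  · intro y hy h
    rw [comp_next, F.transport_next, h, P.dev_plane_next' (hout y hy).2]
  · intro y hy hf h
    have hf' := hout _ hf
    rw [comp_flip] at hf' ⊢
    rw [transport_flip e.2 (hout y hy).1 hf'.1, h, P.dev_flip (hout y hy).2 hf'.2]
  · rwa [inv_comp_comp]

section

variable (hk : 0 < k) (hc : ∀ m x, P.MeetsFacet m x → c.val (P.dev m x) = x.label k (P.corner m))
include hk hc

/-- Pull back along `transport` a dart that the facet shows in the patch. Its label is measured from
a corner of the facet, which differs from the corners of the patch by multiples of `k`, so the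
result has label `0`. If the patch misses the facet, the condition is empty and any dart serves. -/
theorem exists_unfolds (m : M) (X : PlaneDart) :
    ∃ e, Unfolds P c m (P.bigDart k m X) e := by
  by_cases hx : ∃ x, InPatch k x ∧ P.MeetsFacet m (comp (P.bigDart k m X) x)
  · obtain ⟨x, hx, hm⟩ := hx
    obtain ⟨e, he⟩ := c.exists_transport_eq x (P.dev m (comp (P.bigDart k m X) x)) (by
      rw [hc _ _ hm, label, ← map_mul, residue_eq_iff]
      rw [corner_eq P k m]
      refine ⟨((X.2⁻¹ : Eisensteinˣ) : Eisenstein) * (X.1 - P.quotient k m), ?_⟩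
      simp only [comp, bigDart, blow, mul_inv, Units.val_mul]
      have h1 := x.2.mul_inv
      have h2 := X.2.mul_inv
      linear_combination ((k : Eisenstein) * X.1 + X.2 * x.1 - k * P.quotient k m) *
        ((X.2⁻¹ : Eisensteinˣ) : Eisenstein) * h1 + x.1 * h2)
    exact ⟨e, unfolds_of_eq hk hx hm he⟩
  · obtain ⟨-, -, e, -⟩ := c.exists_inPatch hk (P.dev m base)
    exact ⟨e, fun y hy hm => absurd ⟨y, hy, hm⟩ hx⟩

end

end FacetDecomposition

namespace PlaneDart

variable {k : ℕ}

theorem halfTurn_halfTurn (W : PlaneDart) : comp (comp W (halfTurn k)) (halfTurn k) = W := by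
  ext1
  · simp [comp, halfTurn]
  · simp [comp, halfTurn]

theorem place_halfTurn (W : PlaneDart) (p : ℂ) :
    (comp W (halfTurn k)).place (k - p) = W.place p := by
  rw [place_comp]; congr 1
  simp [place, halfTurn]

theorem mem_region_comp {g W : PlaneDart} {p : ℂ} :
    (inv g).place p ∈ region k (comp (inv g) W) ↔ p ∈ region k W := by
  obtain ⟨q, rfl⟩ : ∃ q, p = W.place q := ⟨_, (place_place_inv W p).symm⟩
  rw [← place_comp, place_mem_region, place_mem_region]

theorem region_comp_inter_nonempty {g W : PlaneDart} {O : Set ℂ} :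
    (region k (comp (inv g) W) ∩ O).Nonempty ↔ ∃ p ∈ region k W, (inv g).place p ∈ O := by
  constructor
  · rintro ⟨q, hq, hqO⟩
    rw [← place_inv_place g q] at hq hqO
    exact ⟨_, mem_region_comp.1 hq, hqO⟩
  · rintro ⟨p, hp, hpO⟩
    exact ⟨_, mem_region_comp.2 hp, hpO⟩

theorem lx_natCast (k : ℕ) : lx k = k := by rw [← toComplex_natCast, lx_toComplex]; simp
theorem ly_natCast (k : ℕ) : ly k = 0 := by rw [← toComplex_natCast, ly_toComplex]; simp

theorem exists_side_notMem_lattice (hk : 0 < k) {W : PlaneDart} {r : ℂ} (h0 : 0 < lx r)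
    (h1 : lx r < k) (hy : ly r = 0) {U : Set ℂ} (hU : U ∈ 𝓝 (W.place r)) :
    ∃ s, 0 < lx s ∧ lx s < k ∧ ly s = 0 ∧ W.place s ∈ U ∧ W.place s ∉ Set.range toComplex := by
  have hk' : (0 : ℝ) < k := by exact_mod_cast hk
  have e1 := lx_natCast k
  have e2 := ly_natCast k
  have hseg : W.place r ∈ openSegment ℝ (W.place 0) (W.place k) := by
    refine mem_openSegment_iff.2 ⟨lx r / k, by positivity, (div_lt_one hk').2 h1, ?_⟩
    rw [← place_lineMap]
    congr 1
    apply ext_coords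
    · simp only [lx_add, lx_ofReal_mul, lx_sub, e1, lx_zero]; field_simp; ring
    · simp only [ly_add, ly_ofReal_mul, ly_sub, e2, ly_zero, hy]; ring
  have hne : W.place 0 ≠ W.place k := by
    intro h
    have h := congrArg (inv W).place h
    rw [place_inv_place, place_inv_place] at h
    exact hk.ne' (by exact_mod_cast h.symm)
  obtain ⟨T, hTm, hT, hTL⟩ := exists_mem_openSegment_notMem_lattice hne hseg hU
    countable_range_toComplex
  obtain ⟨s, hs0, hs1, rfl⟩ := mem_openSegment_iff.1 hT
  rw [← place_lineMap] at hTm hTL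
  refine ⟨_, ?_, ?_, ?_, hTm, hTL⟩
  · simp only [lx_add, lx_ofReal_mul, lx_sub, e1, lx_zero]; nlinarith
  · simp only [lx_add, lx_ofReal_mul, lx_sub, e1, lx_zero]; nlinarith
  · simp only [ly_add, ly_ofReal_mul, ly_sub, e2, ly_zero]; ring

end PlaneDart

namespace FacetDecomposition

open PlaneDart LatticeLabelling

variable {D : Type u} {M : Type v} {F : Fullerene D} {S : TriSurface M}
  {P : FacetDecomposition F S} {k : ℕ} {c : LatticeLabelling F k} {m : M} {W : PlaneDart}
  {e e' : c.Dart} (hk : 0 < k)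

include hk

theorem Unfolds.unique (h : Unfolds P c m W e) (h' : Unfolds P c m W e')
    (hm : (region k W ∩ P.facet m).Nonempty) : e' = e := by
  obtain ⟨x, hx, hmx⟩ := (region_meets_iff hk).1 hm
  exact h.eq hx hmx (h' x hx hmx)

theorem Unfolds.next (h : Unfolds P c m W e) :
    Unfolds P c m (comp W (turn k)) (c.bigNext hk e) := by
  intro x hx hm
  rw [comp_assoc] at *
  rw [c.transport_bigNext hk e hx, h _ (inPatch_turn.2 hx) hm]

/-- At a generic point of the common side inside the facet, the facet shows the small triangles on
both sides; `transport_bigFlip` compares them. -/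
theorem Unfolds.flip_of_mem_side (h : Unfolds P c m W e) {p : ℂ} (h0 : 0 < lx p) (h1 : lx p < k)
    (hy : ly p = 0) (hL : W.place p ∉ Set.range toComplex) (hp : W.place p ∈ P.facet m) :
    Unfolds P c m (comp W (halfTurn k)) (c.bigFlip hk e) := by
  obtain ⟨x, x', hx, hx', hpx, hxx⟩ := exists_halfTurn_of_mem_side h0 h1 hy (by
    rintro ⟨z, rfl⟩
    exact hL ⟨_, (place_toComplex W z).symm⟩)
  have hm : P.MeetsFacet m (comp W x) := P.meetsFacet_of_mem_nhds
    (place_mem_ctri_comp.2 (x.openEdge_subset_ctri hpx)) hp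
  have hm' : P.MeetsFacet m (comp W x.flip) := P.meetsFacet_of_mem_nhds
    (place_mem_ctri_comp.2 (x.flip.openEdge_subset_ctri (x.openEdge_flip ▸ hpx))) hp
  refine unfolds_of_eq hk hx' (by rwa [comp_assoc, ← hxx]) ?_
  rw [c.transport_bigFlip hk e hx hx' hxx, h x hx hm, comp_assoc, ← hxx, comp_flip, P.dev_flip hm]
  rwa [← comp_flip]

/-- A segment inside the convex facet from one patch to the other crosses their common side between
its end points. The crossing point may be moved off the lattice along the side, after which
`Unfolds.flip_of_mem_side` applies. -/
theorem Unfolds.flip (h : Unfolds P c m W e) (hm : (region k W ∩ P.facet m).Nonempty)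
    (hm' : (region k (comp W (halfTurn k)) ∩ P.facet m).Nonempty) :
    Unfolds P c m (comp W (halfTurn k)) (c.bigFlip hk e) := by
  have hk' : (0 : ℝ) < k := by exact_mod_cast hk
  obtain ⟨p, hp, hpm⟩ := hm
  obtain ⟨p', hp', hpm'⟩ := hm'
  obtain ⟨q, rfl⟩ : ∃ q, p = W.place q := ⟨_, (place_place_inv W p).symm⟩
  obtain ⟨q', rfl⟩ : ∃ q', p' = W.place q' := ⟨_, (place_place_inv W p').symm⟩
  rw [place_mem_region] at hp
  have hp' : (k : ℂ) - q' ∈ patch k := by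
    rw [← place_halfTurn (k := k), place_mem_region] at hp'; exact hp'
  obtain ⟨a1, a2, a3⟩ := hp
  obtain ⟨b1, b2, b3⟩ := hp'
  have e1 := lx_natCast k
  have e2 := ly_natCast k
  simp only [lx_sub, ly_sub, e1, e2] at b1 b2 b3
  set t : ℝ := ly q / (ly q - ly q') with ht
  have hd : 0 < ly q - ly q' := by linarith
  have ht0 : 0 < t := by positivity
  have ht1 : t < 1 := by rw [ht, div_lt_one hd]; linarith
  set r : ℂ := q + t * (q' - q) with hr
  have hry : ly r = 0 := by
    rw [hr, ly_add, ly_ofReal_mul, ly_sub, ht]; field_simp; ring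
  have hrx : lx r = (1 - t) * lx q + t * lx q' := by
    rw [hr, lx_add, lx_ofReal_mul, lx_sub]; ring
  have hry' : (1 - t) * ly q + t * ly q' = 0 := by
    rw [← hry, hr, ly_add, ly_ofReal_mul, ly_sub]; ring
  have hr0 : 0 < lx r := by
    rw [hrx]
    nlinarith [mul_pos ht0 (show 0 < lx q' + ly q' by linarith), mul_pos (sub_pos.2 ht1) a1,
      mul_pos (sub_pos.2 ht1) a2]
  have hr1 : lx r < k := by
    rw [hrx]
    nlinarith [mul_pos ht0 b1, mul_pos (sub_pos.2 ht1) (show 0 < k - (lx q + ly q) by linarith),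
      mul_pos ht0 (show 0 < -ly q' by linarith)]
  have hrm : W.place r ∈ P.facet m := by
    rw [hr, place_lineMap, ← Complex.real_smul]
    exact (P.convex_facet m).add_smul_sub_mem hpm hpm' ⟨ht0.le, ht1.le⟩
  obtain ⟨s, hs0, hs1, hs, hsm, hsL⟩ := exists_side_notMem_lattice hk hr0 hr1 hry
    ((P.isOpen_facet m).mem_nhds hrm)
  exact h.flip_of_mem_side hk hs0 hs1 hs hsL hsm

variable {g : PlaneDart}

/-- The patch meets both facets and touches the edge, so its interior contains a point of the edge.
At a generic such point the facets continue each other, and one small triangle there identifies the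
two darts. -/
theorem IsGlue.unfolds_same (hg : P.IsGlue m g) (h : Unfolds P c m W e)
    (h' : Unfolds P c (S.flip m) (comp (inv g) W) e') (hm : (region k W ∩ P.facet m).Nonempty)
    (hm' : (region k (comp (inv g) W) ∩ P.facet (S.flip m)).Nonempty) {t : ℂ}
    (ht : t ∈ closure (region k W)) (hte : t ∈ P.openEdge m) : e' = e := by
  obtain ⟨p, hp, hpm⟩ := hm
  obtain ⟨p', hp', hpm'⟩ := region_comp_inter_nonempty.1 hm'
  obtain ⟨r, hr, hre⟩ := exists_mem_openEdge_of_sides (convex_region hk W) (isOpen_region hk W) ht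
    hte hp (side_pos hpm) hp' (hg.side_neg hpm')
  obtain ⟨q, hqW, hq, hL⟩ := exists_mem_openSegment_notMem_lattice (P.corner_ne m) hre
    ((isOpen_region hk W).mem_nhds hr) countable_range_toComplex
  obtain ⟨x, hqx, hmx, hx⟩ := hg.exists_local hq hL
  have ha := inPatch_of_mem_ctri hk hqx hqW
  obtain ⟨a, rfl⟩ : ∃ a, x = comp W a := ⟨_, (comp_inv_comp W x).symm⟩
  rw [inv_comp_comp] at ha
  rcases hx with ⟨hf, hd⟩ | ⟨hqe, hf, hd⟩
  · rw [← comp_assoc] at hf hd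
    exact Subtype.ext ((F.transport a).injective
      ((h' a ha hf).trans (hd.trans (h a ha hmx).symm)))
  · have ha' := inPatch_of_mem_ctri hk
      (openEdge_subset_ctri _ ((openEdge_flip (comp W a)).symm ▸ hqe)) hqW
    rw [← comp_flip] at ha' hf hd
    rw [inv_comp_comp] at ha'
    rw [← comp_assoc] at hf hd
    refine Subtype.ext ((F.transport a.flip).injective ((h' _ ha' hf).trans ?_))
    rw [hd, ← h a ha hmx, transport_flip e.2 ha ha']

theorem nonneg_side_of_notMem (hc : ∀ q ∈ region k W, q ∉ P.openEdge m) {t : ℂ}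
    (ht : t ∈ closure (region k W)) (hte : t ∈ P.openEdge m) {p : ℂ} (hp : p ∈ region k W)
    (hpm : 0 < P.side m p) : ∀ q ∈ closure (region k W), 0 ≤ P.side m q := by
  refine closure_minimal (t := {q | 0 ≤ P.side m q}) (fun q hq => ?_)
    (isClosed_le continuous_const (continuous_side m))
  by_contra hneg
  obtain ⟨r, hr, hre⟩ := exists_mem_openEdge_of_sides (convex_region hk W) (isOpen_region hk W) ht
    hte hp hpm hq (not_le.1 hneg)
  exact hc r hr hre

theorem nonpos_side_of_notMem (hc : ∀ q ∈ region k W, q ∉ P.openEdge m) {t : ℂ}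
    (ht : t ∈ closure (region k W)) (hte : t ∈ P.openEdge m) {p : ℂ} (hp : p ∈ region k W)
    (hpm : P.side m p < 0) : ∀ q ∈ closure (region k W), P.side m q ≤ 0 := by
  refine closure_minimal (t := {q | P.side m q ≤ 0}) (fun q hq => ?_)
    (isClosed_le (continuous_side m) continuous_const)
  by_contra hneg
  obtain ⟨r, hr, hre⟩ := exists_mem_openEdge_of_sides (convex_region hk W) (isOpen_region hk W) ht
    hte hq (not_le.1 hneg) hp hpm
  exact hc r hr hre

omit hk in
theorem exists_side_ne_zero {O : Set ℂ} (hO : IsOpen O) (hne : O.Nonempty) :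
    ∃ p ∈ O, P.side m p ≠ 0 := exists_cross_ne (P.corner_ne m) hO hne

/-- If the edge enters one of the two patches, that patch is seen in both facets, and the claim is
`Unfolds.flip` inside one facet combined with `IsGlue.unfolds_same`. Otherwise the common side of
the patches lies along the edge, and the facets are compared at a generic point there. -/
theorem IsGlue.unfolds_flip (hg : P.IsGlue m g) (h : Unfolds P c m W e)
    (h' : Unfolds P c (S.flip m) (comp (inv g) (comp W (halfTurn k))) e')
    (hm : (region k W ∩ P.facet m).Nonempty)
    (hm' : (region k (comp (inv g) (comp W (halfTurn k))) ∩ P.facet (S.flip m)).Nonempty) {s : ℂ}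
    (hs0 : 0 ≤ lx s) (hs1 : lx s ≤ k) (hs : ly s = 0) (hse : W.place s ∈ P.openEdge m) :
    e' = c.bigFlip hk e := by
  have hk' : (0 : ℝ) < k := by exact_mod_cast hk
  have hcl : ∀ {s : ℂ}, 0 ≤ lx s → lx s ≤ k → ly s = 0 → W.place s ∈ closure (region k W) :=
    fun h0 h1 h => place_mem_closure_region hk ⟨h0, h.ge, by rw [h, add_zero]; exact h1⟩
  have hcl' : ∀ {s : ℂ}, 0 ≤ lx s → lx s ≤ k → ly s = 0 →
      W.place s ∈ closure (region k (comp W (halfTurn k))) := by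
    intro s h0 h1 h
    rw [← place_halfTurn (k := k)]
    refine place_mem_closure_region hk ⟨?_, ?_, ?_⟩ <;>
      simp only [lx_sub, ly_sub, lx_natCast, ly_natCast] <;> linarith
  have hev := fun {q : ℂ} (hq : q ∈ P.openEdge m) => hg.eventually_mem hq
  obtain ⟨p, hp, hpm⟩ := hm
  obtain ⟨p', hp', hpm'⟩ := region_comp_inter_nonempty.1 hm'
  by_cases hc : ∃ q ∈ region k W, q ∈ P.openEdge m
  · obtain ⟨q, hq, hqe⟩ := hc
    obtain ⟨r, ⟨hrW, hr⟩, hrs⟩ := IsGlue.exists_side_neg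
      (inter_mem ((isOpen_region hk W).mem_nhds hq) (hev hqe)) (side_eq_zero hqe)
    have hmW : (region k (comp (inv g) W) ∩ P.facet (S.flip m)).Nonempty :=
      region_comp_inter_nonempty.2 ⟨r, hrW, hr.2 hrs⟩
    rw [← comp_assoc] at h' hm'
    have h1 := h'.flip hk hm' (by rwa [halfTurn_halfTurn])
    rw [halfTurn_halfTurn] at h1
    rw [← hg.unfolds_same hk h h1 ⟨p, hp, hpm⟩ hmW (hcl hs0 hs1 hs) hse, c.bigFlip_bigFlip]
  by_cases hc' : ∃ q ∈ region k (comp W (halfTurn k)), q ∈ P.openEdge m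
  · obtain ⟨q, hq, hqe⟩ := hc'
    obtain ⟨r, ⟨hrW, hr⟩, hrs⟩ := IsGlue.exists_side_pos
      (inter_mem ((isOpen_region hk _).mem_nhds hq) (hev hqe)) (side_eq_zero hqe)
    have hmW : (region k (comp W (halfTurn k)) ∩ P.facet m).Nonempty := ⟨r, hrW, hr.1 hrs⟩
    exact hg.unfolds_same hk (h.flip hk ⟨p, hp, hpm⟩ hmW) h' hmW hm' (hcl' hs0 hs1 hs) hse
  push Not at hc hc'
  -- The closed patches lie on opposite sides of the line of the edge, so their common side lies on
  -- this line.
  have hpos := nonneg_side_of_notMem hk hc (hcl hs0 hs1 hs) hse hp (side_pos hpm)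
  have hneg := nonpos_side_of_notMem hk hc' (hcl' hs0 hs1 hs) hse hp' (hg.side_neg hpm')
  have hzero : ∀ {s : ℂ}, 0 ≤ lx s → lx s ≤ k → ly s = 0 → P.side m (W.place s) = 0 :=
    fun h0 h1 h => le_antisymm (hneg _ (hcl' h0 h1 h)) (hpos _ (hcl h0 h1 h))
  -- The contact point `s` may be an end of the side; moving it slightly towards the midpoint `k /
  -- 2` keeps it in the open edge.
  obtain ⟨r, hr0, hr1, hr, hre⟩ : ∃ r, 0 < lx r ∧ lx r < k ∧ ly r = 0 ∧
      W.place r ∈ P.openEdge m := by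
    have hcont : Continuous fun a : ℝ => W.place (s + a * ((k / 2 : ℝ) - s)) :=
      W.continuous_place.comp (by fun_prop)
    have hlim := hcont.tendsto 0
    rw [Complex.ofReal_zero, zero_mul, add_zero] at hlim
    obtain ⟨a, ha, ha0, ha1⟩ := (((hlim.mono_left nhdsWithin_le_nhds).eventually
      (eventually_mem_openEdge hse)).and (Ioc_mem_nhdsGT (zero_lt_one' ℝ))).exists
    have hx : lx (s + a * ((k / 2 : ℝ) - s)) = lx s + a * (k / 2 - lx s) := by
      rw [lx_add, lx_ofReal_mul, lx_sub, lx_ofReal]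
    have hy : ly (s + a * ((k / 2 : ℝ) - s)) = 0 := by
      rw [ly_add, ly_ofReal_mul, ly_sub, ly_ofReal, hs]; ring
    have hx0 : 0 < lx s + a * (k / 2 - lx s) := by
      nlinarith [mul_nonneg (sub_nonneg.2 ha1) hs0, mul_pos ha0 hk']
    have hx1 : lx s + a * (k / 2 - lx s) < k := by
      nlinarith [mul_nonneg (sub_nonneg.2 ha1) (sub_nonneg.2 hs1), mul_pos ha0 hk']
    rw [← hx] at hx0 hx1
    exact ⟨_, hx0, hx1, hy, ha (hzero hx0.le hx1.le hy)⟩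
  obtain ⟨t, ht0, ht1, ht, htU, htL⟩ := exists_side_notMem_lattice hk hr0 hr1 hr
    (eventually_mem_openEdge hre)
  have hte := htU (hzero ht0.le ht1.le ht)
  obtain ⟨x, x', hx, hx', htx, hxx⟩ := exists_halfTurn_of_mem_side ht0 ht1 ht (by
    rintro ⟨z, rfl⟩
    exact htL ⟨_, (place_toComplex W z).symm⟩)
  have hTx : W.place t ∈ (comp W x).ctri := place_mem_ctri_comp.2 (x.openEdge_subset_ctri htx)
  have hTx' : W.place t ∈ (comp W x).flip.ctri := by
    rw [← comp_flip]
    exact place_mem_ctri_comp.2 (x.flip.openEdge_subset_ctri (x.openEdge_flip ▸ htx))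
  have hflip : (comp W x).flip = comp (comp W (halfTurn k)) x' := by
    rw [← comp_flip, hxx, comp_assoc]
  obtain ⟨N, hN, hNo, hTN⟩ := mem_nhds_iff.1 (hev hte)
  have hmx : P.MeetsFacet m (comp W x) := by
    obtain ⟨q, ⟨hqN, hqx⟩, hq⟩ := exists_side_ne_zero (P := P) (m := m)
      (hNo.inter (isOpen_tri (comp W x))) (inter_tri_nonempty hTx (hNo.mem_nhds hTN))
    have := hpos q (subset_closure (hx.comp_tri_subset W hqx))
    exact ⟨q, hqx, (hN hqN).1 (lt_of_le_of_ne this hq.symm)⟩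
  have hmx' : P.MeetsFacet (S.flip m) (comp (inv g) (comp W x).flip) := by
    obtain ⟨q, ⟨hqN, hqx⟩, hq⟩ := exists_side_ne_zero (P := P) (m := m)
      (hNo.inter (isOpen_tri (comp W x).flip)) (inter_tri_nonempty hTx' (hNo.mem_nhds hTN))
    have := hneg q (subset_closure (hx'.comp_tri_subset _ (hflip ▸ hqx)))
    exact hg.meets_of_mem hqx ((hN hqN).2 (lt_of_le_of_ne this hq))
  have hd := hg.flip hte (x := comp W x) (by
    obtain ⟨a, ha0, ha1, ha⟩ := htx
    exact ⟨a, ha0, ha1, by rw [place_comp, ha]⟩) hmx hmx'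
  rw [hflip, ← comp_assoc] at hd hmx'
  refine Subtype.ext ((F.transport x').injective ((h' x' hx' hmx').trans ?_))
  rw [hd, c.transport_bigFlip hk e hx hx' hxx, h x hx hmx]

end FacetDecomposition

/-! ### Descent of the polyhedron to the archetype -/

/-- The six sectors are cones, so scaling selects the same branch. -/
theorem Eisenstein.coxeter_natCast_mul {k : ℕ} (hk : 0 < k) (z : Eisenstein) :
    coxeter (k * z) = (k * (coxeter z).1, k * (coxeter z).2) := by
  have hk' : (0 : ℤ) < k := by exact_mod_cast hk
  have h1 : ∀ a : ℤ, 0 < k * a ↔ 0 < a := fun a => mul_pos_iff_of_pos_left hk'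
  have h2 : ∀ a : ℤ, 0 ≤ k * a ↔ 0 ≤ a := fun a => mul_nonneg_iff_of_pos_left hk'
  have h3 : ∀ a : ℤ, k * a < 0 ↔ a < 0 := fun a => by
    have := h2 a
    lia
  have h4 : ∀ a : ℤ, k * a ≤ 0 ↔ a ≤ 0 := fun a => by
    have := h1 a
    lia
  have h5 : ∀ a : ℤ, (k * a).toNat = k * a.toNat := fun a => by
    rcases le_total 0 a with h | h
    · lift a to ℕ using h
      rw [← Nat.cast_mul, Int.toNat_natCast, Int.toNat_natCast]
    · rw [Int.toNat_of_nonpos ((h4 a).2 h), Int.toNat_of_nonpos h, mul_zero]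
  obtain ⟨a, b⟩ := z
  have e : (k : Eisenstein) * ⟨a, b⟩ = ⟨k * a, k * b⟩ := by ext <;> simp
  rw [e]
  simp only [coxeter, ← mul_add, ← mul_neg, ← mul_sub, h1, h2, h3, h4, h5]
  split_ifs <;> rfl

namespace FacetDecomposition

open PlaneDart LatticeLabelling

variable {D : Type u} {M : Type v} {F : Fullerene D} {S : TriSurface M}
  (P : FacetDecomposition F S) {k : ℕ} (c : LatticeLabelling F k) (hk : 0 < k)

include P hk in
theorem nonempty_dart (m : M) : Nonempty c.Dart :=
  let ⟨_, _, e, _⟩ := c.exists_inPatch hk (P.dev m base)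
  ⟨e⟩

/-- The unfolding of the facets that are scaled down by `k`. -/
noncomputable def smallDev (m : M) (X : PlaneDart) : c.Dart :=
  @Classical.epsilon _ (P.nonempty_dart c hk m) (Unfolds P c m (P.bigDart k m X))

variable (hdvd : ∀ m, (k : Eisenstein) ∣ P.vec m)
  (hc : ∀ m x, P.MeetsFacet m x → c.val (P.dev m x) = x.label k (P.corner m))

include hc in
theorem unfolds_smallDev (m : M) (X : PlaneDart) :
    Unfolds P c m (P.bigDart k m X) (P.smallDev c hk m X) :=
  Classical.epsilon_spec (exists_unfolds hk hc m X)

include hdvd in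
theorem bigDart_next (m : M) (X : PlaneDart) :
    P.bigDart k (S.next m) X = P.bigDart k m X := by
  rw [bigDart, remainder_next hdvd, bigDart]

include hdvd in
theorem smallDev_next (m : M) : P.smallDev c hk (S.next m) = P.smallDev c hk m := by
  funext X
  have : Unfolds P c (S.next m) (P.bigDart k m X) = Unfolds P c m (P.bigDart k m X) := by
    funext e
    simp only [Unfolds, MeetsFacet, P.facet_next, P.dev_next]
  simp only [smallDev, P.bigDart_next hdvd, this]

include hdvd in
-- The motion that glues the shrunken facets corresponds to `g` itself, although the two facets may
-- have different remainders: these are absorbed in the translation of `g`.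
theorem IsGlue.bigDart_comp {m : M} {g : PlaneDart}
    (hg : P.IsGlue m g) (y : PlaneDart) :
    P.bigDart k m (P.quotient k (S.next m) + g.2 * (y.1 - P.quotient k (S.flip m)), g.2 * y.2) =
      comp g (P.bigDart k (S.flip m) y) := by
  have h := hg.tail
  rw [corner_next_eq hdvd, P.corner_eq k] at h
  ext1
  · simp only [bigDart, blow, comp]
    linear_combination -h
  · rfl

include hk hdvd in
theorem ccw_quotient (m : M) : 0 < cross
    ((P.quotient k (S.next m)).toComplex - (P.quotient k m).toComplex)
    ((P.quotient k (S.next (S.next m))).toComplex - (P.quotient k m).toComplex) := by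
  have h := P.ccw m
  have hk' : (0 : ℝ) < k ^ 2 := by positivity
  rw [corner_next_eq hdvd m, corner_next_eq hdvd (S.next m), remainder_next hdvd,
    corner_eq P k m] at h
  simp only [toComplex_add, toComplex_mul, toComplex_natCast, add_sub_add_right_eq_sub, ← mul_sub,
    cross_natCast_mul, mul_pos_iff_of_pos_left hk'] at h
  exact h

/-- The facets of `P`, scaled down by `k`, as a decomposition of the archetype. -/
noncomputable def descend : FacetDecomposition (c.archetype hk) S where
  corner := P.quotient k
  dev := P.smallDev c hk
  ccw := P.ccw_quotient hk hdvd
  dev_next := P.smallDev_next c hk hdvd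
  dev_plane_next m X hX := by
    rw [archetype_dual_next]
    have hX' : (region k (P.bigDart k m X.next) ∩ P.facet m).Nonempty :=
      (small_meets_iff hdvd hk).1 (by rwa [Meets, ← tri, tri_next])
    have h := (P.unfolds_smallDev c hk hc m X).next hk
    rw [bigDart, ← blow_next] at h
    exact h.unique hk (P.unfolds_smallDev c hk hc m X.next) hX'
  dev_plane_flip m X hX hf := by
    rw [archetype_dual_flip]
    rw [small_meets_iff hdvd hk] at hX hf
    have hf' := hf
    rw [bigDart, blow_flip] at hf'
    have h := (P.unfolds_smallDev c hk hc m X).flip hk hX hf'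
    rw [bigDart, ← blow_flip] at h
    exact h.unique hk (P.unfolds_smallDev c hk hc m X.flip) hf
  glue m := by
    obtain ⟨g, hg⟩ := P.exists_isGlue m
    refine ⟨g.2, ?_, fun X Y hX hY hXm => ?_⟩
    · have h1 := hg.tail
      have h2 := hg.head
      rw [corner_next_eq hdvd m, corner_eq P k (S.flip m)] at h1
      rw [corner_next_eq hdvd (S.flip m), corner_eq P k m] at h2
      apply natCast_mul_cancel hk
      linear_combination h2 - h1
    rw [small_meets_iff hdvd hk] at hX hY
    obtain ⟨t, htX, htm⟩ := hXm
    have hcomp := IsGlue.bigDart_comp P hdvd hg Y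
    -- The contact point of the shrunken edge with `X`, scaled up, as a point of the side of the
    -- patch.
    obtain ⟨s, hs0, hs1, hs, hsm⟩ : ∃ s, 0 ≤ lx s ∧ lx s ≤ k ∧ ly s = 0 ∧
        (P.bigDart k m X).place s ∈ P.openEdge m := by
      rw [segment_eq_image_lineMap] at htX
      obtain ⟨a, ⟨ha0, ha1⟩, rfl⟩ := htX
      refine ⟨k * (a : ℂ), ?_, ?_, ?_, ?_⟩
      · rw [lx_natCast_mul, lx_ofReal]; positivity
      · rw [lx_natCast_mul, lx_ofReal]
        exact mul_le_of_le_one_right (Nat.cast_nonneg _) ha1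
      · rw [ly_natCast_mul, ly_ofReal, mul_zero]
      · rw [bigDart, blow_place, scale_mem_openEdge hdvd hk]
        convert htm using 1
        rw [AffineMap.lineMap_apply_module', Complex.real_smul, ← place_one, ← place_zero,
          add_comm, ← place_lineMap]
        simp
    have hu := P.unfolds_smallDev c hk hc m X
    have hu' := P.unfolds_smallDev c hk hc (S.flip m) Y
    have hY' : P.bigDart k (S.flip m) Y = comp (inv g) (comp g (P.bigDart k (S.flip m) Y)) :=
      (inv_comp_comp _ _).symm
    rw [← hcomp] at hY'
    rw [hY'] at hu' hY
    refine ⟨fun h => ?_, fun h => ?_⟩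
    · rw [h] at hu' hY
      refine hg.unfolds_same hk hu hu' hX hY (place_mem_closure_region hk ⟨hs0, hs.ge, ?_⟩) hsm
      rw [hs, add_zero]; exact hs1
    · rw [archetype_dual_flip]
      rw [h, bigDart, blow_flip] at hu' hY
      exact hg.unfolds_flip hk hu hu' hX hY hs0 hs1 hs hsm
  cover e p hp := by
    obtain ⟨x, hx, p₁, hp₁, hpx⟩ := exists_inPatch_mem_ctri hk ((natCast_mul_mem_cpatch hk).2 hp)
    obtain ⟨m, y, hd, hm, hy⟩ := P.cover (F.transport x e.1) p₁ hp₁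
    change P.MeetsFacet m y at hm
    -- The patch around `y` is based at `comp y (inv x)`. That this is a scaled dart, with the
    -- remainder of the facet, follows from the label: the patch starts at label `0`.
    obtain ⟨X, hX⟩ : ∃ X, P.bigDart k m X = comp y (inv x) := by
      have h1 := c.val_transport x e.1
      rw [← hd, hc m y hm, e.2, zero_add, label, ← map_mul, residue_eq_iff, corner_eq P k m] at h1
      obtain ⟨w, hw⟩ := h1
      refine ⟨(P.quotient k m + y.2 * (x.2⁻¹ : Eisensteinˣ) * w, y.2 * x.2⁻¹), ?_⟩
      have h2 := x.2.mul_inv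
      have h3 := y.2.mul_inv
      ext1
      · simp only [bigDart, blow, comp, inv]
        linear_combination (-(y.2 : Eisenstein) * (x.2⁻¹ : Eisensteinˣ)) * hw +
          (y.1 - k * P.quotient k m - P.remainder k m) * (y.2 * (y.2⁻¹ : Eisensteinˣ) * h2 + h3)
      · rfl
    have hy' : y = comp (P.bigDart k m X) x := by
      rw [hX, comp_assoc, inv_comp_self, comp_base]
    rw [hy'] at hm hd
    refine ⟨m, X, ?_, ?_, ?_⟩
    · exact ((P.unfolds_smallDev c hk hc m X).eq hx hm hd.symm).symm
    · exact (small_meets_iff hdvd hk).2 ((region_meets_iff hk).2 ⟨x, hx, hm⟩)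
    · rw [← scale_mem_cfacet hdvd hk, ← blow_place]
      change (P.bigDart k m X).place _ ∈ _
      rw [hX, place_comp, ← hpx, place_inv_place]
      exact hy
  disjoint m m' X X' h p hp hX hX' := by
    rw [← scale_mem_facet hdvd hk, ← blow_place] at hX hX'
    have hO : IsOpen (patch k ∩ ((P.bigDart k m X).place ⁻¹' P.facet m ∩
        (P.bigDart k m' X').place ⁻¹' P.facet m')) := by
      refine IsOpen.inter ?_ (((P.isOpen_facet m).preimage (continuous_place _)).inter
        ((P.isOpen_facet m').preimage (continuous_place _)))
      rw [← openTriangle_eq_patch hk]; exact isOpen_openTriangle _ _ _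
    -- The overlap of two shrunken facets becomes an open set in the patch, so it reaches the
    -- interior of a small triangle, to which `disjoint` for `P` applies.
    obtain ⟨x, q, ⟨hq, hqm, hqm'⟩, q₁, hq₁, rfl⟩ := exists_tri_inter_nonempty hO
      ⟨k * p, (natCast_mul_mem_patch hk).2 hp, hX, hX'⟩
    have hx : InPatch k x := inPatch_of_mem ⟨q₁, hq₁, rfl⟩ hq
    have hmem : ∀ {m X}, (P.bigDart k m X).place (x.place q₁) ∈ P.facet m →
        P.MeetsFacet m (comp (P.bigDart k m X) x) :=
      fun h => ⟨_, place_mem_tri_comp.2 ⟨q₁, hq₁, rfl⟩, h⟩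
    have h1 := P.unfolds_smallDev c hk hc m X x hx (hmem hqm)
    have h2 := unfolds_smallDev P c hk hc m' X' x hx (hmem hqm')
    rw [← h, h1] at h2
    obtain ⟨h3, h4⟩ := P.disjoint m m' _ _ h2 q₁ hq₁ (by rw [place_comp]; exact hqm)
      (by rw [place_comp]; exact hqm')
    refine ⟨h3, blow_injective hk (P.remainder k m) ?_⟩
    have h5 := congrArg (fun W => comp W (inv x)) h4
    simp only [comp_assoc, comp_inv_self, comp_base] at h5
    rw [bigDart, bigDart, remainder_sameCycle hdvd h3] at h5
    exact h5

/-- Contracting by `1 / k` towards the corner keeps points inside the facet and takes the patch at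
the corner to its first small triangle. So the facet shows the base dart of the patch at the corner,
where `hP` gives a pentagon. -/
theorem isMaster_descend (hP : P.IsMaster) : (P.descend c hk hdvd hc).IsMaster := by
  intro m X hX htail
  change Meets (P.quotient k m) (P.quotient k (S.next m)) (P.quotient k (S.next (S.next m))) X at hX
  change X.1 = P.quotient k m at htail
  rw [small_meets_iff hdvd hk] at hX
  have hcorner : (P.bigDart k m X).tail = P.corner m := by
    rw [P.corner_eq k, ← htail]; rfl
  obtain ⟨p, hp, hpm⟩ := hX
  obtain ⟨q, rfl⟩ : ∃ q, p = (P.bigDart k m X).place (k * q) :=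
    ⟨(inv (P.bigDart k m X)).place p / k, by
      have hk' : (k : ℂ) ≠ 0 := by exact_mod_cast hk.ne'
      rw [mul_div_cancel₀ _ hk', place_place_inv]⟩
  rw [place_mem_region, natCast_mul_mem_patch hk] at hp
  have hk' : (0 : ℝ) < k := by exact_mod_cast hk
  have hm : P.MeetsFacet m (P.bigDart k m X) := by
    refine ⟨_, ⟨q, hp, rfl⟩, ?_⟩
    have hA : (P.corner m).toComplex ∈ closure (P.facet m) := by
      refine closedTriangle_subset_closure (P.ccw m) ⟨?_, ?_, ?_⟩
      · simp [cross]
      · rw [cross_rotate]; exact (P.ccw m).le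
      · simp [cross]; linarith
    have := (P.convex_facet m).add_smul_sub_mem_interior' hA
      ((P.isOpen_facet m).interior_eq.symm ▸ hpm) (t := 1 / k) ⟨by positivity, by
        rw [div_le_one hk']; exact_mod_cast hk⟩
    rw [(P.isOpen_facet m).interior_eq, ← hcorner, ← place_zero, Complex.real_smul,
      ← place_lineMap] at this
    have hkc : (k : ℂ) ≠ 0 := by exact_mod_cast hk.ne'
    convert this using 2
    push_cast
    field_simp
    ring
  have hd := P.unfolds_smallDev c hk hc m X base (base_inPatch hk) (by rwa [comp_base])
  rw [F.transport_base, comp_base] at hd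
  rw [archetype_onPentagon]
  change F.OnPentagon (P.smallDev c hk m X).1
  rw [hd]
  exact hP m _ hm hcorner

theorem coxeter_descend (m : M) : (P.vec m).coxeter =
    (k * ((P.descend c hk hdvd hc).vec m).coxeter.1,
      k * ((P.descend c hk hdvd hc).vec m).coxeter.2) := by
  rw [← coxeter_natCast_mul hk]
  congr 1
  change _ = k * (P.quotient k (S.next m) - P.quotient k m)
  rw [vec, corner_next_eq hdvd, corner_eq P k m]
  ring

end FacetDecomposition

theorem theorem1 {D : Type u} {M : Type v} [Finite M] (F : Fullerene D) (S : TriSurface M)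
    (P : FacetDecomposition F S) (hP : P.IsMaster) (k : ℕ) (hk : 1 < k)
    (hdvd : ∀ m : M, k ∣ (P.vec m).coxeter.1 ∧ k ∣ (P.vec m).coxeter.2) :
    F.IsGoldbergCoxeterFullerene ∧
    ∃ (D₀ : Type u) (F₀ : Fullerene D₀) (P₀ : FacetDecomposition F₀ S),
      P₀.IsMaster ∧
      (∀ m : M, (P.vec m).coxeter = (k * (P₀.vec m).coxeter.1, k * (P₀.vec m).coxeter.2)) ∧
      IsGoldbergCoxeter k 0 F₀ F := by
  have hk0 : 0 < k := by lia
  have hdvd' : ∀ m, (k : Eisenstein) ∣ P.vec m := fun m => dvd_of_dvd_coxeter (hdvd m)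
  obtain ⟨c, hc⟩ := P.exists_latticeLabelling hdvd'
  refine ⟨⟨k, 0, c.Dart, c.archetype hk0, ?_, c.isGoldbergCoxeter_archetype hk0⟩,
    c.Dart, c.archetype hk0, P.descend c hk0 hdvd' hc, P.isMaster_descend c hk0 hdvd' hc hP,
    P.coxeter_descend c hk0 hdvd' hc, c.isGoldbergCoxeter_archetype hk0⟩
  nlinarith
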